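/- Let $n\ge 1$ and let $\Omega\subset\mathbb R^n$ be bounded and open. The summation convention is used and $\mathcal D(\Omega)=C_c^\infty(\Omega)$. For $\varphi\in\mathcal D(\mathbb R^n)$ let $$D^s\varphi(x)=c_{s,n}\int_{\mathbb R^n}\frac{\varphi(x+z)-\varphi(x)}{|z|^{n+s+1}}\,z\,dz\quad(0<s<1),\qquad c_{s,n}=\frac{2^s\pi^{-n/2}\,\Gamma(\frac{n+s+1}2)}{\Gamma(\frac{1-s}2)},\qquad D^1\varphi=\nabla\varphi .$$ **Assumptions.** $\mu\neq0$ is a finite measure on $(0,1]$ whose support is bounded away from $0$. The matrix $\mathcal A(s,x)=[a^{ij}(s,x)]$ and the functions $a^i(s,x)$, $b^i(s,x)$, $a(x)$ are real and measurable. For all $s\in(0,1]$ and $x,\xi,\psi\in\mathbb R^n$ the following holds: * $\mathcal A(s,x)$ is positive definite (not necessarily symmetric), and $\lambda(x)|\xi|^2\le \xi^T\mathcal A(s,x)\xi\le\Lambda(x)|\xi|^2$ with functions $\lambda,\Lambda:\mathbb R^n\to[0,\infty)$ such that, for some $R,C,\delta>0$ and $p<n$, $\Lambda\in L^1(B_R)$,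 $\Lambda(x)\le C|x|^p$ for $x\notin B_R$, and $\lambda^{-1}\in L^{1+\delta}_{\rm loc}(\mathbb R^n)$; * $|\xi^T\mathcal A(s,x)\psi|^2\le K_{\mathcal A}\,(\xi^T\mathcal A(s,x)\xi)(\psi^T\mathcal A(s,x)\psi)$ for a constant $K_{\mathcal A}>0$; * $|(\mathcal A(s,x)^{-1})^{ij}|\le b^{ij}(x)$, $|a^i(s,x)|\le a^i(x)$, $|b^i(s,x)|\le b^i(x)$ for functions $b^{ij}(x)$, $a^i(x)$, $b^i(x)$ of $x$ only. Let $H^0(\mathcal A,\Omega)$ be the closure (completion) of $\mathcal D(\Omega)$ for the scalar product $\langle u,v\rangle=\int_{\mathbb R^n}\int_{(0,1]}a_S^{ij}(s,x)D^s_iu\,D^s_jv\,d\mu(s)\,dx$, where $[a_S^{ij}]$ is the symmetric part of $\mathcal A$, and let $(H^0(\mathcal A,\Omega))'$ be its dual. Let $$f(x)=b^{ij}(x)\big(a^i(x)a^j(x)+b^i(x)b^j(x)\big)+|a(x)|$$ be compactly bounded on $H^0(\mathcal A,\Omega)$: $f$ is nonnegative and measurable on $\Omega$, and for every $\epsilon>0$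 there is $K_\epsilon\ge0$ with $\int_\Omega f\varphi^2\,dx\le\epsilon\|\varphi\|^2_{H^0(\mathcal A,\Omega)}+K_\epsilon\|\varphi\|_{L^1(\Omega)}^2$ for all $\varphi\in\mathcal D(\Omega)$. **Theorem.** The identity on $\mathcal D(\Omega)$ extends to a continuous injection of $H^0(\mathcal A,\Omega)$ into $L^1(\mathbb R^n)$, so that the elements of $H^0(\mathcal A,\Omega)$ are functions $u$, with fractional gradients $D^su$ obtained as limits. The forms $$(\mathcal Lu,v)=\int_{\mathbb R^n}\int_{(0,1]}\big(a^{ij}D^s_ju\,D^s_iv+a^iu\,D^s_iv+b^iv\,D^s_iu\big)\,d\mu(s)\,dx+\int_\Omega a\,uv\,dx,$$ $$(\mathcal L^*u,v)=\int_{\mathbb R^n}\int_{(0,1]}\big(a^{ji}D^s_ju\,D^s_iv+b^iu\,D^s_iv+a^iv\,D^s_iu\big)\,d\mu(s)\,dx+\int_\Omega a\,uv\,dx,$$ $$(\mathcal I(f)u,v)=\int_\Omega f\,uv\,dx$$ converge absolutely for $u,v\in H^0(\mathcal A,\Omega)$ and define bounded operators $\mathcal L,\mathcal L^*,\mathcal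 I(f):H^0(\mathcal A,\Omega)\to(H^0(\mathcal A,\Omega))'$. Put $\mathcal L_\sigma(f)=\mathcal L+\sigma\mathcal I(f)$ and $\mathcal L^*_\sigma(f)=\mathcal L^*+\sigma\mathcal I(f)$. Then there are $\sigma_0\in\mathbb R$ and a countable set $\Sigma\subset(-\infty,\sigma_0)$ without accumulation points in $\mathbb R$ such that: 1. for every real $\sigma\notin\Sigma$, $\mathcal L_\sigma(f)$ is a bijection from $H^0(\mathcal A,\Omega)$ onto $(H^0(\mathcal A,\Omega))'$; 2. for every $\sigma\in\Sigma$, the kernels of $\mathcal L_\sigma(f)$ and $\mathcal L_\sigma^*(f)$ are nontrivial and have the same finite dimension; 3. for every $\sigma\in\mathbb R$ and $T\in(H^0(\mathcal A,\Omega))'$, the equation $\mathcal L_\sigma(f)u=T$ has a solution $u\in H^0(\mathcal A,\Omega)$ if and only if $\langle T,u^*\rangle=0$ for every $u^*\in H^0(\mathcal A,\Omega)$ with $\mathcal L^*_\sigma(f)u^*=0$. -/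

import Mathlib

open MeasureTheory Set Filter Topology
open scoped Distributions

noncomputable section

namespace NonlocalFredholm

/-- The Euclidean space `ℝⁿ`. -/
abbrev Eucl (n : ℕ) : Type := EuclideanSpace ℝ (Fin n)

/-- The constant `c_{s,n} = 2^s π^{-n/2} Γ((n+s+1)/2) / Γ((1-s)/2)`, used for `0 < s < 1`. -/
def fracConst (n : ℕ) (s : ℝ) : ℝ :=
  2 ^ s * Real.pi ^ (-(n : ℝ) / 2) * Real.Gamma ((n + s + 1) / 2) / Real.Gamma ((1 - s) / 2)

/-- The fractional gradient `Dˢφ(x) = c_{s,n} ∫ (φ(x+z) - φ(x)) z / |z|^{n+s+1} dz` of order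
`s ∈ (0,1)` of a test function (the integral converges absolutely), and `D¹φ = ∇φ`. -/
def fracGrad {n : ℕ} (s : ℝ) (φ : Eucl n → ℝ) (x : Eucl n) : Eucl n :=
  if s = 1 then gradient φ x
  else fracConst n s • ∫ z : Eucl n, ((φ (x + z) - φ x) / ‖z‖ ^ ((n : ℝ) + s + 1)) • z

/-- The coefficients of the operator
`𝓛u = ∫ (-Dˢᵢ(a^{ij}(s,x) Dˢⱼu + aⁱ(s,x) u) + bⁱ(s,x) Dˢᵢu) dμ(s) + a(x) u`
on `ℝⁿ`, with the standing assumptions on them. -/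
structure Coefficients (n : ℕ) where
  /-- the measure weighing the orders `s` -/
  μ : Measure ℝ
  /-- the matrix `𝒜(s,x) = [a^{ij}(s,x)]` -/
  A : ℝ → Eucl n → Matrix (Fin n) (Fin n) ℝ
  /-- the coefficients `aⁱ(s,x)` -/
  a : ℝ → Eucl n → Fin n → ℝ
  /-- the coefficients `bⁱ(s,x)` -/
  b : ℝ → Eucl n → Fin n → ℝ
  /-- the zero order coefficient `a(x)` -/
  a₀ : Eucl n → ℝ
  /-- the bounds `b^{ij}(x)` for the entries of the inverse of `𝒜(s,x)`, uniform in `s` -/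
  Bbd : Eucl n → Matrix (Fin n) (Fin n) ℝ
  /-- the bounds `aⁱ(x)`, uniform in `s` -/
  abd : Eucl n → Fin n → ℝ
  /-- the bounds `bⁱ(x)`, uniform in `s` -/
  bbd : Eucl n → Fin n → ℝ
  finite_μ : IsFiniteMeasure μ
  μ_ne_zero : μ ≠ 0
  /-- `μ` lives on `(0,1]`, away from `0` -/
  support_μ : ∃ s₀ : ℝ, 0 < s₀ ∧ μ (Icc s₀ 1)ᶜ = 0
  aemeasurable_A : ∀ i j, AEMeasurable (fun p : ℝ × Eucl n => A p.1 p.2 i j) (μ.prod volume)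
  aemeasurable_a : ∀ i, AEMeasurable (fun p : ℝ × Eucl n => a p.1 p.2 i) (μ.prod volume)
  aemeasurable_b : ∀ i, AEMeasurable (fun p : ℝ × Eucl n => b p.1 p.2 i) (μ.prod volume)
  /-- `𝒜` is positive definite (not necessarily symmetric) -/
  posDef_A : ∀ s ∈ Ioc (0 : ℝ) 1, ∀ x ξ : Eucl n, ξ ≠ 0 → 0 < ∑ i, ∑ j, A s x i j * ξ i * ξ j
  /-- nonuniform ellipticity bounds `λ` and `Λ`: `Λ` is integrable on a ball `B_R` and grows at
  most like `|x|^p`, `p < n`, outside it, and `λ⁻¹ ∈ L^{1+δ}_loc` -/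
  elliptic : ∃ lam Lam : Eucl n → ℝ, (∀ x, 0 ≤ lam x) ∧ (∀ x, 0 ≤ Lam x) ∧
    (∀ s ∈ Ioc (0 : ℝ) 1, ∀ x ξ : Eucl n,
      lam x * ‖ξ‖ ^ 2 ≤ ∑ i, ∑ j, A s x i j * ξ i * ξ j ∧
      ∑ i, ∑ j, A s x i j * ξ i * ξ j ≤ Lam x * ‖ξ‖ ^ 2) ∧
    ∃ R C δ p : ℝ, 0 < R ∧ 0 < C ∧ 0 < δ ∧ p < n ∧
      IntegrableOn Lam (Metric.ball 0 R) ∧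
      (∀ x ∉ Metric.ball (0 : Eucl n) R, Lam x ≤ C * ‖x‖ ^ p) ∧
      AEMeasurable lam ∧
      ∀ K : Set (Eucl n), IsCompact K → (∫⁻ x in K, (ENNReal.ofReal (lam x))⁻¹ ^ (1 + δ)) < ⊤
  /-- `|ξᵀ𝒜ψ|² ≤ K_𝒜 (ξᵀ𝒜ξ)(ψᵀ𝒜ψ)` -/
  sector : ∃ KA : ℝ, 0 < KA ∧ ∀ s ∈ Ioc (0 : ℝ) 1, ∀ x ξ ψ : Eucl n,
    |∑ i, ∑ j, A s x i j * ξ i * ψ j| ^ 2 ≤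
      KA * (∑ i, ∑ j, A s x i j * ξ i * ξ j) * (∑ i, ∑ j, A s x i j * ψ i * ψ j)
  le_Bbd : ∀ s ∈ Ioc (0 : ℝ) 1, ∀ x i j, |(A s x)⁻¹ i j| ≤ Bbd x i j
  le_abd : ∀ s ∈ Ioc (0 : ℝ) 1, ∀ x i, |a s x i| ≤ abd x i
  le_bbd : ∀ s ∈ Ioc (0 : ℝ) 1, ∀ x i, |b s x i| ≤ bbd x i

namespace Coefficients

variable {n : ℕ} (D : Coefficients n)

instance : IsFiniteMeasure D.μ := D.finite_μ

/-- The measure `dμ(s) dx`. -/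
abbrev prodMeas : Measure (ℝ × Eucl n) := D.μ.prod volume

/-- `f(x) = b^{ij}(x) (aⁱ(x) aʲ(x) + bⁱ(x) bʲ(x)) + |a(x)|`. -/
def f (x : Eucl n) : ℝ :=
  ∑ i, ∑ j, D.Bbd x i j * (D.abd x i * D.abd x j + D.bbd x i * D.bbd x j) + |D.a₀ x|

/-- The bilinear form `a_S^{ij}(s,x) ξᵢ ηⱼ`, with `[a_S^{ij}]` the symmetric part of `𝒜`. -/
def bilS (p : ℝ × Eucl n) (ξ η : Eucl n) : ℝ :=
  ∑ i, ∑ j, (D.A p.1 p.2 i j + D.A p.1 p.2 j i) / 2 * ξ i * η j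

theorem bilS_comm (p : ℝ × Eucl n) (ξ η : Eucl n) : D.bilS p ξ η = D.bilS p η ξ := by
  unfold bilS
  rw [Finset.sum_comm]
  refine Finset.sum_congr rfl fun i _ => Finset.sum_congr rfl fun j _ => ?_
  ring

theorem bilS_add_left (p : ℝ × Eucl n) (ξ ξ' η : Eucl n) :
    D.bilS p (ξ + ξ') η = D.bilS p ξ η + D.bilS p ξ' η := by
  unfold bilS
  simp only [← Finset.sum_add_distrib, PiLp.add_apply]
  refine Finset.sum_congr rfl fun i _ => Finset.sum_congr rfl fun j _ => ?_
  ring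

theorem bilS_smul_left (p : ℝ × Eucl n) (r : ℝ) (ξ η : Eucl n) :
    D.bilS p (r • ξ) η = r * D.bilS p ξ η := by
  unfold bilS
  simp only [Finset.mul_sum, PiLp.smul_apply, smul_eq_mul]
  refine Finset.sum_congr rfl fun i _ => Finset.sum_congr rfl fun j _ => ?_
  ring

theorem bilS_add_right (p : ℝ × Eucl n) (ξ η η' : Eucl n) :
    D.bilS p ξ (η + η') = D.bilS p ξ η + D.bilS p ξ η' := by
  rw [bilS_comm, bilS_add_left, bilS_comm D p η, bilS_comm D p η']

theorem bilS_smul_right (p : ℝ × Eucl n) (r : ℝ) (ξ η : Eucl n) :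
    D.bilS p ξ (r • η) = r * D.bilS p ξ η := by
  rw [bilS_comm, bilS_smul_left, bilS_comm D p η]

theorem bilS_self (p : ℝ × Eucl n) (ξ : Eucl n) :
    D.bilS p ξ ξ = ∑ i, ∑ j, D.A p.1 p.2 i j * ξ i * ξ j := by
  have h : ∑ i, ∑ j, D.A p.1 p.2 j i * ξ i * ξ j = ∑ i, ∑ j, D.A p.1 p.2 i j * ξ i * ξ j := by
    rw [Finset.sum_comm]
    refine Finset.sum_congr rfl fun i _ => Finset.sum_congr rfl fun j _ => ?_
    ring
  have h2 : D.bilS p ξ ξ = (∑ i, ∑ j, D.A p.1 p.2 i j * ξ i * ξ j) / 2 +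
      (∑ i, ∑ j, D.A p.1 p.2 j i * ξ i * ξ j) / 2 := by
    unfold bilS
    simp only [Finset.sum_div, ← Finset.sum_add_distrib]
    refine Finset.sum_congr rfl fun i _ => Finset.sum_congr rfl fun j _ => ?_
    ring
  rw [h2, h]
  ring

theorem ae_mem : ∀ᵐ p ∂D.prodMeas, p.1 ∈ Ioc (0 : ℝ) 1 := by
  obtain ⟨s₀, h0, hs⟩ := D.support_μ
  have h : ∀ᵐ s ∂D.μ, s ∈ Ioc (0 : ℝ) 1 := by
    have : ∀ᵐ s ∂D.μ, s ∈ Icc s₀ 1 := by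
      rw [ae_iff]
      exact hs
    filter_upwards [this] with s hs
    exact ⟨h0.trans_le hs.1, hs.2⟩
  exact Measure.quasiMeasurePreserving_fst.ae h

theorem bilS_pos {p : ℝ × Eucl n} (hp : p.1 ∈ Ioc (0 : ℝ) 1) {ξ : Eucl n} (hξ : ξ ≠ 0) :
    0 < D.bilS p ξ ξ := by
  rw [bilS_self]
  exact D.posDef_A _ hp _ _ hξ

theorem bilS_nonneg {p : ℝ × Eucl n} (hp : p.1 ∈ Ioc (0 : ℝ) 1) (ξ : Eucl n) :
    0 ≤ D.bilS p ξ ξ := by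
  by_cases h : ξ = 0
  · subst h
    simp [bilS]
  · exact (D.bilS_pos hp h).le

theorem abs_bilS_le {p : ℝ × Eucl n} (hp : p.1 ∈ Ioc (0 : ℝ) 1) (ξ η : Eucl n) :
    |D.bilS p ξ η| ≤ D.bilS p ξ ξ + D.bilS p η η := by
  have h1 := D.bilS_nonneg hp (ξ + η)
  have h2 := D.bilS_nonneg hp (ξ + (-1 : ℝ) • η)
  have h3 := D.bilS_nonneg hp ξ
  have h4 := D.bilS_nonneg hp η
  simp only [bilS_add_left, bilS_add_right, bilS_smul_left, bilS_smul_right] at h1 h2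
  rw [D.bilS_comm p η ξ] at h1 h2
  rw [abs_le]
  constructor <;> linarith

theorem aestronglyMeasurable_bilS (G H : ℝ × Eucl n →ₘ[D.prodMeas] Eucl n) :
    AEStronglyMeasurable (fun p => D.bilS p (G p) (H p)) D.prodMeas := by
  have hc : ∀ (F : ℝ × Eucl n →ₘ[D.prodMeas] Eucl n) (i : Fin n),
      AEMeasurable (fun p => F p i) D.prodMeas := fun F i =>
    (EuclideanSpace.proj (𝕜 := ℝ) i).continuous.measurable.comp_aemeasurable F.aemeasurable
  unfold bilS
  apply AEMeasurable.aestronglyMeasurable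
  refine Finset.aemeasurable_fun_sum _ fun i _ => Finset.aemeasurable_fun_sum _ fun j _ => ?_
  exact ((((D.aemeasurable_A i j).add (D.aemeasurable_A j i)).div_const 2).mul (hc G i)).mul
    (hc H j)

theorem integrable_bilS {G H : ℝ × Eucl n →ₘ[D.prodMeas] Eucl n}
    (hG : Integrable (fun p => D.bilS p (G p) (G p)) D.prodMeas)
    (hH : Integrable (fun p => D.bilS p (H p) (H p)) D.prodMeas) :
    Integrable (fun p => D.bilS p (G p) (H p)) D.prodMeas := by
  refine (hG.add hH).mono' (D.aestronglyMeasurable_bilS G H) ?_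
  filter_upwards [D.ae_mem] with p hp
  exact D.abs_bilS_le hp _ _

/-- The space of (classes of) measurable vector fields `G(s,x)` with
`∫∫ a_S^{ij}(s,x) Gᵢ(s,x) Gⱼ(s,x) dμ(s) dx < ∞`. -/
def L2Field : Submodule ℝ (ℝ × Eucl n →ₘ[D.prodMeas] Eucl n) where
  carrier := {G | Integrable (fun p => D.bilS p (G p) (G p)) D.prodMeas}
  zero_mem' := by
    refine (integrable_zero _ _ _).congr ?_
    filter_upwards [AEEqFun.coeFn_zero (μ := D.prodMeas) (α := ℝ × Eucl n) (β := Eucl n)]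
      with p hp
    rw [hp]
    simp [bilS]
  add_mem' := by
    intro G H hG hH
    have h := D.integrable_bilS hG hH
    refine (((hG.add h).add h).add hH).congr ?_
    filter_upwards [AEEqFun.coeFn_add G H] with p hp
    rw [hp]
    simp only [Pi.add_apply, bilS_add_left, bilS_add_right]
    rw [D.bilS_comm p (H p) (G p)]
    ring
  smul_mem' := by
    intro r G hG
    refine (Integrable.const_mul hG (r * r)).congr ?_
    filter_upwards [AEEqFun.coeFn_smul r G] with p hp
    rw [hp]
    simp only [Pi.smul_apply, bilS_smul_left, bilS_smul_right]
    ring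

/-- The scalar product `∫∫ a_S^{ij}(s,x) Gᵢ(s,x) Hⱼ(s,x) dμ(s) dx` on vector fields. -/
abbrev l2Core : InnerProductSpace.Core ℝ D.L2Field where
  inner G H := ∫ p, D.bilS p (G.1 p) (H.1 p) ∂D.prodMeas
  conj_inner_symm G H := by
    simp only [conj_trivial]
    exact integral_congr_ae (Eventually.of_forall fun p => D.bilS_comm _ _ _)
  re_inner_nonneg G := by
    refine integral_nonneg_of_ae ?_
    filter_upwards [D.ae_mem] with p hp
    exact D.bilS_nonneg hp _
  add_left G G' H := by
    rw [← integral_add (D.integrable_bilS G.2 H.2) (D.integrable_bilS G'.2 H.2)]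
    refine integral_congr_ae ?_
    filter_upwards [AEEqFun.coeFn_add G.1 G'.1] with p hp
    rw [Submodule.coe_add, hp, Pi.add_apply, bilS_add_left]
  smul_left G H r := by
    simp only [conj_trivial]
    rw [← integral_const_mul]
    refine integral_congr_ae ?_
    filter_upwards [AEEqFun.coeFn_smul r G.1] with p hp
    rw [Submodule.coe_smul, hp, Pi.smul_apply, bilS_smul_left]
  definite G hG := by
    have h0 : 0 ≤ᵐ[D.prodMeas] fun p => D.bilS p (G.1 p) (G.1 p) := by
      filter_upwards [D.ae_mem] with p hp
      exact D.bilS_nonneg hp _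
    have h1 := (integral_eq_zero_iff_of_nonneg_ae h0 G.2).1 hG
    apply Subtype.ext
    apply AEEqFun.ext
    filter_upwards [h1, D.ae_mem,
      AEEqFun.coeFn_zero (μ := D.prodMeas) (α := ℝ × Eucl n) (β := Eucl n)] with p hp hm hz
    rw [Submodule.coe_zero, hz]
    by_contra hne
    exact (D.bilS_pos hm hne).ne' hp

instance : NormedAddCommGroup D.L2Field :=
  @InnerProductSpace.Core.toNormedAddCommGroup ℝ D.L2Field _ _ _ D.l2Core

instance : InnerProductSpace ℝ D.L2Field :=
  InnerProductSpace.ofCore D.l2Core.toCore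

variable (Ω : TopologicalSpace.Opens (Eucl n))

/-- The closure of `𝓓(Ω)` for the scalar product
`⟨u, v⟩ = ∫∫ a_S^{ij}(s,x) Dˢᵢu(x) Dˢⱼv(x) dμ(s) dx`. A test function `φ` enters through its field
`(s,x) ↦ Dˢφ(x)`, and this embedding is isometric by the choice of the scalar product. -/
def h0Submodule : Submodule ℝ D.L2Field :=
  (Submodule.span ℝ {G : D.L2Field | ∃ φ : 𝓓(Ω, ℝ),
    (G : ℝ × Eucl n →ₘ[D.prodMeas] Eucl n) =ᵐ[D.prodMeas]
      fun p => fracGrad p.1 φ p.2}).topologicalClosure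

/-- The Hilbert space `H⁰(𝒜, Ω)`, the closure of `𝓓(Ω)` for the norm
`(∫∫ a_S^{ij}(s,x) Dˢᵢu(x) Dˢⱼu(x) dμ(s) dx)^{1/2}`. An element is given by the field of fractional
gradients of the function that it stands for. -/
def H0 : Type := D.h0Submodule Ω

instance : NormedAddCommGroup (D.H0 Ω) :=
  inferInstanceAs (NormedAddCommGroup (D.h0Submodule Ω))

instance : InnerProductSpace ℝ (D.H0 Ω) :=
  inferInstanceAs (InnerProductSpace ℝ (D.h0Submodule Ω))

/-- The field of fractional gradients `(s,x) ↦ Dˢu(x)` of an element `u` of `H⁰(𝒜, Ω)`. -/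
def H0.grad {D : Coefficients n} {Ω : TopologicalSpace.Opens (Eucl n)} (U : D.H0 Ω) :
    ℝ × Eucl n → Eucl n :=
  U.1.1

/-- A nonnegative measurable function `g` on `Ω` is compactly bounded on `H⁰(𝒜, Ω)` if for every
`ε > 0` there is `K ≥ 0` with `‖φ‖²_{L²(g,Ω)} ≤ ε ‖φ‖²_{H⁰(𝒜,Ω)} + K ‖φ‖²_{L¹(Ω)}` for every
`φ ∈ 𝓓(Ω)`. -/
def CompactlyBounded (g : Eucl n → ℝ) : Prop :=
  (∀ x ∈ Ω, 0 ≤ g x) ∧ AEMeasurable g (volume.restrict Ω) ∧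
  ∀ ε : ℝ, 0 < ε → ∃ K : ℝ, 0 ≤ K ∧ ∀ φ : 𝓓(Ω, ℝ),
    (∫⁻ x in Ω, ENNReal.ofReal (g x * φ x ^ 2)) ≤
      ENNReal.ofReal ε *
          (∫⁻ p, ENNReal.ofReal (D.bilS p (fracGrad p.1 φ p.2) (fracGrad p.1 φ p.2))
            ∂D.prodMeas) +
        ENNReal.ofReal K * (∫⁻ x in Ω, ‖φ x‖ₑ) ^ 2

/-- The integrand `a^{ij} Dˢⱼu Dˢᵢv + aⁱ u Dˢᵢv + bⁱ v Dˢᵢu` of `(𝓛u, v)` at `p = (s,x)`, for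
functions `u`, `v` with fractional gradients `G`, `H`. -/
def integrand (u v : Eucl n → ℝ) (G H : ℝ × Eucl n → Eucl n) (p : ℝ × Eucl n) : ℝ :=
  ∑ i, ∑ j, D.A p.1 p.2 i j * G p j * H p i + ∑ i, D.a p.1 p.2 i * u p.2 * H p i +
    ∑ i, D.b p.1 p.2 i * v p.2 * G p i

/-- The integrand `a^{ji} Dˢⱼu Dˢᵢv + bⁱ u Dˢᵢv + aⁱ v Dˢᵢu` of `(𝓛*u, v)`, where
`𝓛*u = ∫ (-Dˢᵢ(a^{ji}(s,x) Dˢⱼu + bⁱ(s,x) u) + aⁱ(s,x) Dˢᵢu) dμ(s) + a(x) u`. -/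
def integrandStar (u v : Eucl n → ℝ) (G H : ℝ × Eucl n → Eucl n) (p : ℝ × Eucl n) : ℝ :=
  ∑ i, ∑ j, D.A p.1 p.2 j i * G p j * H p i + ∑ i, D.b p.1 p.2 i * u p.2 * H p i +
    ∑ i, D.a p.1 p.2 i * v p.2 * G p i

end Coefficients

end NonlocalFredholm

end

/-!
The theorem is the Fredholm alternative for a pencil `A + κ J` on a Hilbert space, where `A` is
invertible and `J` is compact. What has to be shown is that, although `𝒜` is degenerate and the
order `s` varies, `H⁰(𝒜, Ω)` embeds injectively and compactly into `L¹`.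

*The estimate behind the embedding.* Everything rests on

  `‖e^{tΔ}φ - φ‖₁ ≤ C t^(s/2) ‖Dˢφ‖₁`,

with `C` independent of `s ∈ [s₀, 1]` (`exists_lintegral_heat_sub_le`). The kernel of `Dˢ` is a
superposition of gradients of heat kernels, so that
`Dˢφ = Γ(α)⁻¹ ∫ a^(α-1) ∇e^{aΔ}φ da` with `α = (1-s)/2` (`fracGrad_eq_integral_heatGrad`). Hence
`div e^{τΔ}Dˢφ` is a Weyl fractional integral of order `α` of `r ↦ Δe^{rΔ}φ`
(`heatDiv_fracGrad_of_lt`, and `heatDiv_fracGrad_one` for `s = 1`). Integration against `τ^(-α)`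
inverts it up to a constant (`integral_rpow_neg_mul_weyl`), and `∫ Δe^{rΔ}φ dr` over `(0, ∞)` minus
the same integral over `(t, ∞)` is `e^{tΔ}φ - φ`. As `div e^{τΔ}` has norm `O(τ^(-1/2))` on `L¹`,
the estimate follows. No Fourier analysis is involved, and the constants stay bounded as `s → 1`.

*The embedding.* For `φ` supported in a fixed ball, `e^{tΔ}φ` is small on that ball when `t` is
large, and `Dˢφ` decays like `|x|^(-n-s)`; this gives a Poincaré inequality in which `‖φ‖₁` is
controlled by the `L¹` norm of `Dˢφ` on a larger ball (`exists_poincare_ball`). By the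
Cauchy–Schwarz inequality and the local integrability of `λ⁻¹`, that norm is controlled by the
energy (`exists_setLIntegral_le_energy`). So the identity on `𝓓(Ω)` extends to a bounded map
`toFunctionL1` into `L¹`. It is injective because `Dˢ` is antisymmetric
(`integral_smul_fracGrad`): integration against test fields in `(s, x)` recovers `Dˢu` from `u`
(`toFunctionL1_injective`). It is compact because `u` is within a small multiple of `‖u‖` of the
Lipschitz function `e^{tΔ}u`, which finitely many of its values determine up to a small error
(`exists_norm_toFunctionL1_le`).

*The forms.* The sector condition, applied to `𝒜⁻¹a` and `𝒜⁻¹b`, dominates the terms of lower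
order by `f` (`exists_sector`). Therefore the forms are bounded, and `𝓛 + σ 𝓘(f)` is coercive for
large `σ`. The form `𝓘(f)` is compact: compact boundedness of `f` reduces this to the compactness
of the embedding into `L¹` (`exists_setIntegral_f_mul_sq_le`). These are the hypotheses of the
abstract alternative `fredholm_alternative_forms`, in which `𝓛*` enters as the transpose of `𝓛`.

*The abstract alternative.* In `fredholm_pencil`, on a bounded range of `κ` the compactness of `J`
gives a factorization `A + κ J = T_κ (1 + R_κ Q)` with `T_κ` invertible and `Q` the orthogonal
projection onto a fixed finite-dimensional space. The index and the range of such an operator are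
those of a matrix, and its kernel is nontrivial only at the zeros of a determinant that is real
analytic in `κ` and equals `1` at `κ = 0`, so these `κ` do not accumulate.
-/

namespace NonlocalFredholm

/-! ### A parametrized Fredholm alternative on a Hilbert space -/

section FredholmAlternative

variable {H : Type*} [NormedAddCommGroup H] [InnerProductSpace ℝ H]

/-- The compression to a finite-dimensional subspace `V` of `1 + R Q`, where `Q` is the orthogonal
projection onto `V`. -/
noncomputable def compression (V : Submodule ℝ H) [FiniteDimensional ℝ V] (R : H →L[ℝ] H) :
    V →ₗ[ℝ] V :=
  LinearMap.id + V.orthogonalProjectionOnto.toLinearMap ∘ₗ R.toLinearMap ∘ₗ V.subtype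

theorem compression_apply (V : Submodule ℝ H) [FiniteDimensional ℝ V] (R : H →L[ℝ] H) (v : V) :
    compression V R v = v + V.orthogonalProjectionOnto (R v) := rfl

theorem adjoint_compression [CompleteSpace H] (V : Submodule ℝ H) [FiniteDimensional ℝ V]
    (R : H →L[ℝ] H) :
    LinearMap.adjoint (compression V R) = compression V (ContinuousLinearMap.adjoint R) := by
  symm
  rw [LinearMap.eq_adjoint_iff]
  intro x y
  simp only [compression_apply, inner_add_left, inner_add_right, Submodule.coe_inner]
  congr 1
  rw [← Submodule.starProjection_apply, ← Submodule.starProjection_apply,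
    Submodule.inner_starProjection_left_eq_right, Submodule.starProjection_eq_self_iff.2 y.2,
    ContinuousLinearMap.adjoint_inner_left, ← Submodule.inner_starProjection_left_eq_right,
    Submodule.starProjection_eq_self_iff.2 x.2]

/-- Since `u = - R Q u` on the kernel, that kernel is carried by the finite-dimensional space
`V`. -/
noncomputable def kerEquivKerCompression (V : Submodule ℝ H) [FiniteDimensional ℝ V]
    (R : H →L[ℝ] H) :
    (1 + R * V.starProjection : H →L[ℝ] H).toLinearMap.ker ≃ₗ[ℝ] (compression V R).ker where
  toFun u := ⟨V.orthogonalProjectionOnto u, by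
    have h := u.2
    rw [LinearMap.mem_ker] at h ⊢
    have h2 := congrArg V.orthogonalProjectionOnto h
    simpa [compression_apply] using h2⟩
  map_add' u v := by
    ext
    exact congrArg Subtype.val (map_add V.orthogonalProjectionOnto (u : H) v)
  map_smul' c u := by
    ext
    exact congrArg Subtype.val (map_smul V.orthogonalProjectionOnto c (u : H))
  invFun v := ⟨-R v.1, by
    have h := v.2
    rw [LinearMap.mem_ker, compression_apply] at h
    have h2 : V.orthogonalProjectionOnto (R v.1) = -v.1 := by
      rw [eq_neg_iff_add_eq_zero, add_comm]; exact h
    rw [LinearMap.mem_ker]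
    simp [Submodule.starProjection_apply, h2]⟩
  left_inv u := by
    have h := u.2
    rw [LinearMap.mem_ker] at h
    ext
    have h2 : (u : H) + R (V.starProjection u) = 0 := by simpa using h
    simp only [← Submodule.starProjection_apply]
    rw [eq_comm]
    exact eq_neg_of_add_eq_zero_left h2
  right_inv v := by
    have h := v.2
    rw [LinearMap.mem_ker, compression_apply] at h
    ext
    have h2 : V.orthogonalProjectionOnto (R v.1) = -v.1 := by
      rw [eq_neg_iff_add_eq_zero, add_comm]; exact h
    simp [h2]

theorem ker_one_add_mul_eq_bot_iff (V : Submodule ℝ H) [FiniteDimensional ℝ V]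
    (R : H →L[ℝ] H) :
    (1 + R * V.starProjection : H →L[ℝ] H).toLinearMap.ker = ⊥ ↔
      LinearMap.det (compression V R) ≠ 0 := by
  rw [← isUnit_iff_ne_zero, ← LinearMap.isUnit_iff_isUnit_det, LinearMap.isUnit_iff_ker_eq_bot,
    ← Submodule.subsingleton_iff_eq_bot, ← Submodule.subsingleton_iff_eq_bot]
  exact (kerEquivKerCompression V R).toEquiv.subsingleton_congr

theorem isClosed_range_one_add_mul (V : Submodule ℝ H) [FiniteDimensional ℝ V]
    (R : H →L[ℝ] H) :
    IsClosed ((1 + R * V.starProjection : H →L[ℝ] H).toLinearMap.range : Set H) := by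
  have hfg : Vᗮ.CoFG :=
    Module.Finite.equiv (Submodule.quotientEquivOfIsCompl _ _ V.isCompl_orthogonal.symm).symm
  refine LinearMap.isClosed_range_of_isClosed_map_of_finiteDimensional_quotient (s := Vᗮ) ?_
  have : Vᗮ.map (1 + R * V.starProjection : H →L[ℝ] H).toLinearMap = Vᗮ := by
    have h : ∀ u ∈ Vᗮ, (1 + R * V.starProjection : H →L[ℝ] H) u = u := by
      intro u hu
      have : V.starProjection u = 0 := by
        rw [Submodule.starProjection_apply_eq_zero_iff]
        exact hu
      simp [this]
    ext u
    constructor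
    · rintro ⟨w, hw, rfl⟩
      have := h w hw
      exact (congrArg (· ∈ Vᗮ) this).mpr hw
    · intro hu
      exact ⟨u, hu, h u hu⟩
  rw [this]
  exact V.isClosed_orthogonal

theorem analyticAt_det_compression (V : Submodule ℝ H) [FiniteDimensional ℝ V]
    {R : ℝ → H →L[ℝ] H} {x : ℝ} (hR : AnalyticAt ℝ R x) :
    AnalyticAt ℝ (fun κ => LinearMap.det (compression V (R κ))) x := by
  let b := stdOrthonormalBasis ℝ V
  have h : ∀ κ, LinearMap.det (compression V (R κ)) =
      (LinearMap.toMatrix b.toBasis b.toBasis (compression V (R κ))).det := fun κ =>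
    (LinearMap.det_toMatrix _ _).symm
  simp only [h, Matrix.det_apply]
  refine Finset.analyticAt_fun_sum _ fun σ _ => ?_
  refine AnalyticAt.const_smul (Finset.analyticAt_fun_prod _ fun i _ => ?_)
  have he : ∀ κ, LinearMap.toMatrix b.toBasis b.toBasis (compression V (R κ)) (σ i) i =
      inner ℝ (b (σ i)) (b i) + inner ℝ (b (σ i) : H) (R κ (b i)) := by
    intro κ
    rw [LinearMap.toMatrix_apply]
    simp only [OrthonormalBasis.coe_toBasis, OrthonormalBasis.coe_toBasis_repr_apply,
      OrthonormalBasis.repr_apply_apply, compression_apply, inner_add_right]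
    congr 1
    rw [Submodule.coe_inner, ← Submodule.starProjection_apply,
      ← Submodule.inner_starProjection_left_eq_right,
      Submodule.starProjection_eq_self_iff.2 (b (σ i)).2]
  simp only [he]
  refine analyticAt_const.add ?_
  let ℓ : (H →L[ℝ] H) →L[ℝ] ℝ :=
    (innerSL ℝ (b (σ i) : H)).comp (ContinuousLinearMap.apply ℝ H (b i : H))
  exact (ℓ.analyticAt _).comp hR

variable [CompleteSpace H]

/-- The kernel of the adjoint `1 + Q R†` of `1 + R Q` lies in `V`. -/
noncomputable def kerAdjointEquiv (V : Submodule ℝ H) [FiniteDimensional ℝ V]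
    (R : H →L[ℝ] H) :
    (ContinuousLinearMap.adjoint (1 + R * V.starProjection : H →L[ℝ] H)).toLinearMap.ker ≃ₗ[ℝ]
      (compression V (ContinuousLinearMap.adjoint R)).ker := by
  have key : ∀ u : H, ContinuousLinearMap.adjoint (1 + R * V.starProjection : H →L[ℝ] H) u =
      u + V.starProjection (ContinuousLinearMap.adjoint R u) := by
    intro u
    refine ext_inner_right ℝ fun w => ?_
    rw [ContinuousLinearMap.adjoint_inner_left, inner_add_left,
      Submodule.inner_starProjection_left_eq_right, ContinuousLinearMap.adjoint_inner_left]
    simp [inner_add_right]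
  have hV : ∀ u : H, u + V.starProjection (ContinuousLinearMap.adjoint R u) = 0 → u ∈ V := by
    intro u hu
    rw [eq_neg_of_add_eq_zero_left hu]
    exact V.neg_mem (V.starProjection_apply_mem _)
  exact {
    toFun := fun u => ⟨⟨u, hV u ((key u).symm.trans u.2)⟩, by
      have h := (key u).symm.trans u.2
      rw [LinearMap.mem_ker, compression_apply]
      ext
      exact h⟩
    map_add' := fun u v => rfl
    map_smul' := fun c u => rfl
    invFun := fun v => ⟨v.1, by
      have h := v.2
      rw [LinearMap.mem_ker, compression_apply] at h
      rw [LinearMap.mem_ker]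
      refine (key _).trans ?_
      rw [Submodule.starProjection_apply]
      exact congrArg Subtype.val h⟩
    left_inv := fun u => rfl
    right_inv := fun v => rfl }

/-- An operator `T (1 + R Q)` with `T` invertible and `Q` a projection of finite rank has closed
range and index zero. -/
theorem index_zero_of_mul (T : (H →L[ℝ] H)ˣ) (V : Submodule ℝ H) [FiniteDimensional ℝ V]
    (R C : H →L[ℝ] H) (hC : C = T * (1 + R * V.starProjection)) :
    FiniteDimensional ℝ C.toLinearMap.ker ∧
    FiniteDimensional ℝ (ContinuousLinearMap.adjoint C).toLinearMap.ker ∧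
    Module.finrank ℝ C.toLinearMap.ker =
      Module.finrank ℝ (ContinuousLinearMap.adjoint C).toLinearMap.ker ∧
    IsClosed (C.toLinearMap.range : Set H) := by
  set B : H →L[ℝ] H := 1 + R * V.starProjection with hB
  have e := kerEquivKerCompression V R
  have e' := kerAdjointEquiv V R
  rw [← hB] at e e'
  let TE : H ≃L[ℝ] H := ContinuousLinearEquiv.unitsEquiv ℝ H T
  have hTE : ∀ x, TE x = (T : H →L[ℝ] H) x := fun x => rfl
  have hCapp : ∀ x, C x = TE (B x) := fun x => by rw [hC]; rfl
  have hker : C.toLinearMap.ker = B.toLinearMap.ker := by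
    ext x
    rw [LinearMap.mem_ker, LinearMap.mem_ker]
    change C x = 0 ↔ B x = 0
    rw [hCapp]; simp
  let TS : H ≃L[ℝ] H := ContinuousLinearEquiv.unitsEquiv ℝ H (star T)
  have hTS : ∀ x, TS x = ContinuousLinearMap.adjoint (T : H →L[ℝ] H) x := fun x => rfl
  have hadj : ∀ x, ContinuousLinearMap.adjoint C x = ContinuousLinearMap.adjoint B (TS x) := by
    intro x
    rw [hTS, hC]
    change ContinuousLinearMap.adjoint ((T : H →L[ℝ] H).comp B) x = _
    rw [ContinuousLinearMap.adjoint_comp]; rfl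
  have hker' : (ContinuousLinearMap.adjoint C).toLinearMap.ker =
      (ContinuousLinearMap.adjoint B).toLinearMap.ker.comap TS.toLinearEquiv.toLinearMap := by
    ext x
    rw [Submodule.mem_comap, LinearMap.mem_ker, LinearMap.mem_ker]
    change ContinuousLinearMap.adjoint C x = 0 ↔ ContinuousLinearMap.adjoint B (TS x) = 0
    rw [hadj]
  let e2 : (ContinuousLinearMap.adjoint C).toLinearMap.ker ≃ₗ[ℝ]
      (ContinuousLinearMap.adjoint B).toLinearMap.ker :=
    (LinearEquiv.ofEq _ _ hker').trans
      (TS.toLinearEquiv.ofSubmodule' _)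
  refine ⟨?_, Module.Finite.equiv (e2.trans e').symm, ?_, ?_⟩
  · rw [hker]; exact Module.Finite.equiv e.symm
  · rw [hker, e.finrank_eq, (e2.trans e').finrank_eq, ← adjoint_compression]
    have h1 := (compression V R).finrank_range_add_finrank_ker
    have h2 := (LinearMap.adjoint (compression V R)).finrank_range_add_finrank_ker
    rw [LinearMap.finrank_range_adjoint] at h2
    omega
  · have : (C.toLinearMap.range : Set H) = TE '' (B.toLinearMap.range : Set H) := by
      ext x
      constructor
      · rintro ⟨y, rfl⟩
        exact ⟨B y, ⟨y, rfl⟩, (hCapp y).symm⟩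
      · rintro ⟨_, ⟨y, rfl⟩, rfl⟩
        exact ⟨y, hCapp y⟩
    rw [this]
    exact TE.toHomeomorph.isClosedMap _ (isClosed_range_one_add_mul V R)

/-- The parametrized Fredholm alternative: an invertible operator `A` is perturbed by multiples
of an operator `J` that is small off finite-dimensional subspaces. On `|κ| < M`, if `‖J‖` is small
on `Vᗮ`, then `A + κ J = T_κ (1 + R_κ Q)` with `T_κ = A + κ J (1 - Q)` invertible; the determinant
of the compression of `1 + R_κ Q` to `V` is analytic in `κ` and equals `1` at `κ = 0`. -/
theorem fredholm_pencil (A : (H →L[ℝ] H)ˣ) (J : H →L[ℝ] H)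
    (hJ : ∀ ε : ℝ, 0 < ε → ∃ V : Submodule ℝ H, FiniteDimensional ℝ V ∧
      ∀ u ∈ Vᗮ, ‖J u‖ ≤ ε * ‖u‖) (κ₀ : ℝ) :
    (∀ᶠ κ in 𝓝[≠] κ₀, ((A : H →L[ℝ] H) + κ • J).toLinearMap.ker = ⊥) ∧
    FiniteDimensional ℝ ((A : H →L[ℝ] H) + κ₀ • J).toLinearMap.ker ∧
    FiniteDimensional ℝ (ContinuousLinearMap.adjoint ((A : H →L[ℝ] H) + κ₀ • J)).toLinearMap.ker ∧
    Module.finrank ℝ ((A : H →L[ℝ] H) + κ₀ • J).toLinearMap.ker =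
      Module.finrank ℝ (ContinuousLinearMap.adjoint
        ((A : H →L[ℝ] H) + κ₀ • J)).toLinearMap.ker ∧
    IsClosed (((A : H →L[ℝ] H) + κ₀ • J).toLinearMap.range : Set H) := by
  set M : ℝ := |κ₀| + 1 with hM
  have hM0 : 0 < M := by positivity
  set N : ℝ := ‖((A⁻¹ : (H →L[ℝ] H)ˣ) : H →L[ℝ] H)‖ + 1 with hN
  have hN0 : 0 < N := by positivity
  -- with this bound for `J` on `Vᗮ`, the perturbation `κ A⁻¹ J (1 - Q)` has norm below `1/2`
  obtain ⟨V, hV, hJV⟩ := hJ (1 / (2 * M * N)) (by positivity)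
  let P : H →L[ℝ] H := 1 - V.starProjection
  have hPmem : ∀ u, P u ∈ Vᗮ := fun u => by
    simp only [P, sub_apply, one_apply_eq_self]
    exact V.sub_starProjection_mem_orthogonal u
  have hPnorm : ∀ u, ‖P u‖ ≤ ‖u‖ := fun u => by
    have h := V.starProjection_add_starProjection_orthogonal u
    have : P u = Vᗮ.starProjection u := by
      simp only [P, sub_apply, one_apply_eq_self]
      rw [sub_eq_iff_eq_add, add_comm]; exact h.symm
    rw [this]
    exact Submodule.norm_starProjection_apply_le _ _
  have hJP : ‖J * P‖ ≤ 1 / (2 * M * N) := by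
    refine ContinuousLinearMap.opNorm_le_bound _ (by positivity) fun u => ?_
    exact (hJV _ (hPmem u)).trans (by gcongr; exact hPnorm u)
  let T : ℝ → H →L[ℝ] H := fun κ => A + κ • (J * P)
  have hTu : ∀ κ, |κ| < M → IsUnit (T κ) := by
    intro κ hκ
    have hfac : T κ = A * (1 - (-(κ • (((A⁻¹ : (H →L[ℝ] H)ˣ) : H →L[ℝ] H) * (J * P))))) := by
      rw [sub_neg_eq_add, mul_add, mul_one, mul_smul_comm, ← mul_assoc, Units.mul_inv, one_mul]
    rw [hfac]
    refine A.isUnit.mul (isUnit_one_sub_of_norm_lt_one ?_)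
    rw [norm_neg, norm_smul, Real.norm_eq_abs]
    calc |κ| * ‖((A⁻¹ : (H →L[ℝ] H)ˣ) : H →L[ℝ] H) * (J * P)‖
        ≤ M * (N * (1 / (2 * M * N))) := by
          gcongr
          refine (norm_mul_le _ _).trans ?_
          gcongr
          exact (lt_add_one _).le
      _ < 1 := by field_simp; norm_num
  let R : ℝ → H →L[ℝ] H := fun κ => κ • (Ring.inverse (T κ) * J)
  have hdec : ∀ κ, |κ| < M →
      (A : H →L[ℝ] H) + κ • J = T κ * (1 + R κ * V.starProjection) := by
    intro κ hκ
    have h1 : T κ * (R κ * V.starProjection) = κ • (J * V.starProjection) := by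
      simp only [R]
      rw [smul_mul_assoc, mul_smul_comm, mul_assoc, ← mul_assoc (T κ),
        Ring.mul_inverse_cancel _ (hTu κ hκ), one_mul]
    rw [mul_add, h1, mul_one]
    simp only [T, P]
    rw [add_assoc, ← smul_add, ← mul_add, sub_add_cancel, mul_one]
  have hkerκ : ∀ κ, |κ| < M → LinearMap.det (compression V (R κ)) ≠ 0 →
      ((A : H →L[ℝ] H) + κ • J).toLinearMap.ker = ⊥ := by
    intro κ hκ hd
    rw [hdec κ hκ]
    rw [← ker_one_add_mul_eq_bot_iff] at hd
    obtain ⟨u, hu⟩ := hTu κ hκ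
    rw [← hu, eq_bot_iff]
    intro x hx
    have hx' : ContinuousLinearEquiv.unitsEquiv ℝ H u
      ((1 + R κ * V.starProjection : H →L[ℝ] H) x) = 0 := hx
    rw [map_eq_zero_iff _ (ContinuousLinearEquiv.unitsEquiv ℝ H u).injective] at hx'
    rw [← hd]
    exact hx'
  have hκ₀ : |κ₀| < M := by rw [hM]; linarith
  refine ⟨?_, ?_⟩
  · have han : AnalyticOnNhd ℝ (fun κ => LinearMap.det (compression V (R κ)))
        (Metric.ball 0 M) := by
      intro κ hκ
      refine analyticAt_det_compression V ?_
      have hκ' : |κ| < M := by simpa using hκ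
      have hT : AnalyticAt ℝ T κ := analyticAt_const.add (analyticAt_id.smul analyticAt_const)
      have hI : AnalyticAt ℝ (fun κ => Ring.inverse (T κ)) κ := by
        obtain ⟨u, hu⟩ := hTu κ hκ'
        have := analyticAt_inverse (𝕜 := ℝ) u
        rw [hu] at this
        exact AnalyticAt.fun_comp this hT
      exact analyticAt_id.smul (hI.mul analyticAt_const)
    -- the determinant is `1` at `κ = 0`, where `R_κ = 0`
    have hne : ¬ Set.EqOn (fun κ => LinearMap.det (compression V (R κ))) 0 (Metric.ball 0 M) := by
      intro h
      have h0 := h (Metric.mem_ball_self hM0)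
      have : compression V (R 0) = LinearMap.id := by
        ext v
        simp [compression_apply, R]
      simp [this] at h0
    have hev := (han.eqOn_zero_or_eventually_ne_zero_of_preconnected
      (convex_ball 0 M).isPreconnected).resolve_left hne
    have hmem : κ₀ ∈ Metric.ball (0 : ℝ) M := by simpa using hκ₀
    have hev2 : ∀ᶠ κ in 𝓝[≠] κ₀, LinearMap.det (compression V (R κ)) ≠ 0 := by
      rw [Filter.Eventually, mem_codiscreteWithin] at hev
      have := hev κ₀ hmem
      rw [disjoint_principal_right] at this
      filter_upwards [this, mem_nhdsWithin_of_mem_nhds (Metric.isOpen_ball.mem_nhds hmem)]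
        with κ h1 h2
      by_contra h3
      exact h1 ⟨h2, not_not.2 h3⟩
    filter_upwards [hev2, mem_nhdsWithin_of_mem_nhds (Metric.isOpen_ball.mem_nhds hmem)]
      with κ h1 h2
    exact hkerκ κ (by simpa using h2) h1
  · obtain ⟨u, hu⟩ := hTu κ₀ hκ₀
    exact index_zero_of_mul u V (R κ₀) _ (by rw [hu]; exact hdec κ₀ hκ₀)

end FredholmAlternative

/-! ### The Fredholm alternative for bilinear forms -/

section Forms

variable {H : Type*} [NormedAddCommGroup H] [InnerProductSpace ℝ H] [CompleteSpace H]

/-- Cauchy–Schwarz for the form `I`: if `I u u ≤ ε ‖u‖²` on `Vᗮ`, then `I` has small operator norm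
there. -/
theorem norm_sharp_le_of_forall_apply_self_le (I : H →L[ℝ] StrongDual ℝ H)
    (hsymm : ∀ u v, I u v = I v u) (hpos : ∀ u, 0 ≤ I u u)
    (hcomp : ∀ ε : ℝ, 0 < ε → ∃ V : Submodule ℝ H, FiniteDimensional ℝ V ∧
      ∀ u ∈ Vᗮ, I u u ≤ ε * ‖u‖ ^ 2) (ε : ℝ) (hε : 0 < ε) :
    ∃ V : Submodule ℝ H, FiniteDimensional ℝ V ∧ ∀ u ∈ Vᗮ,
      ‖InnerProductSpace.continuousLinearMapOfBilin (𝕜 := ℝ) I u‖ ≤ ε * ‖u‖ := by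
  obtain ⟨V, hV, h⟩ := hcomp (ε ^ 2 / (‖I‖ + 1)) (by positivity)
  refine ⟨V, hV, fun u hu => ?_⟩
  have hu := h u hu
  set w := InnerProductSpace.continuousLinearMapOfBilin (𝕜 := ℝ) I u with hw
  have h1 : I u w = ‖w‖ ^ 2 := by
    rw [← real_inner_self_eq_norm_sq]
    exact (InnerProductSpace.continuousLinearMapOfBilin_apply (𝕜 := ℝ) I u w).symm
  have hcs : I u w * I w u ≤ I u u * I w w :=
    LinearMap.BilinForm.apply_mul_apply_le_of_forall_zero_le
      (LinearMap.mk₂ ℝ (fun u v => I u v) (by simp) (by simp) (by simp) (by simp)) hpos u w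
  rw [hsymm w u, h1] at hcs
  have h2 : I w w ≤ ‖I‖ * ‖w‖ * ‖w‖ := (le_abs_self _).trans (I.le_opNorm₂ w w)
  by_cases hw0 : ‖w‖ = 0
  · rw [hw0]; positivity
  have hwp : 0 < ‖w‖ := lt_of_le_of_ne (norm_nonneg _) (Ne.symm hw0)
  have h3 : ‖w‖ ^ 2 * ‖w‖ ^ 2 ≤ (ε ^ 2 / (‖I‖ + 1) * ‖u‖ ^ 2) * ((‖I‖ + 1) * ‖w‖ ^ 2) := by
    refine hcs.trans (mul_le_mul hu ?_ (hpos w) (by positivity))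
    nlinarith [norm_nonneg I]
  have h4 : ‖w‖ ^ 2 * ‖w‖ ^ 2 ≤ (ε * ‖u‖) ^ 2 * ‖w‖ ^ 2 := by
    refine h3.trans (le_of_eq ?_)
    have : ‖I‖ + 1 ≠ 0 := by positivity
    field_simp
  have h5 := le_of_mul_le_mul_right h4 (by positivity)
  exact le_of_sq_le_sq h5 (by positivity)

/-- A set of reals without accumulation points is discrete, hence countable. -/
theorem countable_of_forall_not_accPt {S : Set ℝ} (h : ∀ σ, ¬ AccPt σ (𝓟 S)) : S.Countable := by
  have : DiscreteTopology S := by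
    rw [discreteTopology_subtype_iff]
    intro x _
    exact not_neBot.1 (h x)
  exact Set.countable_coe_iff.1 (countable_of_Lindelof_of_discrete (X := S))

/-- The Fredholm alternative for the pencil `L + σ I` of bounded bilinear forms on a Hilbert space,
where `Ls` is the transpose of `L`, the form `I` is symmetric, nonnegative and compact (it is small
on subspaces of finite codimension), and `L + σ₀ I` is coercive. -/
theorem fredholm_alternative_forms (L Ls I : H →L[ℝ] StrongDual ℝ H)
    (hLs : ∀ u v, L u v = Ls v u) (hsymm : ∀ u v, I u v = I v u) (hpos : ∀ u, 0 ≤ I u u)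
    {c σ₀ : ℝ} (hc : 0 < c) (hcoer : ∀ u, c * ‖u‖ ^ 2 ≤ L u u + σ₀ * I u u)
    (hcomp : ∀ ε : ℝ, 0 < ε → ∃ V : Submodule ℝ H, FiniteDimensional ℝ V ∧
      ∀ u ∈ Vᗮ, I u u ≤ ε * ‖u‖ ^ 2) :
    ∃ S : Set ℝ, S.Countable ∧ (∀ σ : ℝ, ¬ AccPt σ (𝓟 S)) ∧ S ⊆ Iio σ₀ ∧
        (∀ σ ∉ S, Function.Bijective (L + σ • I)) ∧
        (∀ σ ∈ S,
          (L + σ • I).toLinearMap.ker ≠ ⊥ ∧ (Ls + σ • I).toLinearMap.ker ≠ ⊥ ∧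
          FiniteDimensional ℝ (L + σ • I).toLinearMap.ker ∧
          FiniteDimensional ℝ (Ls + σ • I).toLinearMap.ker ∧
          Module.finrank ℝ (L + σ • I).toLinearMap.ker =
            Module.finrank ℝ (Ls + σ • I).toLinearMap.ker) ∧
        (∀ (σ : ℝ) (T : StrongDual ℝ H),
          (∃ U : H, (L + σ • I) U = T) ↔
            ∀ W : H, (Ls + σ • I) W = 0 → T W = 0) := by
  have hco : IsCoercive (L + σ₀ • I) := ⟨c, hc, fun u => by
    have := hcoer u
    simp only [add_apply, smul_apply, smul_eq_mul]
    rw [mul_assoc, ← pow_two]; exact this⟩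
  -- `A`, `J` and `G σ` are the Riesz representatives of `L + σ₀ I`, `I` and `L + σ I`
  let A : (H →L[ℝ] H)ˣ :=
    (ContinuousLinearEquiv.unitsEquiv ℝ H).symm hco.continuousLinearEquivOfBilin
  have hA : ∀ u v, inner ℝ ((A : H →L[ℝ] H) u) v = L u v + σ₀ * I u v := fun u v =>
    hco.continuousLinearEquivOfBilin_apply u v
  let J : H →L[ℝ] H := InnerProductSpace.continuousLinearMapOfBilin (𝕜 := ℝ) I
  have hJ : ∀ u v, inner ℝ (J u) v = I u v := fun u v =>
    InnerProductSpace.continuousLinearMapOfBilin_apply (𝕜 := ℝ) I u v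
  let G : ℝ → H →L[ℝ] H := fun σ => (A : H →L[ℝ] H) + (σ - σ₀) • J
  have hG : ∀ σ u v, inner ℝ (G σ u) v = (L + σ • I) u v := by
    intro σ u v
    simp only [G, add_apply, smul_apply, inner_add_left, real_inner_smul_left, hA, hJ, smul_eq_mul]
    ring
  have hGs : ∀ σ u v, inner ℝ (ContinuousLinearMap.adjoint (G σ) u) v = (Ls + σ • I) u v := by
    intro σ u v
    rw [ContinuousLinearMap.adjoint_inner_left, real_inner_comm, hG]
    simp only [add_apply, smul_apply, hLs v u, hsymm v u]
  have hker : ∀ σ, (L + σ • I).toLinearMap.ker = (G σ).toLinearMap.ker := by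
    intro σ
    ext u
    rw [LinearMap.mem_ker, LinearMap.mem_ker]
    change (L + σ • I) u = 0 ↔ G σ u = 0
    rw [ContinuousLinearMap.ext_iff, ← inner_self_eq_zero (𝕜 := ℝ)]
    constructor
    · intro h
      rw [hG, h]; rfl
    · intro h v
      rw [inner_self_eq_zero] at h
      rw [← hG, h, inner_zero_left]; rfl
  have hkers : ∀ σ, (Ls + σ • I).toLinearMap.ker =
      (ContinuousLinearMap.adjoint (G σ)).toLinearMap.ker := by
    intro σ
    ext u
    rw [LinearMap.mem_ker, LinearMap.mem_ker]
    change (Ls + σ • I) u = 0 ↔ ContinuousLinearMap.adjoint (G σ) u = 0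
    rw [ContinuousLinearMap.ext_iff, ← inner_self_eq_zero (𝕜 := ℝ)]
    constructor
    · intro h
      rw [hGs, h]; rfl
    · intro h v
      rw [inner_self_eq_zero] at h
      rw [← hGs, h, inner_zero_left]; rfl
  have hpencil := fun κ₀ => fredholm_pencil A J
    (norm_sharp_le_of_forall_apply_self_le I hsymm hpos hcomp) κ₀
  have hsolv : ∀ (σ : ℝ) (T : StrongDual ℝ H),
      (∃ U : H, (L + σ • I) U = T) ↔ ∀ W : H, (Ls + σ • I) W = 0 → T W = 0 := by
    intro σ T
    constructor
    · rintro ⟨U, rfl⟩ W hW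
      have : (Ls + σ • I) W U = 0 := by rw [hW]; rfl
      rw [← this]
      simp only [add_apply, smul_apply, hLs U W, hsymm U W]
    · intro h
      obtain ⟨t, rfl⟩ := (InnerProductSpace.toDual ℝ H).surjective T
      -- the range of `G σ` is closed, so it is the orthogonal complement of the adjoint kernel
      have hcl := (hpencil (σ - σ₀)).2.2.2.2
      have hmem : t ∈ ((G σ).toLinearMap.rangeᗮ)ᗮ := by
        rw [ContinuousLinearMap.orthogonal_range, ← hkers]
        intro W hW
        rw [real_inner_comm]
        exact h W hW
      rw [Submodule.orthogonal_orthogonal_eq_closure, hcl.submodule_topologicalClosure_eq] at hmem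
      obtain ⟨U, hU⟩ := hmem
      refine ⟨U, ?_⟩
      ext v
      rw [← hG]
      change G σ U = t at hU
      rw [hU]; rfl
  have hbot : ∀ σ, σ₀ ≤ σ → (L + σ • I).toLinearMap.ker = ⊥ := by
    intro σ hσ
    rw [eq_bot_iff]
    intro u hu
    have h0 : (L + σ • I) u u = 0 := by
      have : (L + σ • I) u = 0 := hu
      rw [this]; rfl
    simp only [add_apply, smul_apply, smul_eq_mul] at h0
    have h1 := hcoer u
    have h2 := hpos u
    have h3 : c * ‖u‖ ^ 2 ≤ 0 := by nlinarith
    have h4 : ‖u‖ ^ 2 ≤ 0 := by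
      by_contra h
      push Not at h
      nlinarith [mul_pos hc h]
    have h5 : ‖u‖ = 0 := by nlinarith [norm_nonneg u]
    simpa using h5
  have hacc : ∀ σ : ℝ, ¬ AccPt σ (𝓟 {σ | (L + σ • I).toLinearMap.ker ≠ ⊥}) := by
    intro σ h
    rw [accPt_iff_frequently_nhdsNE] at h
    refine h ?_
    have h1 := (hpencil (σ - σ₀)).1
    have ht : Tendsto (fun x : ℝ => x - σ₀) (𝓝[≠] σ) (𝓝[≠] (σ - σ₀)) := by
      refine tendsto_nhdsWithin_iff.2
        ⟨(Continuous.tendsto (by fun_prop) σ).mono_left nhdsWithin_le_nhds, ?_⟩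
      exact eventually_nhdsWithin_of_forall fun x hx => by simpa [sub_eq_iff_eq_add] using hx
    filter_upwards [ht.eventually h1] with x hx
    simp only [not_not]
    rw [hker]; exact hx
  refine ⟨{σ | (L + σ • I).toLinearMap.ker ≠ ⊥}, countable_of_forall_not_accPt hacc, hacc,
    fun σ hσ => ?_, fun σ hσ => ?_, fun σ hσ => ?_, hsolv⟩
  · by_contra h
    exact hσ (hbot σ (not_lt.1 h))
  · have hk : (L + σ • I).toLinearMap.ker = ⊥ := by
      by_contra h; exact hσ h
    obtain ⟨-, h1, h2, h3, -⟩ := hpencil (σ - σ₀)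
    refine ⟨LinearMap.ker_eq_bot.1 hk, fun T => (hsolv σ T).2 fun W hW => ?_⟩
    have h4 : (Ls + σ • I).toLinearMap.ker = ⊥ := by
      rw [hkers]
      apply Submodule.finrank_eq_zero.1
      rw [← h3]
      change Module.finrank ℝ (G σ).toLinearMap.ker = 0
      rw [← hker, hk]; simp
    have : W ∈ (Ls + σ • I).toLinearMap.ker := hW
    rw [h4] at this
    have : W = 0 := this
    rw [this, map_zero]
  · obtain ⟨-, h1, h2, h3, -⟩ := hpencil (σ - σ₀)
    have h1 : FiniteDimensional ℝ (L + σ • I).toLinearMap.ker := by rw [hker]; exact h1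
    have h2 : FiniteDimensional ℝ (Ls + σ • I).toLinearMap.ker := by rw [hkers]; exact h2
    have h3 : Module.finrank ℝ (L + σ • I).toLinearMap.ker =
            Module.finrank ℝ (Ls + σ • I).toLinearMap.ker := by rw [hker, hkers]; exact h3
    refine ⟨hσ, fun h => hσ ?_, h1, h2, h3⟩
    apply Submodule.finrank_eq_zero.1
    rw [h3, h]; simp

end Forms

/-! ### The heat kernel -/

section HeatKernel

variable {n : ℕ}

/-- The heat kernel `(4πt)^{-n/2} exp(-|z|²/(4t))` of `ℝⁿ`. -/
noncomputable def heatKer (t : ℝ) (z : Eucl n) : ℝ :=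
  (4 * Real.pi * t) ^ (-(n : ℝ) / 2) * Real.exp (-‖z‖ ^ 2 / (4 * t))

/-- The time derivative `(|z|²/(4r²) - n/(2r)) p_r(z)` of the heat kernel `p_r`, which is also
its Laplacian. -/
noncomputable def heatLapKer (r : ℝ) (z : Eucl n) : ℝ :=
  (‖z‖ ^ 2 / (4 * r ^ 2) - n / (2 * r)) * heatKer r z

theorem heatKer_pos {t : ℝ} (ht : 0 < t) (z : Eucl n) : 0 < heatKer t z := by
  unfold heatKer; positivity

theorem heatKer_neg (t : ℝ) (z : Eucl n) : heatKer t (-z) = heatKer t z := by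
  simp [heatKer]

theorem continuous_heatKer (t : ℝ) : Continuous (heatKer t : Eucl n → ℝ) := by
  unfold heatKer; fun_prop

theorem measurable_heatKer : Measurable fun p : ℝ × Eucl n => heatKer p.1 p.2 := by
  unfold heatKer; fun_prop

theorem integrable_exp_neg_mul_sq_norm {b : ℝ} (hb : 0 < b) :
    Integrable fun z : Eucl n => Real.exp (-b * ‖z‖ ^ 2) := by
  by_contra h
  have h1 := GaussianFourier.integral_rexp_neg_mul_sq_norm (V := Eucl n) hb
  rw [integral_undef h] at h1
  have : 0 < (Real.pi / b) ^ (Module.finrank ℝ (Eucl n) / 2 : ℝ) := by positivity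
  linarith

theorem mul_exp_neg_le {c : ℝ} (hc : 0 < c) (y : ℝ) :
    y * Real.exp (-c * y) ≤ 2 / c * Real.exp (-(c / 2) * y) := by
  have h1 : c / 2 * y ≤ Real.exp (c / 2 * y) := by
    linarith [Real.add_one_le_exp (c / 2 * y)]
  have h2 : Real.exp (-(c / 2) * y) = Real.exp (c / 2 * y) * Real.exp (-c * y) := by
    rw [← Real.exp_add]; congr 1; ring
  rw [h2, ← mul_assoc]
  gcongr
  rw [div_mul_eq_mul_div, le_div_iff₀ hc]
  linarith

/-- The second moment of a Gaussian, by differentiation of its mass in the parameter. -/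
theorem integral_sq_norm_mul_exp {b : ℝ} (hb : 0 < b) :
    Integrable (fun z : Eucl n => ‖z‖ ^ 2 * Real.exp (-b * ‖z‖ ^ 2)) ∧
    ∫ z : Eucl n, ‖z‖ ^ 2 * Real.exp (-b * ‖z‖ ^ 2) =
      n / (2 * b) * (Real.pi / b) ^ (n / 2 : ℝ) := by
  have hint : ∀ c : ℝ, 0 < c →
      Integrable (fun z : Eucl n => ‖z‖ ^ 2 * Real.exp (-c * ‖z‖ ^ 2)) := by
    intro c hc
    refine ((integrable_exp_neg_mul_sq_norm (half_pos hc)).const_mul (2 / c)).mono'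
      (by fun_prop) (Eventually.of_forall fun z => ?_)
    rw [Real.norm_of_nonneg (by positivity)]
    exact mul_exp_neg_le hc _
  refine ⟨hint b hb, ?_⟩
  have hd := hasDerivAt_integral_of_dominated_loc_of_deriv_le
    (F := fun c (z : Eucl n) => Real.exp (-c * ‖z‖ ^ 2))
    (F' := fun c z => -(‖z‖ ^ 2 * Real.exp (-c * ‖z‖ ^ 2))) (x₀ := b)
    (bound := fun z => ‖z‖ ^ 2 * Real.exp (-(b / 2) * ‖z‖ ^ 2)) (μ := volume)
    (Ioi_mem_nhds (half_lt_self hb))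
    (Eventually.of_forall fun c => by fun_prop) (integrable_exp_neg_mul_sq_norm hb)
    (by fun_prop)
    (Eventually.of_forall fun z c hc => by
      rw [norm_neg, Real.norm_of_nonneg (by positivity)]
      have : b / 2 < c := hc
      gcongr)
    (hint _ (half_pos hb))
    (Eventually.of_forall fun z c _ => by
      have := ((hasDerivAt_id c).neg.mul_const (‖z‖ ^ 2)).exp
      convert! this using 1
      simp; ring)
  have h2 : HasDerivAt (fun c : ℝ => (Real.pi / c) ^ (n / 2 : ℝ))
      (-(n / (2 * b) * (Real.pi / b) ^ (n / 2 : ℝ))) b := by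
    have h := ((hasDerivAt_inv hb.ne').const_mul Real.pi).rpow_const (p := (n / 2 : ℝ))
      (Or.inl (by positivity))
    simp only [← div_eq_mul_inv] at h
    convert! h using 1
    rw [Real.rpow_sub_one (by positivity)]
    field_simp
  have h3 := h2.congr_of_eventuallyEq (f₁ := fun c => ∫ z : Eucl n, Real.exp (-c * ‖z‖ ^ 2)) (by
    filter_upwards [Ioi_mem_nhds hb] with c hc
    rw [GaussianFourier.integral_rexp_neg_mul_sq_norm hc]
    simp)
  have h4 := hd.2.unique h3
  rw [integral_neg, neg_inj] at h4
  exact h4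

theorem heatKer_eq {t : ℝ} (z : Eucl n) :
    heatKer t z = (4 * Real.pi * t) ^ (-(n : ℝ) / 2) * Real.exp (-(1 / (4 * t)) * ‖z‖ ^ 2) := by
  unfold heatKer
  congr 2
  ring

theorem heatConst_mul {t : ℝ} (ht : 0 < t) :
    (4 * Real.pi * t) ^ (-(n : ℝ) / 2) * (Real.pi / (1 / (4 * t))) ^ (n / 2 : ℝ) = 1 := by
  rw [show Real.pi / (1 / (4 * t)) = 4 * Real.pi * t by field_simp,
    ← Real.rpow_add (by positivity)]
  rw [show -(n : ℝ) / 2 + n / 2 = 0 by ring, Real.rpow_zero]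

theorem integrable_heatKer {t : ℝ} (ht : 0 < t) : Integrable (heatKer t : Eucl n → ℝ) := by
  have := (integrable_exp_neg_mul_sq_norm (n := n) (b := 1 / (4 * t)) (by positivity)).const_mul
    ((4 * Real.pi * t) ^ (-(n : ℝ) / 2))
  exact this.congr (Eventually.of_forall fun z => (heatKer_eq z).symm)

theorem integral_heatKer {t : ℝ} (ht : 0 < t) : ∫ z : Eucl n, heatKer t z = 1 := by
  simp only [heatKer_eq]
  rw [integral_const_mul, GaussianFourier.integral_rexp_neg_mul_sq_norm (by positivity)]
  simpa using heatConst_mul ht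

theorem integrable_sq_norm_mul_heatKer {t : ℝ} (ht : 0 < t) :
    Integrable fun z : Eucl n => ‖z‖ ^ 2 * heatKer t z := by
  have := (integral_sq_norm_mul_exp (n := n) (b := 1 / (4 * t)) (by positivity)).1.const_mul
    ((4 * Real.pi * t) ^ (-(n : ℝ) / 2))
  exact this.congr (Eventually.of_forall fun z => by simp only [heatKer_eq]; ring)

theorem integral_sq_norm_mul_heatKer {t : ℝ} (ht : 0 < t) :
    ∫ z : Eucl n, ‖z‖ ^ 2 * heatKer t z = 2 * n * t := by
  have h := (integral_sq_norm_mul_exp (n := n) (b := 1 / (4 * t)) (by positivity)).2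
  have h2 : ∀ z : Eucl n, ‖z‖ ^ 2 * heatKer t z = (4 * Real.pi * t) ^ (-(n : ℝ) / 2) *
      (‖z‖ ^ 2 * Real.exp (-(1 / (4 * t)) * ‖z‖ ^ 2)) := fun z => by rw [heatKer_eq]; ring
  simp only [h2]
  rw [integral_const_mul, h]
  have := heatConst_mul (n := n) ht
  calc _ = (n / (2 * (1 / (4 * t)))) * ((4 * Real.pi * t) ^ (-(n : ℝ) / 2) *
      (Real.pi / (1 / (4 * t))) ^ (n / 2 : ℝ)) := by ring
    _ = _ := by rw [this]; field_simp; ring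

theorem norm_mul_heatKer_le {t : ℝ} (ht : 0 < t) (z : Eucl n) :
    ‖z‖ * heatKer t z ≤ √t / 2 * heatKer t z + 1 / (2 * √t) * (‖z‖ ^ 2 * heatKer t z) := by
  have hs : 0 < √t := Real.sqrt_pos.2 ht
  have h : ‖z‖ ≤ √t / 2 + 1 / (2 * √t) * ‖z‖ ^ 2 := by
    have := sq_nonneg (√t - ‖z‖)
    have h2 : 2 * √t * ‖z‖ ≤ √t ^ 2 + ‖z‖ ^ 2 := by nlinarith
    have : √t / 2 + 1 / (2 * √t) * ‖z‖ ^ 2 = (√t ^ 2 + ‖z‖ ^ 2) / (2 * √t) := by field_simp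
    rw [this, le_div_iff₀ (by positivity)]
    linarith
  calc ‖z‖ * heatKer t z ≤ (√t / 2 + 1 / (2 * √t) * ‖z‖ ^ 2) * heatKer t z :=
        mul_le_mul_of_nonneg_right h (heatKer_pos ht z).le
    _ = _ := by ring

theorem integrable_norm_mul_heatKer {t : ℝ} (ht : 0 < t) :
    Integrable fun z : Eucl n => ‖z‖ * heatKer t z := by
  refine (((integrable_heatKer ht).const_mul (√t / 2)).add
    ((integrable_sq_norm_mul_heatKer ht).const_mul (1 / (2 * √t)))).mono'
    (continuous_norm.mul (continuous_heatKer t)).aestronglyMeasurable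
    (Eventually.of_forall fun z => ?_)
  rw [Real.norm_of_nonneg (mul_nonneg (norm_nonneg _) (heatKer_pos ht z).le)]
  exact norm_mul_heatKer_le ht z

/-- The gradient of the heat kernel has `L¹` norm of order `t^{-1/2}`. -/
theorem integral_norm_div_mul_heatKer_le {t : ℝ} (ht : 0 < t) :
    ∫ z : Eucl n, ‖z‖ / (2 * t) * heatKer t z ≤ (n + 1) * t ^ (-(1 / 2) : ℝ) := by
  have hs : 0 < √t := Real.sqrt_pos.2 ht
  have h1 : ∫ z : Eucl n, ‖z‖ * heatKer t z ≤ √t / 2 + 1 / (2 * √t) * (2 * n * t) := by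
    refine (integral_mono (integrable_norm_mul_heatKer ht)
      (((integrable_heatKer ht).const_mul _).add
      ((integrable_sq_norm_mul_heatKer ht).const_mul _)) (norm_mul_heatKer_le ht)).trans ?_
    simp only [Pi.add_apply]
    rw [integral_add ((integrable_heatKer ht).const_mul _)
      ((integrable_sq_norm_mul_heatKer ht).const_mul _), integral_const_mul, integral_const_mul,
      integral_heatKer ht, integral_sq_norm_mul_heatKer ht, mul_one]
  have h2 : ∀ z : Eucl n, ‖z‖ / (2 * t) * heatKer t z = 1 / (2 * t) * (‖z‖ * heatKer t z) :=
    fun z => by ring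
  simp only [h2]
  rw [integral_const_mul]
  have h3 : t ^ (-(1 / 2) : ℝ) = 1 / √t := by
    rw [Real.rpow_neg ht.le, Real.sqrt_eq_rpow, one_div (t ^ _)]
  rw [h3]
  have ht2 : t = √t ^ 2 := (Real.sq_sqrt ht.le).symm
  calc _ ≤ 1 / (2 * t) * (√t / 2 + 1 / (2 * √t) * (2 * n * t)) := by gcongr
    _ = (1 / 4 + n / 2) * (1 / √t) := by
        set r := √t
        rw [ht2]; field_simp; ring
    _ ≤ _ := by
      have : (0 : ℝ) ≤ n := Nat.cast_nonneg n
      exact mul_le_mul_of_nonneg_right (by linarith) (by positivity)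

theorem heatKer_le {t : ℝ} (ht : 0 < t) (z : Eucl n) :
    heatKer t z ≤ (4 * Real.pi * t) ^ (-(n : ℝ) / 2) := by
  unfold heatKer
  refine mul_le_of_le_one_right (by positivity) ?_
  rw [Real.exp_le_one_iff, neg_div]
  simp only [Left.neg_nonpos_iff]
  positivity

theorem abs_heatLapKer_le {r : ℝ} (hr : 0 < r) (z : Eucl n) :
    |heatLapKer r z| ≤ (n + 1) * (4 * Real.pi * r) ^ (-(n : ℝ) / 2) * r⁻¹ := by
  set c := (4 * Real.pi * r) ^ (-(n : ℝ) / 2) with hc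
  have hc0 : 0 < c := by positivity
  set u := ‖z‖ ^ 2 / (4 * r) with hu
  have hu0 : 0 ≤ u := by positivity
  have h1 : heatLapKer r z = (u - n / 2) * Real.exp (-u) * c * r⁻¹ := by
    unfold heatLapKer heatKer
    rw [← hc, neg_div, ← hu]
    have : ‖z‖ ^ 2 / (4 * r ^ 2) - n / (2 * r) = (u - n / 2) * r⁻¹ := by rw [hu]; field_simp
    rw [this]; ring
  have h2 : |(u - n / 2) * Real.exp (-u)| ≤ n + 1 := by
    have h3 : u * Real.exp (-u) ≤ 1 := by
      rw [Real.exp_neg, mul_inv_le_iff₀ (Real.exp_pos _)]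
      linarith [Real.add_one_le_exp u]
    have h4 : Real.exp (-u) ≤ 1 := Real.exp_le_one_iff.2 (by linarith)
    have h5 := Real.exp_pos (-u)
    have hn : (0 : ℝ) ≤ n := Nat.cast_nonneg n
    rw [abs_le]
    constructor <;> nlinarith [mul_nonneg hu0 h5.le]
  rw [h1, abs_mul, abs_mul, abs_of_pos hc0, abs_of_pos (inv_pos.2 hr)]
  gcongr

theorem hasDerivAt_heatKer {r : ℝ} (hr : 0 < r) (z : Eucl n) :
    HasDerivAt (fun t => heatKer t z) (heatLapKer r z) r := by
  have h1 : HasDerivAt (fun t : ℝ => (4 * Real.pi * t) ^ (-(n : ℝ) / 2))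
      (4 * Real.pi * (-(n : ℝ) / 2) * (4 * Real.pi * r) ^ (-(n : ℝ) / 2 - 1)) r := by
    have := ((hasDerivAt_id r).const_mul (4 * Real.pi)).rpow_const (p := -(n : ℝ) / 2)
      (Or.inl (by simp; positivity))
    simpa using this
  have h2 : HasDerivAt (fun t : ℝ => Real.exp (-‖z‖ ^ 2 / (4 * t)))
      (Real.exp (-‖z‖ ^ 2 / (4 * r)) * (‖z‖ ^ 2 / (4 * r ^ 2))) r := by
    have h3 : HasDerivAt (fun t : ℝ => -‖z‖ ^ 2 / (4 * t)) (‖z‖ ^ 2 / (4 * r ^ 2)) r := by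
      have := ((hasDerivAt_inv hr.ne').const_mul (-‖z‖ ^ 2 / 4))
      convert! this using 1
      · ext t; field_simp
      · field_simp
    exact h3.exp
  convert! h1.mul h2 using 1
  unfold heatLapKer heatKer
  rw [Real.rpow_sub_one (by positivity)]
  field_simp
  ring

/-- Completing the square in a product of two heat kernels. -/
theorem heatKer_mul_heatKer {a t : ℝ} (ha : 0 < a) (ht : 0 < t) (z w : Eucl n) :
    heatKer t w * heatKer a (z - w) =
      heatKer (a + t) z * heatKer (a * t / (a + t)) (w - (t / (a + t)) • z) := by
  have hat : 0 < a + t := by positivity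
  unfold heatKer
  have hc : (4 * Real.pi * t) ^ (-(n : ℝ) / 2) * (4 * Real.pi * a) ^ (-(n : ℝ) / 2) =
      (4 * Real.pi * (a + t)) ^ (-(n : ℝ) / 2) *
        (4 * Real.pi * (a * t / (a + t))) ^ (-(n : ℝ) / 2) := by
    rw [← Real.mul_rpow (by positivity) (by positivity),
      ← Real.mul_rpow (by positivity) (by positivity)]
    congr 1; field_simp
  have he : Real.exp (-‖w‖ ^ 2 / (4 * t)) * Real.exp (-‖z - w‖ ^ 2 / (4 * a)) =
      Real.exp (-‖z‖ ^ 2 / (4 * (a + t))) *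
        Real.exp (-‖w - (t / (a + t)) • z‖ ^ 2 / (4 * (a * t / (a + t)))) := by
    rw [← Real.exp_add, ← Real.exp_add]
    congr 1
    rw [norm_sub_sq_real, norm_sub_sq_real, norm_smul, real_inner_smul_right, mul_pow,
      Real.norm_eq_abs, sq_abs, real_inner_comm z w]
    field_simp
    ring
  calc _ = ((4 * Real.pi * t) ^ (-(n : ℝ) / 2) * (4 * Real.pi * a) ^ (-(n : ℝ) / 2)) *
      (Real.exp (-‖w‖ ^ 2 / (4 * t)) * Real.exp (-‖z - w‖ ^ 2 / (4 * a))) := by ring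
    _ = _ := by rw [hc, he]; ring

theorem integral_inner_mul_heatKer (t : ℝ) (c : Eucl n) :
    ∫ z : Eucl n, inner ℝ c z * heatKer t z = 0 := by
  have h := integral_neg_eq_self (fun z : Eucl n => inner ℝ c z * heatKer t z) volume
  simp only [inner_neg_right, heatKer_neg, neg_mul, integral_neg] at h
  linarith

theorem integrable_inner_mul_heatKer {t : ℝ} (ht : 0 < t) (c : Eucl n) :
    Integrable fun z : Eucl n => inner ℝ c z * heatKer t z := by
  refine ((integrable_norm_mul_heatKer ht).const_mul ‖c‖).mono'
    (Continuous.aestronglyMeasurable (by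
      have := continuous_heatKer (n := n) t
      fun_prop)) (Eventually.of_forall fun z => ?_)
  rw [norm_mul, Real.norm_of_nonneg (heatKer_pos ht z).le, ← mul_assoc]
  exact mul_le_mul_of_nonneg_right (norm_inner_le_norm _ _) (heatKer_pos ht z).le

/-- The convolution identity `∇p_t * ∇p_a = Δ p_{a+t}`. -/
theorem integral_inner_mul_heatKer_mul_heatKer {a t : ℝ} (ha : 0 < a) (ht : 0 < t) (z : Eucl n) :
    ∫ w : Eucl n, inner ℝ w (z - w) / (4 * a * t) * (heatKer t w * heatKer a (z - w)) =
      heatLapKer (a + t) z := by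
  have hat : 0 < a + t := by positivity
  set θ := t / (a + t) with hθ
  set κ := a * t / (a + t) with hκ
  have hκ0 : 0 < κ := by positivity
  simp only [heatKer_mul_heatKer ha ht z]
  rw [← hθ, ← hκ]
  have h1 := integral_add_right_eq_self (μ := volume) (fun w : Eucl n =>
    inner ℝ w (z - w) / (4 * a * t) * (heatKer (a + t) z * heatKer κ (w - θ • z))) (θ • z)
  rw [← h1]
  have h2 : ∀ v : Eucl n, inner ℝ (v + θ • z) (z - (v + θ • z)) / (4 * a * t) *
      (heatKer (a + t) z * heatKer κ (v + θ • z - θ • z)) =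
      heatKer (a + t) z / (4 * a * t) * (θ * (1 - θ) * ‖z‖ ^ 2 * heatKer κ v +
        (1 - 2 * θ) * (inner ℝ z v * heatKer κ v) - ‖v‖ ^ 2 * heatKer κ v) := by
    intro v
    have : inner ℝ (v + θ • z) (z - (v + θ • z)) =
        θ * (1 - θ) * ‖z‖ ^ 2 + (1 - 2 * θ) * inner ℝ z v - ‖v‖ ^ 2 := by
      simp only [inner_sub_right, inner_add_left, inner_add_right, real_inner_smul_left,
        real_inner_smul_right, real_inner_self_eq_norm_sq, real_inner_comm z v, norm_smul, mul_pow,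
        Real.norm_eq_abs, sq_abs]
      ring
    rw [this, add_sub_cancel_right]
    ring
  simp only [h2]
  rw [integral_const_mul, integral_sub, integral_add, integral_const_mul, integral_const_mul,
    integral_inner_mul_heatKer, integral_heatKer hκ0, integral_sq_norm_mul_heatKer hκ0]
  · unfold heatLapKer
    rw [hθ, hκ]
    field_simp
    ring
  · exact (integrable_heatKer hκ0).const_mul _
  · exact (integrable_inner_mul_heatKer hκ0 z).const_mul _
  · exact ((integrable_heatKer hκ0).const_mul _).add
      ((integrable_inner_mul_heatKer hκ0 z).const_mul _)
  · exact integrable_sq_norm_mul_heatKer hκ0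

theorem abs_heatKer_sub_le {t : ℝ} (ht : 0 < t) :
    ∃ C : ℝ, 0 ≤ C ∧ ∀ x y : Eucl n, |heatKer t x - heatKer t y| ≤ C * ‖x - y‖ := by
  set c := (4 * Real.pi * t) ^ (-(n : ℝ) / 2) with hc
  have hc0 : 0 < c := by positivity
  have hs : 0 < √t := Real.sqrt_pos.2 ht
  have hd : ∀ u : ℝ, HasDerivAt (fun u : ℝ => Real.exp (-u ^ 2 / (4 * t)))
      (Real.exp (-u ^ 2 / (4 * t)) * (-(2 * u) / (4 * t))) u := by
    intro u
    have h := ((hasDerivAt_pow 2 u).neg.div_const (4 * t)).exp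
    simpa using h
  have hb : ∀ u : ℝ, ‖Real.exp (-u ^ 2 / (4 * t)) * (-(2 * u) / (4 * t))‖ ≤ 1 / (2 * √t) := by
    intro u
    have h1 : |u| / √t ≤ Real.exp (u ^ 2 / (4 * t)) := by
      refine le_trans ?_ (Real.add_one_le_exp _)
      have h2 := sq_nonneg (|u| / (2 * √t) - 1)
      have h3 : (|u| / (2 * √t)) ^ 2 = u ^ 2 / (4 * t) := by
        rw [div_pow, sq_abs, mul_pow, Real.sq_sqrt ht.le]; norm_num
      have h4 : |u| / √t = 2 * (|u| / (2 * √t)) := by field_simp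
      nlinarith
    rw [norm_mul, Real.norm_of_nonneg (Real.exp_pos _).le, neg_div, Real.exp_neg,
      Real.norm_eq_abs, abs_div, abs_neg, abs_mul, abs_of_pos (by positivity : (0 : ℝ) < 4 * t),
      abs_two, inv_mul_le_iff₀ (Real.exp_pos _)]
    calc 2 * |u| / (4 * t) = |u| / √t * (1 / (2 * √t)) := by
          have ht2 : t = √t ^ 2 := (Real.sq_sqrt ht.le).symm
          set r := √t
          rw [ht2]; field_simp; ring
      _ ≤ _ := by gcongr
  refine ⟨c * (1 / (2 * √t)), by positivity, fun x y => ?_⟩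
  have h := Convex.norm_image_sub_le_of_norm_hasDerivWithin_le (s := Set.univ)
    (fun u _ => (hd u).hasDerivWithinAt) (fun u _ => hb u) convex_univ (mem_univ ‖y‖) (mem_univ ‖x‖)
  unfold heatKer
  rw [← hc, ← mul_sub, abs_mul, abs_of_pos hc0, mul_assoc]
  refine mul_le_mul_of_nonneg_left (h.trans ?_) hc0.le
  gcongr
  exact abs_norm_sub_norm_le x y

end HeatKernel

/-! ### The fractional gradient as a superposition of heat gradients -/

section FracGrad

variable {n : ℕ}

/-- `φ` is continuous, bounded by `M`, and Lipschitz with constant `L`. -/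
structure BddLip (φ : Eucl n → ℝ) (M L : ℝ) : Prop where
  cont : Continuous φ
  bdd : ∀ x, |φ x| ≤ M
  lip : ∀ x y, |φ x - φ y| ≤ L * ‖x - y‖

theorem BddLip.M_nonneg {φ : Eucl n → ℝ} {M L : ℝ} (h : BddLip φ M L) : 0 ≤ M :=
  (abs_nonneg _).trans (h.bdd 0)

/-- The gradient `x ↦ ∫ φ(x+z) z/(2a) p_a(z) dz` of the heat extension of `φ`. -/
noncomputable def heatGrad (a : ℝ) (φ : Eucl n → ℝ) (x : Eucl n) : Eucl n :=
  ∫ z : Eucl n, (heatKer a z / (2 * a) * φ (x + z)) • z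

/-- The divergence `x ↦ ∫ V(x+z)·z/(2τ) p_τ(z) dz` of the heat extension of a vector field. -/
noncomputable def heatDiv (τ : ℝ) (V : Eucl n → Eucl n) (x : Eucl n) : ℝ :=
  ∫ z : Eucl n, heatKer τ z / (2 * τ) * inner ℝ z (V (x + z))

/-- The heat extension of `φ` at time `t`. -/
noncomputable def heat (t : ℝ) (φ : Eucl n → ℝ) (x : Eucl n) : ℝ :=
  ∫ z : Eucl n, heatKer t z * φ (x + z)

/-- The Laplacian, and time derivative, of the heat extension of `φ` at time `r`. -/
noncomputable def heatLap (r : ℝ) (φ : Eucl n → ℝ) (x : Eucl n) : ℝ :=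
  ∫ z : Eucl n, heatLapKer r z * φ (x + z)

/-- The kernel of `Dˢ` is a superposition of gradients of heat kernels. -/
theorem integral_rpow_mul_heatKer {s : ℝ} (hs1 : s < 1) (hs0 : 0 < s) {z : Eucl n} (hz : z ≠ 0) :
    IntegrableOn (fun a : ℝ => a ^ ((1 - s) / 2 - 1) * (heatKer a z / (2 * a))) (Ioi 0) ∧
    ∫ a in Ioi (0 : ℝ), a ^ ((1 - s) / 2 - 1) * (heatKer a z / (2 * a)) =
      Real.Gamma ((1 - s) / 2) * (fracConst n s / ‖z‖ ^ ((n : ℝ) + s + 1)) := by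
  have hz' : 0 < ‖z‖ := norm_pos_iff.2 hz
  set γ : ℝ := ((n : ℝ) + s + 1) / 2 with hγ
  have hγ0 : 0 < γ := by positivity
  set c : ℝ := ‖z‖ ^ 2 / 4 with hc
  have hc0 : 0 < c := by positivity
  have hG := Real.integral_rpow_mul_exp_neg_mul_Ioi hγ0 hc0
  have hGi : IntegrableOn (fun t : ℝ => t ^ (γ - 1) * Real.exp (-(c * t))) (Ioi 0) := by
    by_contra h
    rw [integral_undef h] at hG
    have : 0 < (1 / c) ^ γ * Real.Gamma γ := mul_pos (by positivity) (Real.Gamma_pos_of_pos hγ0)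
    linarith
  have hpt : ∀ a ∈ Ioi (0 : ℝ), a ^ ((1 - s) / 2 - 1) * (heatKer a z / (2 * a)) =
      (1 / 2 * (4 * Real.pi) ^ (-(n : ℝ) / 2)) *
      ((|(-1 : ℝ)| * a ^ ((-1 : ℝ) - 1)) •
        ((a ^ (-1 : ℝ)) ^ (γ - 1) * Real.exp (-(c * a ^ (-1 : ℝ))))) := by
    intro a ha
    have ha : 0 < a := ha
    unfold heatKer
    rw [Real.mul_rpow (by positivity) ha.le, ← Real.rpow_mul ha.le]
    have h1 : Real.exp (-‖z‖ ^ 2 / (4 * a)) = Real.exp (-(c * a ^ (-1 : ℝ))) := by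
      rw [hc, Real.rpow_neg_one]; congr 1; field_simp
    have h0 : ∀ X : ℝ, X / (2 * a) = X * (1 / 2 * a ^ (-1 : ℝ)) := fun X => by
      rw [Real.rpow_neg_one]; field_simp
    rw [h1, abs_neg, abs_one, one_mul, smul_eq_mul, h0]
    have h2 : a ^ ((1 - s) / 2 - 1) * a ^ (-(n : ℝ) / 2) * a ^ (-1 : ℝ) =
        a ^ ((-1 : ℝ) - 1) * a ^ (-1 * (γ - 1)) := by
      rw [← Real.rpow_add ha, ← Real.rpow_add ha, ← Real.rpow_add ha, hγ]
      congr 1; ring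
    linear_combination (1 / 2 * (4 * Real.pi) ^ (-(n : ℝ) / 2) *
      Real.exp (-(c * a ^ (-1 : ℝ)))) * h2
  refine ⟨?_, ?_⟩
  · have h := (integrableOn_Ioi_comp_rpow_iff
      (fun t : ℝ => t ^ (γ - 1) * Real.exp (-(c * t))) (neg_ne_zero.2 one_ne_zero)).2 hGi
    exact IntegrableOn.congr_fun (h.const_mul (1 / 2 * (4 * Real.pi) ^ (-(n : ℝ) / 2)))
      (fun a ha => (hpt a ha).symm) measurableSet_Ioi
  · rw [setIntegral_congr_fun measurableSet_Ioi hpt, integral_const_mul,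
      integral_comp_rpow_Ioi (fun t : ℝ => t ^ (γ - 1) * Real.exp (-(c * t)))
        (neg_ne_zero.2 one_ne_zero), hG]
    have hGα : Real.Gamma ((1 - s) / 2) ≠ 0 := (Real.Gamma_pos_of_pos (by linarith)).ne'
    unfold fracConst
    rw [← hγ]
    have h3 : (1 / c) ^ γ = 2 ^ ((n : ℝ) + s + 1) / ‖z‖ ^ ((n : ℝ) + s + 1) := by
      rw [hc, one_div_div, show (4 : ℝ) / ‖z‖ ^ 2 = (2 / ‖z‖) ^ (2 : ℝ) by
        rw [Real.rpow_two, div_pow]; norm_num, ← Real.rpow_mul (by positivity),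
        Real.div_rpow (by positivity) (by positivity), hγ]
      congr 2 <;> ring
    have h4 : (4 * Real.pi) ^ (-(n : ℝ) / 2) = 2 ^ (-(n : ℝ)) * Real.pi ^ (-(n : ℝ) / 2) := by
      rw [Real.mul_rpow (by positivity) (by positivity),
        show (4 : ℝ) = 2 ^ (2 : ℝ) by norm_num, ← Real.rpow_mul (by positivity)]
      congr 2; ring
    have h5 : (2 : ℝ) ^ (-(n : ℝ)) * 2 ^ ((n : ℝ) + s + 1) = 2 * 2 ^ s := by
      rw [← Real.rpow_add two_pos, show -(n : ℝ) + (n + s + 1) = 1 + s by ring,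
        Real.rpow_add two_pos, Real.rpow_one]
    rw [h3, h4]
    have hz2 : ‖z‖ ^ ((n : ℝ) + s + 1) ≠ 0 := by positivity
    field_simp
    linear_combination h5

/-- The bound of `a ↦ a^{α-1} ∇p_a * φ` for bounded Lipschitz `φ`. -/
theorem integrableOn_rpow_mul_min {α A B : ℝ} (hα : 0 < α) (hα2 : α < 1 / 2) (hA : 0 ≤ A)
    (hB : 0 ≤ B) :
    IntegrableOn (fun a : ℝ => a ^ (α - 1) * min A (B * a ^ (-(1 / 2) : ℝ))) (Ioi 0) ∧
    ∫ a in Ioi (0 : ℝ), a ^ (α - 1) * min A (B * a ^ (-(1 / 2) : ℝ)) ≤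
      A / α + B / (1 / 2 - α) := by
  have hm : AEStronglyMeasurable (fun a : ℝ => a ^ (α - 1) * min A (B * a ^ (-(1 / 2) : ℝ))) :=
    (by fun_prop : Measurable _).aestronglyMeasurable
  have hnn : ∀ a : ℝ, 0 < a → 0 ≤ a ^ (α - 1) * min A (B * a ^ (-(1 / 2) : ℝ)) := fun a ha =>
    mul_nonneg (by positivity) (le_min hA (by positivity))
  have hi1 : IntegrableOn (fun a : ℝ => a ^ (α - 1) * A) (Ioc 0 1) := by
    have := (intervalIntegral.intervalIntegrable_rpow' (a := 0) (b := 1)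
      (by linarith : -1 < α - 1)).mul_const A
    rwa [intervalIntegrable_iff_integrableOn_Ioc_of_le zero_le_one] at this
  have hi2 : IntegrableOn (fun a : ℝ => B * a ^ (α - 1 + -(1 / 2))) (Ioi 1) :=
    (integrableOn_Ioi_rpow_of_lt (by linarith) one_pos).const_mul B
  have hle1 : ∀ a ∈ Ioc (0 : ℝ) 1, a ^ (α - 1) * min A (B * a ^ (-(1 / 2) : ℝ)) ≤
      a ^ (α - 1) * A := fun a ha =>
    mul_le_mul_of_nonneg_left (min_le_left _ _) (Real.rpow_nonneg ha.1.le _)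
  have hle2 : ∀ a ∈ Ioi (1 : ℝ), a ^ (α - 1) * min A (B * a ^ (-(1 / 2) : ℝ)) ≤
      B * a ^ (α - 1 + -(1 / 2)) := fun a ha => by
    have ha0 : (0 : ℝ) < a := one_pos.trans ha
    rw [Real.rpow_add ha0, mul_left_comm]
    exact mul_le_mul_of_nonneg_left (min_le_right _ _) (Real.rpow_nonneg ha0.le _)
  have hj1 : IntegrableOn (fun a : ℝ => a ^ (α - 1) * min A (B * a ^ (-(1 / 2) : ℝ)))
      (Ioc 0 1) := by
    refine hi1.mono' hm.restrict ((ae_restrict_iff' measurableSet_Ioc).2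
      (Eventually.of_forall fun a ha => ?_))
    rw [Real.norm_of_nonneg (hnn a ha.1)]
    exact hle1 a ha
  have hj2 : IntegrableOn (fun a : ℝ => a ^ (α - 1) * min A (B * a ^ (-(1 / 2) : ℝ))) (Ioi 1) := by
    refine hi2.mono' hm.restrict ((ae_restrict_iff' measurableSet_Ioi).2
      (Eventually.of_forall fun a ha => ?_))
    rw [Real.norm_of_nonneg (hnn a (one_pos.trans ha))]
    exact hle2 a ha
  have hU : Ioi (0 : ℝ) = Ioc 0 1 ∪ Ioi 1 := (Ioc_union_Ioi_eq_Ioi zero_le_one).symm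
  refine ⟨hU ▸ hj1.union hj2, ?_⟩
  rw [hU, setIntegral_union (Ioc_disjoint_Ioi le_rfl) measurableSet_Ioi hj1 hj2]
  refine add_le_add ((setIntegral_mono_on hj1 hi1 measurableSet_Ioc hle1).trans ?_)
    ((setIntegral_mono_on hj2 hi2 measurableSet_Ioi hle2).trans ?_)
  · rw [integral_mul_const, ← intervalIntegral.integral_of_le zero_le_one,
      integral_rpow (Or.inl (by linarith))]
    simp [hα.ne']
    field_simp
    exact le_rfl
  · rw [integral_const_mul, integral_Ioi_rpow_of_lt (by linarith) one_pos, Real.one_rpow]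
    rw [show α - 1 + -(1 / 2) + 1 = -(1 / 2 - α) by ring, neg_div_neg_eq]
    rw [mul_one_div]

theorem integrable_heatKer_smul {a : ℝ} (ha : 0 < a) {φ : Eucl n → ℝ} {M L : ℝ}
    (h : BddLip φ M L) (x : Eucl n) :
    Integrable fun z : Eucl n => (heatKer a z / (2 * a) * φ (x + z)) • z := by
  have hc := continuous_heatKer (n := n) a
  have hφ := h.cont
  refine ((integrable_norm_mul_heatKer ha).const_mul (M / (2 * a))).mono'
    (Continuous.aestronglyMeasurable (by fun_prop)) (Eventually.of_forall fun z => ?_)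
  rw [norm_smul, norm_mul, Real.norm_of_nonneg (div_nonneg (heatKer_pos ha z).le (by positivity)),
    Real.norm_eq_abs]
  calc heatKer a z / (2 * a) * |φ (x + z)| * ‖z‖ ≤ heatKer a z / (2 * a) * M * ‖z‖ := by
        have := heatKer_pos ha z
        gcongr
        exact h.bdd _
    _ = _ := by ring

theorem integral_heatKer_smul_id (a : ℝ) :
    ∫ z : Eucl n, (heatKer a z / (2 * a)) • z = 0 := by
  have h := integral_neg_eq_self (fun z : Eucl n => (heatKer a z / (2 * a)) • z) volume
  simp only [heatKer_neg, smul_neg, integral_neg] at h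
  have h2 : (2 : ℝ) • ∫ z : Eucl n, (heatKer a z / (2 * a)) • z = 0 := by
    rw [two_smul]
    nth_rewrite 1 [← h]
    exact neg_add_cancel _
  exact (smul_eq_zero.1 h2).resolve_left two_ne_zero

/-- Both bounds for the truncated kernel: `n L` by the second moment of the heat kernel, and
`O(a^{-1/2})` by the first. -/
theorem integral_norm_heatKer_smul_sub_le {a : ℝ} (ha : 0 < a) {φ : Eucl n → ℝ} {M L : ℝ}
    (h : BddLip φ M L) (x : Eucl n) :
    Integrable (fun z : Eucl n => (heatKer a z / (2 * a) * (φ (x + z) - φ x)) • z) ∧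
    ∫ z : Eucl n, ‖(heatKer a z / (2 * a) * (φ (x + z) - φ x)) • z‖ ≤
      min (n * L) (2 * M * (n + 1) * a ^ (-(1 / 2) : ℝ)) := by
  have h1 : Integrable (fun z : Eucl n => (heatKer a z / (2 * a) * (φ (x + z) - φ x)) • z) := by
    have h2 : BddLip (fun _ : Eucl n => φ x) M 0 :=
      ⟨continuous_const, fun _ => h.bdd x, fun _ _ => by simp⟩
    have := (integrable_heatKer_smul ha h x).sub (integrable_heatKer_smul ha h2 x)
    refine this.congr (Eventually.of_forall fun z => ?_)
    simp only [Pi.sub_apply]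
    rw [← sub_smul]; congr 1; ring
  have hnorm : ∀ z : Eucl n, ‖(heatKer a z / (2 * a) * (φ (x + z) - φ x)) • z‖ =
      heatKer a z / (2 * a) * |φ (x + z) - φ x| * ‖z‖ := fun z => by
    rw [norm_smul, norm_mul,
      Real.norm_of_nonneg (div_nonneg (heatKer_pos ha z).le (by positivity)), Real.norm_eq_abs]
  refine ⟨h1, le_min ?_ ?_⟩
  · have h2 : ∫ z : Eucl n, L / (2 * a) * (‖z‖ ^ 2 * heatKer a z) = n * L := by
      rw [integral_const_mul, integral_sq_norm_mul_heatKer ha]; field_simp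
    rw [← h2]
    refine integral_mono h1.norm ((integrable_sq_norm_mul_heatKer ha).const_mul _) fun z => ?_
    simp only [hnorm]
    have h3 := h.lip (x + z) x
    rw [add_sub_cancel_left] at h3
    calc _ ≤ heatKer a z / (2 * a) * (L * ‖z‖) * ‖z‖ := by
          have := heatKer_pos ha z
          gcongr
      _ = _ := by ring
  · refine le_trans (b := ∫ z : Eucl n, 2 * M * (‖z‖ / (2 * a) * heatKer a z)) ?_ ?_
    · refine integral_mono h1.norm ?_ fun z => ?_
      · refine Integrable.const_mul ?_ _
        exact ((integrable_norm_mul_heatKer ha).const_mul (1 / (2 * a))).congr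
          (Eventually.of_forall fun z => by ring)
      · simp only [hnorm]
        have h3 : |φ (x + z) - φ x| ≤ 2 * M := by
          refine (abs_sub _ _).trans ?_
          linarith [h.bdd (x + z), h.bdd x]
        calc _ ≤ heatKer a z / (2 * a) * (2 * M) * ‖z‖ := by
              have := heatKer_pos ha z
              gcongr
          _ = _ := by ring
    · rw [integral_const_mul, mul_assoc (2 * M)]
      have := h.M_nonneg
      exact mul_le_mul_of_nonneg_left (integral_norm_div_mul_heatKer_le ha) (by positivity)

theorem heatGrad_eq_sub {a : ℝ} (ha : 0 < a) {φ : Eucl n → ℝ} {M L : ℝ}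
    (h : BddLip φ M L) (x : Eucl n) :
    heatGrad a φ x = ∫ z : Eucl n, (heatKer a z / (2 * a) * (φ (x + z) - φ x)) • z := by
  have h2 : BddLip (fun _ : Eucl n => φ x) M 0 :=
    ⟨continuous_const, fun _ => h.bdd x, fun _ _ => by simp⟩
  have h3 : ∀ z : Eucl n, (heatKer a z / (2 * a) * (φ (x + z) - φ x)) • z =
      (heatKer a z / (2 * a) * φ (x + z)) • z - (heatKer a z / (2 * a) * φ x) • z := fun z => by
    rw [← sub_smul]; congr 1; ring
  simp only [h3]
  rw [integral_sub (integrable_heatKer_smul ha h x) (integrable_heatKer_smul ha h2 x)]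
  have h4 : ∀ z : Eucl n, (heatKer a z / (2 * a) * φ x) • z =
      φ x • (heatKer a z / (2 * a)) • z := fun z => by rw [smul_smul, mul_comm]
  simp only [h4]
  rw [integral_smul, integral_heatKer_smul_id, smul_zero, sub_zero]
  rfl

theorem norm_heatGrad_le {a : ℝ} (ha : 0 < a) {φ : Eucl n → ℝ} {M L : ℝ}
    (h : BddLip φ M L) (x : Eucl n) :
    ‖heatGrad a φ x‖ ≤ min (n * L) (2 * M * (n + 1) * a ^ (-(1 / 2) : ℝ)) := by
  rw [heatGrad_eq_sub ha h]
  exact (norm_integral_le_integral_norm _).trans (integral_norm_heatKer_smul_sub_le ha h x).2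

end FracGrad

/-! ### Uniform bounds for the fractional gradient -/

section FracGradBounds

variable {n : ℕ}

theorem integrable_prod_heatKer_smul_sub {s : ℝ} (hs0 : 0 < s) (hs1 : s < 1) {φ : Eucl n → ℝ}
    {M L : ℝ} (h : BddLip φ M L) (hL : 0 ≤ L) (x : Eucl n) :
    Integrable (fun p : ℝ × Eucl n =>
      (p.1 ^ ((1 - s) / 2 - 1) * (heatKer p.1 p.2 / (2 * p.1)) * (φ (x + p.2) - φ x)) • p.2)
      ((volume.restrict (Ioi (0 : ℝ))).prod volume) := by
  have hmeas : Measurable (fun p : ℝ × Eucl n =>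
      (p.1 ^ ((1 - s) / 2 - 1) * (heatKer p.1 p.2 / (2 * p.1)) * (φ (x + p.2) - φ x)) • p.2) := by
    have h1 := measurable_heatKer (n := n)
    have h2 := h.cont.measurable
    fun_prop
  have hM := h.M_nonneg
  have hsm : ∀ (a : ℝ) (z : Eucl n),
      (a ^ ((1 - s) / 2 - 1) * (heatKer a z / (2 * a)) * (φ (x + z) - φ x)) • z =
      a ^ ((1 - s) / 2 - 1) • ((heatKer a z / (2 * a) * (φ (x + z) - φ x)) • z) := fun a z => by
    rw [smul_smul, mul_assoc]
  rw [integrable_prod_iff hmeas.aestronglyMeasurable]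
  constructor
  · refine (ae_restrict_iff' measurableSet_Ioi).2 (Eventually.of_forall fun a ha => ?_)
    simp only [hsm]
    exact (integral_norm_heatKer_smul_sub_le ha h x).1.smul (a ^ ((1 - s) / 2 - 1))
  · refine (integrableOn_rpow_mul_min (α := (1 - s) / 2) (A := n * L) (B := 2 * M * (n + 1))
      (by linarith) (by linarith) (by positivity) (by positivity)).1.mono'
      hmeas.aestronglyMeasurable.norm.integral_prod_right'
      ((ae_restrict_iff' measurableSet_Ioi).2 (Eventually.of_forall fun a ha => ?_))
    have ha' : 0 < a := ha
    rw [Real.norm_of_nonneg (integral_nonneg fun _ => norm_nonneg _)]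
    simp only [hsm, norm_smul (a ^ ((1 - s) / 2 - 1))]
    rw [integral_const_mul, Real.norm_of_nonneg (by positivity)]
    gcongr
    exact (integral_norm_heatKer_smul_sub_le ha h x).2

theorem fracConst_pos {s : ℝ} (hs0 : 0 < s) (hs1 : s < 1) : 0 < fracConst n s := by
  unfold fracConst
  have h1 := Real.Gamma_pos_of_pos (s := (n + s + 1) / 2) (by positivity)
  have h2 := Real.Gamma_pos_of_pos (s := (1 - s) / 2) (by linarith)
  have := Real.pi_pos
  positivity

/-- The representation `Dˢφ = Γ((1-s)/2)⁻¹ ∫ a^{(1-s)/2-1} ∇p_a * φ da`, together with the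
absolute convergence of the integral defining `Dˢφ`. -/
theorem fracGrad_eq_integral_heatGrad {s : ℝ} (hs0 : 0 < s) (hs1 : s < 1) {φ : Eucl n → ℝ}
    {M L : ℝ} (h : BddLip φ M L) (hL : 0 ≤ L) (x : Eucl n) :
    Integrable (fun z : Eucl n => ((φ (x + z) - φ x) / ‖z‖ ^ ((n : ℝ) + s + 1)) • z) ∧
    fracGrad s φ x = (Real.Gamma ((1 - s) / 2))⁻¹ •
      ∫ a in Ioi (0 : ℝ), a ^ ((1 - s) / 2 - 1) • heatGrad a φ x := by
  have hF := integrable_prod_heatKer_smul_sub hs0 hs1 h hL x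
  set Γα := Real.Gamma ((1 - s) / 2) with hΓ
  have hΓ0 : 0 < Γα := Real.Gamma_pos_of_pos (by linarith)
  have hc := fracConst_pos (n := n) hs0 hs1
  have hz : ∀ z : Eucl n, ∫ a in Ioi (0 : ℝ),
      (a ^ ((1 - s) / 2 - 1) * (heatKer a z / (2 * a)) * (φ (x + z) - φ x)) • z =
      (Γα * fracConst n s) • ((φ (x + z) - φ x) / ‖z‖ ^ ((n : ℝ) + s + 1)) • z := by
    intro z
    by_cases hz : z = 0
    · simp [hz]
    · rw [integral_smul_const, integral_mul_const, (integral_rpow_mul_heatKer hs1 hs0 hz).2,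
        smul_smul]
      congr 1; ring
  have hi := hF.integral_prod_right
  simp only [hz] at hi
  have hi2 := hi.smul (Γα * fracConst n s)⁻¹
  have hne : Γα * fracConst n s ≠ 0 := (mul_pos hΓ0 hc).ne'
  simp only [Pi.smul_def, smul_smul (Γα * fracConst n s)⁻¹ (Γα * fracConst n s),
    inv_mul_cancel₀ hne, one_smul] at hi2
  refine ⟨hi2, ?_⟩
  unfold fracGrad
  rw [if_neg hs1.ne]
  have hsw := integral_integral_swap (f := fun (a : ℝ) (z : Eucl n) =>
    (a ^ ((1 - s) / 2 - 1) * (heatKer a z / (2 * a)) * (φ (x + z) - φ x)) • z) hF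
  simp only [hz] at hsw
  rw [integral_smul] at hsw
  have hl : ∫ a in Ioi (0 : ℝ), a ^ ((1 - s) / 2 - 1) • heatGrad a φ x =
      ∫ a in Ioi (0 : ℝ), ∫ z : Eucl n,
        (a ^ ((1 - s) / 2 - 1) * (heatKer a z / (2 * a)) * (φ (x + z) - φ x)) • z := by
    refine setIntegral_congr_fun measurableSet_Ioi fun a ha => ?_
    rw [heatGrad_eq_sub ha h, ← integral_smul]
    simp only [smul_smul, mul_assoc]
  rw [hl, hsw, smul_smul, ← mul_assoc, inv_mul_cancel₀ hΓ0.ne', one_mul]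

theorem exists_Gamma_ge : ∃ γ : ℝ, 0 < γ ∧ ∀ x ∈ Icc (1 / 2 : ℝ) 2, γ ≤ Real.Gamma x := by
  have hc : ContinuousOn Real.Gamma (Icc (1 / 2 : ℝ) 2) := fun x hx =>
    (Real.differentiableAt_Gamma fun m => by
      have : (0 : ℝ) ≤ m := Nat.cast_nonneg m
      have := hx.1
      linarith).continuousAt.continuousWithinAt
  obtain ⟨x, hx, hmin⟩ := isCompact_Icc.exists_isMinOn (nonempty_Icc.2 (by norm_num)) hc
  exact ⟨Real.Gamma x, Real.Gamma_pos_of_pos (by linarith [hx.1]), fun y hy => hmin hy⟩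

/-- `1/Γ(α) = α/Γ(α+1)` vanishes at `α = 0`; this balances the divergence of
`∫ (φ(x+z)-φ(x)) z |z|^{-n-s-1} dz` as `s → 1`. -/
theorem exists_inv_Gamma_le : ∃ C : ℝ, 0 ≤ C ∧ ∀ α ∈ Ioo (0 : ℝ) (1 / 2),
    (Real.Gamma α)⁻¹ ≤ C * α := by
  obtain ⟨γ, hγ, h⟩ := exists_Gamma_ge
  refine ⟨γ⁻¹, by positivity, fun α hα => ?_⟩
  have h1 := h (α + 1) ⟨by linarith [hα.1], by linarith [hα.2]⟩
  rw [Real.Gamma_add_one hα.1.ne'] at h1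
  have h2 := Real.Gamma_pos_of_pos hα.1
  have := hα.1
  rw [inv_mul_eq_div, inv_le_comm₀ h2 (by positivity), inv_div, div_le_iff₀ hα.1]
  linarith

theorem norm_fracGrad_one_le {φ : Eucl n → ℝ} {M L : ℝ} (h : BddLip φ M L) (hL : 0 ≤ L)
    (x : Eucl n) : ‖fracGrad 1 φ x‖ ≤ L := by
  unfold fracGrad
  rw [if_pos rfl]
  unfold gradient
  rw [LinearIsometryEquiv.norm_map]
  exact norm_fderiv_le_of_lip' ℝ hL (Eventually.of_forall fun y => h.lip y x)

/-- `Dˢφ` is bounded uniformly in `s ∈ [s₀, 1]` by the sup norm and the Lipschitz constant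
of `φ`. -/
theorem exists_norm_fracGrad_le (n : ℕ) {s₀ : ℝ} (hs₀ : 0 < s₀) :
    ∃ C : ℝ, 0 ≤ C ∧ ∀ s ∈ Icc s₀ 1, ∀ (φ : Eucl n → ℝ) (M L : ℝ), BddLip φ M L → 0 ≤ L →
      ∀ x, ‖fracGrad s φ x‖ ≤ C * (M + L) := by
  obtain ⟨C, hC, hCα⟩ := exists_inv_Gamma_le
  refine ⟨1 + C * (n + 2 * (n + 1) / s₀), by positivity, fun s hs φ M L h hL x => ?_⟩
  have hM := h.M_nonneg
  have hn : (0 : ℝ) ≤ n := Nat.cast_nonneg n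
  rcases eq_or_lt_of_le hs.2 with rfl | hs1
  · refine (norm_fracGrad_one_le h hL x).trans ?_
    have : 0 ≤ C * (n + 2 * (n + 1) / s₀) * (M + L) := by positivity
    nlinarith
  have hs0 : 0 < s := hs₀.trans_le hs.1
  rw [(fracGrad_eq_integral_heatGrad hs0 hs1 h hL x).2, norm_smul]
  set α := (1 - s) / 2 with hα
  have hα0 : 0 < α := by rw [hα]; linarith
  have hα1 : α < 1 / 2 := by rw [hα]; linarith
  have hI := integrableOn_rpow_mul_min (α := α) (A := n * L) (B := 2 * M * (n + 1))
    hα0 hα1 (by positivity) (by positivity)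
  have h1 : ‖∫ a in Ioi (0 : ℝ), a ^ (α - 1) • heatGrad a φ x‖ ≤
      n * L / α + 2 * M * (n + 1) / (1 / 2 - α) := by
    refine (norm_integral_le_of_norm_le hI.1 ?_).trans hI.2
    refine (ae_restrict_iff' measurableSet_Ioi).2 (Eventually.of_forall fun a ha => ?_)
    have ha' : 0 < a := ha
    rw [norm_smul, Real.norm_of_nonneg (by positivity)]
    gcongr
    exact norm_heatGrad_le ha h x
  have hG0 := Real.Gamma_pos_of_pos hα0
  rw [Real.norm_of_nonneg (by positivity)]
  calc _ ≤ C * α * (n * L / α + 2 * M * (n + 1) / (1 / 2 - α)) := by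
        refine mul_le_mul (hCα α ⟨hα0, hα1⟩) h1 (norm_nonneg _) (by positivity)
    _ = C * (n * L + (α / (1 / 2 - α)) * (2 * (n + 1)) * M) := by
        have : 1 / 2 - α ≠ 0 := by linarith
        field_simp
    _ ≤ C * (n * L + (1 / s₀) * (2 * (n + 1)) * M) := by
        have : α / (1 / 2 - α) ≤ 1 / s₀ := by
          rw [div_le_div_iff₀ (by linarith) hs₀, hα]
          nlinarith [hs.1]
        gcongr
    _ ≤ _ := by
        have h2 : 0 ≤ C * n * M := by positivity
        have h3 : 0 ≤ C * (2 * (n + 1) / s₀) * L := by positivity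
        have : 1 / s₀ * (2 * (n + 1)) * M = 2 * (n + 1) / s₀ * M := by ring
        rw [this]
        nlinarith

theorem exists_fracConst_le (n : ℕ) : ∃ C : ℝ, 0 ≤ C ∧ ∀ s ∈ Ioo (0 : ℝ) 1, fracConst n s ≤ C := by
  obtain ⟨C, hC, hCα⟩ := exists_inv_Gamma_le
  have hn : (0 : ℝ) ≤ n := Nat.cast_nonneg n
  have hc : ContinuousOn (fun s : ℝ => Real.Gamma ((n + s + 1) / 2)) (Icc (0 : ℝ) 1) := fun s hs =>
    (ContinuousAt.comp (f := fun s : ℝ => ((n : ℝ) + s + 1) / 2) (Real.differentiableAt_Gamma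
      (s := ((n : ℝ) + s + 1) / 2) fun m => by
        have : (0 : ℝ) ≤ m := Nat.cast_nonneg m
        have := hs.1
        have : 0 < ((n : ℝ) + s + 1) / 2 := by positivity
        linarith).continuousAt (by fun_prop)).continuousWithinAt
  obtain ⟨G, hG⟩ := isCompact_Icc.exists_bound_of_continuousOn hc
  have hG0 : 0 ≤ G := (norm_nonneg _).trans (hG 0 (by simp))
  refine ⟨2 * Real.pi ^ (-(n : ℝ) / 2) * G * C, by positivity, fun s hs => ?_⟩
  unfold fracConst
  rw [div_eq_mul_inv]
  have h1 : (2 : ℝ) ^ s ≤ 2 := by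
    calc (2 : ℝ) ^ s ≤ 2 ^ (1 : ℝ) := Real.rpow_le_rpow_of_exponent_le (by norm_num) hs.2.le
      _ = 2 := Real.rpow_one 2
  have h2 := (le_abs_self _).trans (hG s ⟨hs.1.le, hs.2.le⟩)
  have h3 := hCα ((1 - s) / 2) ⟨by linarith [hs.2], by linarith [hs.1]⟩
  have h4 : C * ((1 - s) / 2) ≤ C := by
    have := hs.1
    exact mul_le_of_le_one_right hC (by linarith)
  have h5 := Real.Gamma_pos_of_pos (s := (1 - s) / 2) (by linarith [hs.2])
  have h6 := Real.Gamma_pos_of_pos (s := (n + s + 1) / 2) (by have := hs.1; positivity)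
  exact mul_le_mul (mul_le_mul (mul_le_mul_of_nonneg_right h1 (by positivity)) h2 h6.le
    (by positivity)) (h3.trans h4) (by positivity) (by positivity)

/-- Decay of `Dˢφ` away from the support of `φ`, uniformly in `s ∈ [s₀, 1]`. -/
theorem exists_norm_fracGrad_le_of_large (n : ℕ) {s₀ : ℝ} (hs₀ : 0 < s₀) :
    ∃ C : ℝ, 0 ≤ C ∧ ∀ s ∈ Icc s₀ 1, ∀ (φ : Eucl n → ℝ) (R : ℝ), 0 < R → Integrable φ →
      (∀ y, R ≤ ‖y‖ → φ y = 0) → ∀ x, 2 * R ≤ ‖x‖ → 1 ≤ ‖x‖ →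
      ‖fracGrad s φ x‖ ≤ C * (∫ y, |φ y|) * ‖x‖ ^ (-((n : ℝ) + s₀)) := by
  obtain ⟨c, hc0, hc⟩ := exists_fracConst_le n
  have hn : (0 : ℝ) ≤ n := Nat.cast_nonneg n
  refine ⟨c * 2 ^ ((n : ℝ) + 1), by positivity, fun s hs φ R hR hφ hsupp x hx hx1 => ?_⟩
  have hI : 0 ≤ ∫ y, |φ y| := integral_nonneg fun _ => abs_nonneg _
  have hx0 : 0 < ‖x‖ := by linarith
  rcases eq_or_lt_of_le hs.2 with rfl | hs1
  · have hz : φ =ᶠ[𝓝 x] fun _ => 0 := by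
      have : {y : Eucl n | R < ‖y‖} ∈ 𝓝 x :=
        (isOpen_lt continuous_const continuous_norm).mem_nhds
          (show R < ‖x‖ by linarith)
      filter_upwards [this] with y hy
      have hy : R < ‖y‖ := hy
      exact hsupp y hy.le
    have : fracGrad 1 φ x = 0 := by
      unfold fracGrad
      rw [if_pos rfl]
      unfold gradient
      rw [hz.fderiv_eq]; simp
    rw [this, norm_zero]
    positivity
  have hs0 : 0 < s := hs₀.trans_le hs.1
  unfold fracGrad
  rw [if_neg hs1.ne, norm_smul, Real.norm_of_nonneg (fracConst_pos hs0 hs1).le]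
  have hφx : φ x = 0 := hsupp x (by linarith)
  have hb : ‖∫ z : Eucl n, ((φ (x + z) - φ x) / ‖z‖ ^ ((n : ℝ) + s + 1)) • z‖ ≤
      ∫ z : Eucl n, |φ (x + z)| * (2 ^ ((n : ℝ) + 1) * ‖x‖ ^ (-((n : ℝ) + s₀))) := by
    refine norm_integral_le_of_norm_le ?_ (Eventually.of_forall fun z => ?_)
    · exact (((hφ.comp_add_left x).abs).mul_const _)
    · rw [hφx, sub_zero, norm_smul, norm_div, Real.norm_eq_abs,
        Real.norm_of_nonneg (by positivity : 0 ≤ ‖z‖ ^ ((n : ℝ) + s + 1))]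
      by_cases hz : φ (x + z) = 0
      · simp [hz]
      have hzR : ‖x + z‖ < R := by
        by_contra hcon
        exact hz (hsupp _ (not_lt.1 hcon))
      have hzx : ‖x‖ / 2 ≤ ‖z‖ := by
        have : ‖x‖ ≤ ‖x + z‖ + ‖z‖ := by
          calc ‖x‖ = ‖(x + z) - z‖ := by rw [add_sub_cancel_right]
            _ ≤ _ := norm_sub_le _ _
        linarith
      have hz0 : 0 < ‖z‖ := by linarith
      have h1 : |φ (x + z)| / ‖z‖ ^ ((n : ℝ) + s + 1) * ‖z‖ =
          |φ (x + z)| * ‖z‖ ^ (-((n : ℝ) + s)) := by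
        rw [Real.rpow_neg hz0.le, Real.rpow_add_one hz0.ne']
        field_simp
      rw [h1]
      refine mul_le_mul_of_nonneg_left ?_ (abs_nonneg _)
      calc ‖z‖ ^ (-((n : ℝ) + s)) ≤ (‖x‖ / 2) ^ (-((n : ℝ) + s)) :=
            Real.rpow_le_rpow_of_nonpos (by positivity) hzx (by linarith)
        _ = 2 ^ ((n : ℝ) + s) * ‖x‖ ^ (-((n : ℝ) + s)) := by
            rw [Real.div_rpow hx0.le (by norm_num), Real.rpow_neg (by norm_num : (0 : ℝ) ≤ 2),
              div_inv_eq_mul, mul_comm]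
        _ ≤ _ := by
            refine mul_le_mul ?_ ?_ (by positivity) (by positivity)
            · exact Real.rpow_le_rpow_of_exponent_le (by norm_num) (by linarith)
            · exact Real.rpow_le_rpow_of_exponent_le hx1 (by linarith [hs.1])
  rw [integral_mul_const, integral_add_left_eq_self (fun y => |φ y|) x] at hb
  calc _ ≤ c * ((∫ y, |φ y|) * (2 ^ ((n : ℝ) + 1) * ‖x‖ ^ (-((n : ℝ) + s₀)))) :=
        mul_le_mul (hc s ⟨hs0, hs1⟩) hb (norm_nonneg _) hc0
    _ = _ := by ring

end FracGradBounds

/-! ### Linearity, measurability and integration by parts for `Dˢ` -/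

section FracGradOperations

variable {n : ℕ}

theorem continuousOn_fracConst (n : ℕ) : ContinuousOn (fracConst n) (Ioo 0 1) := by
  intro s hs
  have hG : ∀ x : ℝ, 0 < x → ContinuousAt Real.Gamma x := fun x hx =>
    (Real.differentiableAt_Gamma fun m => by
      have : (0 : ℝ) ≤ m := Nat.cast_nonneg m
      linarith).continuousAt
  have hn : (0 : ℝ) ≤ n := Nat.cast_nonneg n
  have h1 : ContinuousAt (fun s : ℝ => Real.Gamma ((n + s + 1) / 2)) s :=
    ContinuousAt.comp (f := fun s : ℝ => ((n : ℝ) + s + 1) / 2)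
      (hG _ (by have := hs.1; positivity)) (by fun_prop)
  have h2 : ContinuousAt (fun s : ℝ => Real.Gamma ((1 - s) / 2)) s :=
    ContinuousAt.comp (f := fun s : ℝ => (1 - s) / 2) (hG _ (by linarith [hs.2])) (by fun_prop)
  have h3 : ContinuousAt (fun s : ℝ => (2 : ℝ) ^ s) s :=
    (Real.continuous_const_rpow two_ne_zero).continuousAt
  unfold fracConst
  exact ((((h3.mul continuousAt_const).mul h1).div h2
    (Real.Gamma_pos_of_pos (by linarith [hs.2])).ne')).continuousWithinAt

theorem continuous_gradient {φ : Eucl n → ℝ} (hφ : ContDiff ℝ 1 φ) :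
    Continuous (fun x => gradient φ x) := by
  unfold gradient
  exact (LinearIsometryEquiv.continuous _).comp (hφ.continuous_fderiv one_ne_zero)

/-- Joint measurability of `(s, x) ↦ Dˢφ(x)`. -/
theorem aestronglyMeasurable_fracGrad (ν : Measure (ℝ × Eucl n))
    (hν : ∀ᵐ p ∂ν, p.1 ∈ Ioc (0 : ℝ) 1) {φ : Eucl n → ℝ} (hφ : ContDiff ℝ 1 φ) :
    AEStronglyMeasurable (fun p : ℝ × Eucl n => fracGrad p.1 φ p.2) ν := by
  classical
  have hc : Measurable ((Ioo (0 : ℝ) 1).piecewise (fracConst n) 0) :=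
    (continuousOn_fracConst n).measurable_piecewise continuousOn_const measurableSet_Ioo
  have hI : Measurable fun p : ℝ × Eucl n =>
      ∫ z : Eucl n, ((φ (p.2 + z) - φ p.2) / ‖z‖ ^ ((n : ℝ) + p.1 + 1)) • z := by
    have hm : Measurable fun q : (ℝ × Eucl n) × Eucl n =>
        ((φ (q.1.2 + q.2) - φ q.1.2) / ‖q.2‖ ^ ((n : ℝ) + q.1.1 + 1)) • q.2 := by
      have := hφ.continuous.measurable
      fun_prop
    exact (hm.stronglyMeasurable.integral_prod_right' (ν := volume)).measurable
  have hg : Measurable fun p : ℝ × Eucl n => gradient φ p.2 :=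
    (continuous_gradient hφ).measurable.comp measurable_snd
  have hM : Measurable fun p : ℝ × Eucl n => if p.1 = 1 then gradient φ p.2
      else (Ioo (0 : ℝ) 1).piecewise (fracConst n) 0 p.1 •
        ∫ z : Eucl n, ((φ (p.2 + z) - φ p.2) / ‖z‖ ^ ((n : ℝ) + p.1 + 1)) • z :=
    Measurable.ite (measurable_fst (measurableSet_singleton (1 : ℝ))) hg
      ((hc.comp measurable_fst).smul hI)
  refine hM.aestronglyMeasurable.congr ?_
  filter_upwards [hν] with p hp
  unfold fracGrad
  split_ifs with h
  · rfl
  · rw [Set.piecewise_eq_of_mem _ _ _ (show p.1 ∈ Ioo (0 : ℝ) 1 from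
      ⟨hp.1, lt_of_le_of_ne hp.2 h⟩)]

theorem exists_bddLip {φ : Eucl n → ℝ} (hφ : ContDiff ℝ 1 φ) (hc : HasCompactSupport φ) :
    ∃ M L : ℝ, BddLip φ M L ∧ 0 ≤ L := by
  obtain ⟨M, hM⟩ := hc.exists_bound_of_continuous hφ.continuous
  obtain ⟨L, hL⟩ := hφ.lipschitzWith_of_hasCompactSupport hc one_ne_zero
  exact ⟨M, L, ⟨hφ.continuous, hM, fun x y => by
    have := hL.dist_le_mul x y
    rwa [Real.dist_eq, dist_eq_norm] at this⟩, L.2⟩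

theorem fracGrad_add {s : ℝ} (hs : s ∈ Ioc (0 : ℝ) 1) {φ ψ : Eucl n → ℝ}
    (hφ : ContDiff ℝ 1 φ) (hφc : HasCompactSupport φ)
    (hψ : ContDiff ℝ 1 ψ) (hψc : HasCompactSupport ψ) (x : Eucl n) :
    fracGrad s (φ + ψ) x = fracGrad s φ x + fracGrad s ψ x := by
  rcases eq_or_lt_of_le hs.2 with rfl | hs1
  · unfold fracGrad gradient
    simp only [if_true]
    rw [fderiv_add ((hφ.differentiable one_ne_zero) x) ((hψ.differentiable one_ne_zero) x),
      map_add]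
  · obtain ⟨M, L, h, hL⟩ := exists_bddLip hφ hφc
    obtain ⟨M', L', h', hL'⟩ := exists_bddLip hψ hψc
    unfold fracGrad
    simp only [if_neg hs1.ne]
    rw [← smul_add, ← integral_add (fracGrad_eq_integral_heatGrad hs.1 hs1 h hL x).1
      (fracGrad_eq_integral_heatGrad hs.1 hs1 h' hL' x).1]
    congr 1
    refine integral_congr_ae (Eventually.of_forall fun z => ?_)
    simp only [Pi.add_apply]
    rw [← add_smul]
    congr 1; ring

theorem fracGrad_smul {s : ℝ} (c : ℝ) {φ : Eucl n → ℝ} (hφ : ContDiff ℝ 1 φ) (x : Eucl n) :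
    fracGrad s (c • φ) x = c • fracGrad s φ x := by
  unfold fracGrad
  split_ifs with h
  · unfold gradient
    rw [fderiv_const_smul ((hφ.differentiable one_ne_zero) x), map_smulₛₗ]
    rfl
  · rw [smul_comm c, ← integral_smul c]
    congr 1
    refine integral_congr_ae (Eventually.of_forall fun z => ?_)
    simp only [Pi.smul_apply, smul_eq_mul, smul_smul]
    congr 1; ring

theorem measurable_heatGrad {φ : Eucl n → ℝ} (hφ : Continuous φ) :
    Measurable fun p : ℝ × Eucl n => heatGrad p.1 φ p.2 := by
  have hm : Measurable fun q : (ℝ × Eucl n) × Eucl n =>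
      (heatKer q.1.1 q.2 / (2 * q.1.1) * φ (q.1.2 + q.2)) • q.2 := by
    have h1 := hφ.measurable
    have h2 : Measurable fun q : (ℝ × Eucl n) × Eucl n => heatKer q.1.1 q.2 :=
      measurable_heatKer.comp (by fun_prop : Measurable fun q : (ℝ × Eucl n) × Eucl n =>
        ((q.1.1, q.2) : ℝ × Eucl n))
    fun_prop
  exact (hm.stronglyMeasurable.integral_prod_right' (ν := volume)).measurable

/-- `∇p_a *` is antisymmetric, since the kernel `∇p_a` is odd. -/
theorem integral_smul_heatGrad {a : ℝ} (ha : 0 < a) {φ ψ : Eucl n → ℝ} {M L M' L' : ℝ}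
    (hφ : BddLip φ M L) (hφi : Integrable φ) (hψ : BddLip ψ M' L') (hψi : Integrable ψ) :
    ∫ x, ψ x • heatGrad a φ x = -∫ x, φ x • heatGrad a ψ x := by
  have key : ∀ {φ ψ : Eucl n → ℝ} {M L M' L' : ℝ}, BddLip φ M L → BddLip ψ M' L' →
      Integrable ψ → ∫ x, ψ x • heatGrad a φ x =
        ∫ z : Eucl n, (heatKer a z / (2 * a) * ∫ x, ψ x * φ (x + z)) • z := by
    intro φ ψ M L M' L' hφ hψ hψi
    have hint : Integrable (fun p : Eucl n × Eucl n =>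
        ψ p.1 • (heatKer a p.2 / (2 * a) * φ (p.1 + p.2)) • p.2) (volume.prod volume) := by
      have h1 := hφ.cont
      have h2 := hψ.cont
      have h3 := continuous_heatKer (n := n) a
      refine (hψi.norm.mul_prod ((integrable_norm_mul_heatKer ha).const_mul (M / (2 * a)))).mono'
        (Continuous.aestronglyMeasurable (by fun_prop)) (Eventually.of_forall fun p => ?_)
      rw [norm_smul, norm_smul, norm_mul, Real.norm_of_nonneg
        (div_nonneg (heatKer_pos ha p.2).le (by positivity) : 0 ≤ heatKer a p.2 / (2 * a))]
      refine mul_le_mul_of_nonneg_left ?_ (norm_nonneg _)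
      calc heatKer a p.2 / (2 * a) * ‖φ (p.1 + p.2)‖ * ‖p.2‖
          ≤ heatKer a p.2 / (2 * a) * M * ‖p.2‖ := by
            have := heatKer_pos ha p.2
            gcongr
            exact hφ.bdd _
        _ = _ := by ring
    unfold heatGrad
    simp only [← integral_smul]
    rw [integral_integral_swap (f := fun (x z : Eucl n) =>
      ψ x • (heatKer a z / (2 * a) * φ (x + z)) • z) hint]
    refine integral_congr_ae (Eventually.of_forall fun z => ?_)
    simp only [smul_smul]
    rw [integral_smul_const, ← integral_const_mul]
    congr 1
    refine integral_congr_ae (Eventually.of_forall fun x => ?_)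
    simp only
    ring
  rw [key hφ hψ hψi, key hψ hφ hφi]
  have hneg := integral_neg_eq_self
    (fun z : Eucl n => (heatKer a z / (2 * a) * ∫ x, ψ x * φ (x + z)) • z) volume
  rw [← hneg, ← integral_neg]
  refine integral_congr_ae (Eventually.of_forall fun z => ?_)
  simp only [heatKer_neg, smul_neg]
  have := integral_sub_right_eq_self (fun x => φ x * ψ (x + z)) z (μ := volume)
  rw [← this]
  simp only [sub_add_cancel, ← sub_eq_add_neg]
  simp only [mul_comm (ψ _)]

theorem integrable_prod_smul_heatGrad {α : ℝ} (hα0 : 0 < α) (hα1 : α < 1 / 2) {φ ψ : Eucl n → ℝ}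
    {M L : ℝ} (hφ : BddLip φ M L) (hL : 0 ≤ L) (hψi : Integrable ψ) :
    Integrable (fun p : ℝ × Eucl n => ψ p.2 • p.1 ^ (α - 1) • heatGrad p.1 φ p.2)
      ((volume.restrict (Ioi (0 : ℝ))).prod volume) := by
  have hM := hφ.M_nonneg
  have hI := (integrableOn_rpow_mul_min (α := α) (A := n * L) (B := 2 * M * (n + 1))
    hα0 hα1 (by positivity) (by positivity)).1
  have hm := measurable_heatGrad hφ.cont
  refine (hI.mul_prod hψi.norm).mono' (hψi.1.comp_snd.smul
    (((measurable_fst.pow_const _).smul hm).aestronglyMeasurable)) ?_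
  have : ∀ᵐ p ∂((volume.restrict (Ioi (0 : ℝ))).prod (volume : Measure (Eucl n))),
      p.1 ∈ Ioi (0 : ℝ) :=
    Measure.quasiMeasurePreserving_fst.ae (ae_restrict_mem measurableSet_Ioi)
  filter_upwards [this] with p hp
  have hp' : 0 < p.1 := hp
  rw [norm_smul, norm_smul, Real.norm_of_nonneg (by positivity : 0 ≤ p.1 ^ (α - 1)), mul_comm]
  gcongr
  exact norm_heatGrad_le hp hφ _

theorem integral_smul_fracGrad_eq {s : ℝ} (hs0 : 0 < s) (hs1 : s < 1) {φ ψ : Eucl n → ℝ}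
    {M L : ℝ} (hφ : BddLip φ M L) (hL : 0 ≤ L) (hψi : Integrable ψ) :
    ∫ x, ψ x • fracGrad s φ x = (Real.Gamma ((1 - s) / 2))⁻¹ •
      ∫ a in Ioi (0 : ℝ), a ^ ((1 - s) / 2 - 1) • ∫ x, ψ x • heatGrad a φ x := by
  have hint := integrable_prod_smul_heatGrad (α := (1 - s) / 2) (by linarith) (by linarith)
    hφ hL hψi
  have h1 : ∀ x, ψ x • fracGrad s φ x = (Real.Gamma ((1 - s) / 2))⁻¹ •
      ∫ a in Ioi (0 : ℝ), ψ x • a ^ ((1 - s) / 2 - 1) • heatGrad a φ x := fun x => by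
    rw [(fracGrad_eq_integral_heatGrad hs0 hs1 hφ hL x).2, smul_comm, integral_smul (ψ x)]
  have h2 := integral_integral_swap (f := fun (a : ℝ) (x : Eucl n) =>
    ψ x • a ^ ((1 - s) / 2 - 1) • heatGrad a φ x) hint
  rw [integral_congr_ae (Eventually.of_forall h1), integral_smul, ← h2]
  congr 1
  refine integral_congr_ae (Eventually.of_forall fun a => ?_)
  simp only [← integral_smul (a ^ ((1 - s) / 2 - 1))]
  refine integral_congr_ae (Eventually.of_forall fun x => ?_)
  exact smul_comm _ _ _

theorem integral_smul_fracGrad_of_lt {s : ℝ} (hs0 : 0 < s) (hs1 : s < 1) {φ ψ : Eucl n → ℝ}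
    {M L M' L' : ℝ} (hφ : BddLip φ M L) (hφi : Integrable φ) (hL : 0 ≤ L)
    (hψ : BddLip ψ M' L') (hψi : Integrable ψ) (hL' : 0 ≤ L') :
    ∫ x, ψ x • fracGrad s φ x = -∫ x, φ x • fracGrad s ψ x := by
  rw [integral_smul_fracGrad_eq hs0 hs1 hφ hL hψi, integral_smul_fracGrad_eq hs0 hs1 hψ hL' hφi,
    ← smul_neg, ← integral_neg]
  congr 1
  refine setIntegral_congr_fun measurableSet_Ioi fun a ha => ?_
  rw [integral_smul_heatGrad ha hφ hφi hψ hψi, smul_neg]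

theorem inner_gradient {φ : Eucl n → ℝ} (x v : Eucl n) :
    inner ℝ (gradient φ x) v = fderiv ℝ φ x v := by
  unfold gradient
  exact InnerProductSpace.toDual_symm_apply

/-- Integration by parts: `Dˢ` is antisymmetric on test functions. -/
theorem integral_smul_fracGrad {s : ℝ} (hs : s ∈ Ioc (0 : ℝ) 1) {φ ψ : Eucl n → ℝ}
    (hφ : ContDiff ℝ 1 φ) (hφc : HasCompactSupport φ)
    (hψ : ContDiff ℝ 1 ψ) (hψc : HasCompactSupport ψ) :
    ∫ x, ψ x • fracGrad s φ x = -∫ x, φ x • fracGrad s ψ x := by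
  rcases eq_or_lt_of_le hs.2 with rfl | hs1
  · unfold fracGrad
    simp only [if_true]
    have hi : ∀ {φ ψ : Eucl n → ℝ}, ContDiff ℝ 1 φ → ContDiff ℝ 1 ψ → HasCompactSupport ψ →
        Integrable fun x => ψ x • gradient φ x := fun hφ hψ hψc =>
      (hψ.continuous.smul (continuous_gradient hφ)).integrable_of_hasCompactSupport
        hψc.smul_right
    refine ext_inner_right ℝ fun v => ?_
    rw [inner_neg_left, real_inner_comm, real_inner_comm v, ← integral_inner (hi hφ hψ hψc),
      ← integral_inner (hi hψ hφ hφc)]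
    simp only [inner_smul_right, real_inner_comm (gradient _ _) v, inner_gradient]
    have hf : ∀ {φ : Eucl n → ℝ}, ContDiff ℝ 1 φ → Continuous fun x => fderiv ℝ φ x v := fun h =>
      (h.continuous_fderiv one_ne_zero).clm_apply continuous_const
    rw [integral_mul_fderiv_eq_neg_fderiv_mul_of_integrable]
    · congr 2; ext x; ring
    · exact ((hf hψ).mul hφ.continuous).integrable_of_hasCompactSupport hφc.mul_left
    · exact (hψ.continuous.mul (hf hφ)).integrable_of_hasCompactSupport hψc.mul_right
    · exact (hψ.continuous.mul hφ.continuous).integrable_of_hasCompactSupport hψc.mul_right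
    · exact fun x _ => hψ.differentiable one_ne_zero x
    · exact fun x _ => hφ.differentiable one_ne_zero x
  · obtain ⟨M, L, h, hL⟩ := exists_bddLip hφ hφc
    obtain ⟨M', L', h', hL'⟩ := exists_bddLip hψ hψc
    exact integral_smul_fracGrad_of_lt hs.1 hs1 h
        (hφ.continuous.integrable_of_hasCompactSupport hφc)
      hL h' (hψ.continuous.integrable_of_hasCompactSupport hψc) hL'

end FracGradOperations

/-! ### The divergence of the heat extension of `Dˢφ` -/

section HeatIdentities

variable {n : ℕ}

/-- The semigroup law in the form `div e^{τΔ} ∇e^{aΔ}φ = Δe^{(a+τ)Δ}φ`. -/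
theorem heatDiv_heatGrad {a τ : ℝ} (ha : 0 < a) (hτ : 0 < τ) {φ : Eucl n → ℝ} {M L : ℝ}
    (h : BddLip φ M L) (x : Eucl n) :
    heatDiv τ (heatGrad a φ) x = heatLap (a + τ) φ x := by
  have hφ := h.cont
  have hM := h.M_nonneg
  have hca := continuous_heatKer (n := n) a
  have hcτ := continuous_heatKer (n := n) τ
  let H : Eucl n × Eucl n → ℝ := fun p =>
    heatKer τ p.1 / (2 * τ) * (heatKer a p.2 / (2 * a) * φ (x + p.1 + p.2) * inner ℝ p.1 p.2)
  have hH : Integrable H (volume.prod volume) := by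
    refine (((integrable_norm_mul_heatKer hτ).const_mul (1 / (2 * τ))).mul_prod
      ((integrable_norm_mul_heatKer ha).const_mul (M / (2 * a)))).mono'
      (Continuous.aestronglyMeasurable (by fun_prop)) (Eventually.of_forall fun p => ?_)
    have h1 := heatKer_pos hτ p.1
    have h2 := heatKer_pos ha p.2
    simp only [H]
    rw [norm_mul, norm_mul, norm_mul,
      Real.norm_of_nonneg (by positivity : 0 ≤ heatKer τ p.1 / (2 * τ)),
      Real.norm_of_nonneg (by positivity : 0 ≤ heatKer a p.2 / (2 * a))]
    calc _ ≤ heatKer τ p.1 / (2 * τ) * (heatKer a p.2 / (2 * a) * M * (‖p.1‖ * ‖p.2‖)) := by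
          gcongr
          · exact h.bdd _
          · exact norm_inner_le_norm _ _
      _ = _ := by ring
  have hH2 : Integrable (fun p : Eucl n × Eucl n => H (p.1, -p.1 + p.2)) (volume.prod volume) :=
    (measurePreserving_prod_neg_add volume volume).integrable_comp_of_integrable hH
  have h1 : ∀ z : Eucl n, heatKer τ z / (2 * τ) * inner ℝ z (heatGrad a φ (x + z)) =
      ∫ ζ : Eucl n, H (z, -z + ζ) := by
    intro z
    rw [integral_add_left_eq_self (fun w => H (z, w))]
    unfold heatGrad
    rw [← integral_inner (integrable_heatKer_smul ha h (x + z)), ← integral_const_mul]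
    refine integral_congr_ae (Eventually.of_forall fun w => ?_)
    simp only [H, inner_smul_right]
  unfold heatDiv
  simp only [h1]
  rw [integral_integral_swap (f := fun (z ζ : Eucl n) => H (z, -z + ζ)) hH2]
  unfold heatLap
  refine integral_congr_ae (Eventually.of_forall fun ζ => ?_)
  simp only
  rw [← integral_inner_mul_heatKer_mul_heatKer ha hτ, ← integral_mul_const]
  refine integral_congr_ae (Eventually.of_forall fun z => ?_)
  simp only [H]
  rw [neg_add_eq_sub, add_assoc x, add_sub_cancel]
  field_simp
  ring

/-- For `s < 1`, `div e^{τΔ}Dˢφ` is the Weyl fractional integral of order `(1-s)/2` of the heat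
Laplacian `r ↦ Δe^{rΔ}φ`, at time `τ`. -/
theorem heatDiv_fracGrad_of_lt {s τ : ℝ} (hs0 : 0 < s) (hs1 : s < 1) (hτ : 0 < τ)
    {φ : Eucl n → ℝ} {M L : ℝ} (h : BddLip φ M L) (hL : 0 ≤ L) (x : Eucl n) :
    heatDiv τ (fracGrad s φ) x = (Real.Gamma ((1 - s) / 2))⁻¹ *
      ∫ a in Ioi (0 : ℝ), a ^ ((1 - s) / 2 - 1) * heatLap (a + τ) φ x := by
  set α := (1 - s) / 2 with hα
  have hα0 : 0 < α := by rw [hα]; linarith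
  have hα1 : α < 1 / 2 := by rw [hα]; linarith
  have hM := h.M_nonneg
  have hI := (integrableOn_rpow_mul_min (α := α) (A := n * L) (B := 2 * M * (n + 1))
    hα0 hα1 (by positivity) (by positivity)).1
  have hm : Measurable fun p : ℝ × Eucl n => heatGrad p.1 φ (x + p.2) :=
    (measurable_heatGrad h.cont).comp (measurable_fst.prodMk (measurable_snd.const_add x))
  have hk := (continuous_heatKer (n := n) τ).measurable
  have hIa : ∀ y, IntegrableOn (fun a : ℝ => a ^ (α - 1) • heatGrad a φ y) (Ioi 0) := by
    intro y
    have hm2 := (measurable_heatGrad h.cont).comp (measurable_prodMk_right (y := y))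
    have hm3 : Measurable fun a : ℝ => a ^ (α - 1) := by fun_prop
    refine hI.mono' (hm3.smul hm2).aestronglyMeasurable
      ((ae_restrict_iff' measurableSet_Ioi).2 (Eventually.of_forall fun a ha => ?_))
    have ha' : 0 < a := ha
    rw [norm_smul, Real.norm_of_nonneg (by positivity)]
    gcongr
    exact norm_heatGrad_le ha h y
  have hint : Integrable (fun p : ℝ × Eucl n => heatKer τ p.2 / (2 * τ) *
      inner ℝ p.2 (p.1 ^ (α - 1) • heatGrad p.1 φ (x + p.2)))
      ((volume.restrict (Ioi (0 : ℝ))).prod volume) := by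
    refine (hI.mul_prod ((integrable_norm_mul_heatKer hτ).const_mul (1 / (2 * τ)))).mono'
      (((hk.comp measurable_snd).div_const _).mul (measurable_snd.inner
        ((measurable_fst.pow_const _).smul hm))).aestronglyMeasurable ?_
    have : ∀ᵐ p ∂((volume.restrict (Ioi (0 : ℝ))).prod (volume : Measure (Eucl n))),
        p.1 ∈ Ioi (0 : ℝ) :=
      Measure.quasiMeasurePreserving_fst.ae (ae_restrict_mem measurableSet_Ioi)
    filter_upwards [this] with p hp
    have hp' : 0 < p.1 := hp
    have h2 := heatKer_pos hτ p.2
    rw [norm_mul, Real.norm_of_nonneg (by positivity : 0 ≤ heatKer τ p.2 / (2 * τ))]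
    calc _ ≤ heatKer τ p.2 / (2 * τ) * (‖p.2‖ * (p.1 ^ (α - 1) *
          min (n * L) (2 * M * (n + 1) * p.1 ^ (-(1 / 2) : ℝ)))) := by
          gcongr
          refine (norm_inner_le_norm _ _).trans ?_
          rw [norm_smul, Real.norm_of_nonneg (by positivity : 0 ≤ p.1 ^ (α - 1))]
          gcongr
          exact norm_heatGrad_le hp h _
      _ = _ := by ring
  have h1 : ∀ z : Eucl n, heatKer τ z / (2 * τ) * inner ℝ z (fracGrad s φ (x + z)) =
      (Real.Gamma α)⁻¹ * ∫ a in Ioi (0 : ℝ), heatKer τ z / (2 * τ) *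
        inner ℝ z (a ^ (α - 1) • heatGrad a φ (x + z)) := by
    intro z
    rw [(fracGrad_eq_integral_heatGrad hs0 hs1 h hL (x + z)).2, inner_smul_right,
      ← integral_inner (hIa (x + z)), integral_const_mul]
    ring
  have h2 := integral_integral_swap (f := fun (a : ℝ) (z : Eucl n) => heatKer τ z / (2 * τ) *
      inner ℝ z (a ^ (α - 1) • heatGrad a φ (x + z))) hint
  unfold heatDiv
  rw [integral_congr_ae (Eventually.of_forall h1), integral_const_mul, ← h2]
  congr 1
  refine setIntegral_congr_fun measurableSet_Ioi fun a ha => ?_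
  have h3 := heatDiv_heatGrad ha hτ h x
  unfold heatDiv at h3
  rw [← h3, ← integral_const_mul]
  refine integral_congr_ae (Eventually.of_forall fun z => ?_)
  simp only [inner_smul_right]
  ring

theorem hasFDerivAt_heatKer_mul (τ : ℝ) (i : Fin n) (z : Eucl n) :
    HasFDerivAt (fun z : Eucl n => heatKer τ z / (2 * τ) * z i)
      ((heatKer τ z / (2 * τ)) • (EuclideanSpace.proj i : Eucl n →L[ℝ] ℝ) -
        (z i * heatKer τ z / (4 * τ ^ 2)) • innerSL ℝ z) z := by
  have h1 : HasFDerivAt (fun z : Eucl n => Real.exp (-‖z‖ ^ 2 / (4 * τ)))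
      (Real.exp (-‖z‖ ^ 2 / (4 * τ)) • (-(1 / (4 * τ)) • (2 • innerSL ℝ z))) z := by
    have h2 : HasFDerivAt (fun z : Eucl n => ‖z‖ ^ 2) (2 • innerSL ℝ z) z :=
      (hasStrictFDerivAt_norm_sq z).hasFDerivAt
    have h3 := (h2.const_mul (-(1 / (4 * τ)))).exp
    convert! h3 using 1
    · ext y; congr 1; ring
    · congr 2; ring
  have h4 := (EuclideanSpace.proj i : Eucl n →L[ℝ] ℝ).hasFDerivAt (x := z)
  have h5 := ((h1.const_mul ((4 * Real.pi * τ) ^ (-(n : ℝ) / 2))).mul_const (1 / (2 * τ))).mul h4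
  convert! h5 using 1
  · ext y
    simp [heatKer, div_eq_mul_inv]
  · ext v
    simp [heatKer]
    field_simp
    ring

/-- The limiting case of order `0` of `heatDiv_fracGrad_of_lt`, by parts. -/
theorem heatDiv_fracGrad_one {τ : ℝ} (hτ : 0 < τ) {φ : Eucl n → ℝ} (hφ : ContDiff ℝ 1 φ)
    (hc : HasCompactSupport φ) (x : Eucl n) :
    heatDiv τ (fracGrad 1 φ) x = heatLap τ φ x := by
  have hcτ := continuous_heatKer (n := n) τ
  have hφx : ContDiff ℝ 1 fun z => φ (x + z) := hφ.comp (contDiff_const.add contDiff_id)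
  have hcx : HasCompactSupport fun z => φ (x + z) :=
    hc.comp_homeomorph (Homeomorph.addLeft x)
  have hder : ∀ z v, fderiv ℝ (fun z => φ (x + z)) z v = fderiv ℝ φ (x + z) v := fun z v => by
    rw [fderiv_comp_add_left]
  let e : Fin n → Eucl n := fun i => EuclideanSpace.single i 1
  have hin : ∀ z : Eucl n, heatKer τ z / (2 * τ) * inner ℝ z (fracGrad 1 φ (x + z)) =
      ∑ i, heatKer τ z / (2 * τ) * z i * fderiv ℝ (fun z => φ (x + z)) z (e i) := by
    intro z
    unfold fracGrad
    simp only [if_true]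
    rw [real_inner_comm, inner_gradient]
    have hz : z = ∑ i, z i • e i := by
      ext j
      simp [e, Pi.single_apply]
    conv_lhs => rw [hz]
    rw [map_sum, ← hz, Finset.mul_sum]
    refine Finset.sum_congr rfl fun i _ => ?_
    rw [map_smul, hder, smul_eq_mul]
    ring
  have hcd : ∀ i, Continuous fun z => fderiv ℝ (fun z => φ (x + z)) z (e i) := fun i =>
    (hφx.continuous_fderiv one_ne_zero).clm_apply continuous_const
  have hf : ∀ (i : Fin n) (z : Eucl n),
      fderiv ℝ (fun z : Eucl n => heatKer τ z / (2 * τ) * z i) z (e i) =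
      heatKer τ z / (2 * τ) - z i ^ 2 * heatKer τ z / (4 * τ ^ 2) := by
    intro i z
    rw [(hasFDerivAt_heatKer_mul τ i z).fderiv]
    simp [e, EuclideanSpace.inner_single_right]
    ring
  have hparts : ∀ i, ∫ z, heatKer τ z / (2 * τ) * z i * fderiv ℝ (fun z => φ (x + z)) z (e i) =
      ∫ z, -((heatKer τ z / (2 * τ) - z i ^ 2 * heatKer τ z / (4 * τ ^ 2)) * φ (x + z)) := by
    intro i
    rw [integral_neg, integral_mul_fderiv_eq_neg_fderiv_mul_of_integrable
      (f := fun z : Eucl n => heatKer τ z / (2 * τ) * z i)]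
    · simp only [hf]
    · simp only [hf]
      exact Continuous.integrable_of_hasCompactSupport (by have := hφ.continuous; fun_prop)
        hcx.mul_left
    · have := hcd i
      exact Continuous.integrable_of_hasCompactSupport (by fun_prop)
        (HasCompactSupport.mul_left (hcx.fderiv_apply ℝ (e i)))
    · exact Continuous.integrable_of_hasCompactSupport (by have := hφ.continuous; fun_prop)
        hcx.mul_left
    · exact fun z _ => (hasFDerivAt_heatKer_mul τ i z).differentiableAt
    · exact fun z _ => hφx.differentiable one_ne_zero z
  unfold heatDiv heatLap
  simp only [hin]
  rw [integral_finsetSum]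
  · simp only [hparts]
    rw [← integral_finsetSum]
    · refine integral_congr_ae (Eventually.of_forall fun z => ?_)
      simp only
      have hsum : ∑ i, z i ^ 2 * heatKer τ z / (4 * τ ^ 2) =
          ‖z‖ ^ 2 * heatKer τ z / (4 * τ ^ 2) := by
        rw [← Finset.sum_div, ← Finset.sum_mul, ← EuclideanSpace.real_norm_sq_eq]
      rw [Finset.sum_neg_distrib, ← Finset.sum_mul, Finset.sum_sub_distrib, hsum]
      simp [heatLapKer]
      field_simp
      ring
    · intro i _
      exact Continuous.integrable_of_hasCompactSupport (by have := hφ.continuous; fun_prop)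
        (hcx.mul_left).neg
  · intro i _
    have := hcd i
    exact Continuous.integrable_of_hasCompactSupport (by fun_prop)
      (HasCompactSupport.mul_left (hcx.fderiv_apply ℝ (e i)))

end HeatIdentities

/-! ### Weyl fractional integrals and the heat flow in time -/

section Weyl

/-- The beta integral `∫_0^∞ u^(α-1) (1+u)⁻¹ du`. -/
noncomputable def betaConst (α : ℝ) : ℝ :=
  ∫ u in Ioi (0 : ℝ), u ^ (α - 1) * (1 + u)⁻¹

theorem integrableOn_betaConst {α : ℝ} (h0 : 0 < α) (h1 : α < 1) :
    IntegrableOn (fun u : ℝ => u ^ (α - 1) * (1 + u)⁻¹) (Ioi 0) := by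
  have hm : Measurable fun u : ℝ => u ^ (α - 1) * (1 + u)⁻¹ := by fun_prop
  rw [← Ioc_union_Ioi_eq_Ioi zero_le_one]
  refine IntegrableOn.union ?_ ?_
  · have h : IntegrableOn (fun u : ℝ => u ^ (α - 1)) (Ioc 0 1) :=
      (intervalIntegrable_iff_integrableOn_Ioc_of_le zero_le_one).1
        (intervalIntegral.intervalIntegrable_rpow' (by linarith))
    refine h.mono' hm.aestronglyMeasurable
      ((ae_restrict_iff' measurableSet_Ioc).2 (Eventually.of_forall fun u hu => ?_))
    have hu0 : 0 < u := hu.1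
    rw [Real.norm_of_nonneg (by positivity)]
    exact mul_le_of_le_one_right (by positivity) (inv_le_one_of_one_le₀ (by linarith))
  · refine (integrableOn_Ioi_rpow_of_lt (by linarith : α - 2 < -1) one_pos).mono'
      hm.aestronglyMeasurable
      ((ae_restrict_iff' measurableSet_Ioi).2 (Eventually.of_forall fun u hu => ?_))
    have hu1 : 1 < u := hu
    have hu0 : 0 < u := by linarith
    rw [Real.norm_of_nonneg (by positivity), show α - 2 = (α - 1) - 1 by ring,
      Real.rpow_sub_one hu0.ne' (α - 1), div_eq_mul_inv]
    gcongr
    linarith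

/-- This growth as `α → 0` compensates `1/Γ(α) → 0`, so that the constants below do not degenerate
as `s → 1`. -/
theorem le_betaConst {α : ℝ} (h0 : 0 < α) (h1 : α < 1) : 1 / (2 * α) ≤ betaConst α := by
  have hI := integrableOn_betaConst h0 h1
  have h : IntervalIntegrable (fun u : ℝ => u ^ (α - 1)) volume 0 1 :=
    intervalIntegral.intervalIntegrable_rpow' (by linarith)
  have h2 : ∫ u in Ioc (0 : ℝ) 1, u ^ (α - 1) * 2⁻¹ = 1 / (2 * α) := by
    rw [integral_mul_const, ← intervalIntegral.integral_of_le zero_le_one,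
      integral_rpow (Or.inl (by linarith))]
    simp [Real.zero_rpow h0.ne']
  rw [← h2]
  calc _ ≤ ∫ u in Ioc (0 : ℝ) 1, u ^ (α - 1) * (1 + u)⁻¹ := by
        refine setIntegral_mono_on (((intervalIntegrable_iff_integrableOn_Ioc_of_le
          zero_le_one).1 h).mul_const _) (hI.mono_set Ioc_subset_Ioi_self) measurableSet_Ioc
          fun u hu => ?_
        have hu0 : 0 < u := hu.1
        have hu1 : u ≤ 1 := hu.2
        gcongr
        linarith
    _ ≤ _ := by
        refine setIntegral_mono_set hI ?_ Ioc_subset_Ioi_self.eventuallyLE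
        filter_upwards [ae_restrict_mem measurableSet_Ioi] with u hu
        have hu0 : 0 < u := hu
        simp only [Pi.zero_apply]
        positivity

/-- Integrating the Weyl fractional integral of `f` against `τ^(-α)` gives a multiple of `∫ f`. -/
theorem integral_rpow_neg_mul_weyl {α : ℝ} (h0 : 0 < α) (h1 : α < 1) {f : ℝ → ℝ}
    (hm : Measurable f) (hf : IntegrableOn f (Ioi 0)) :
    IntegrableOn (fun τ : ℝ => τ ^ (-α) * ∫ a in Ioi (0 : ℝ), a ^ (α - 1) * f (a + τ)) (Ioi 0) ∧
      ∫ τ in Ioi (0 : ℝ), τ ^ (-α) * ∫ a in Ioi (0 : ℝ), a ^ (α - 1) * f (a + τ) =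
        betaConst α * ∫ r in Ioi (0 : ℝ), f r := by
  have hsub : ∀ g : ℝ → ℝ, ∀ u ∈ Ioi (0 : ℝ),
      ∫ τ in Ioi (0 : ℝ), g ((1 + u) * τ) = (1 + u)⁻¹ * ∫ r in Ioi (0 : ℝ), g r := by
    intro g u hu
    have hu0 : 0 < u := hu
    have := integral_comp_mul_left_Ioi g 0 (by linarith : 0 < 1 + u)
    rwa [mul_zero, smul_eq_mul] at this
  have hsubi : ∀ u ∈ Ioi (0 : ℝ), IntegrableOn (fun τ => f ((1 + u) * τ)) (Ioi 0) := by
    intro u hu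
    have hu0 : 0 < u := hu
    have := integrableOn_Ioi_comp_mul_left_iff f 0 (by linarith : 0 < 1 + u)
    rw [mul_zero] at this
    exact this.2 hf
  have hF : Integrable (fun q : ℝ × ℝ => q.1 ^ (α - 1) * f ((1 + q.1) * q.2))
      ((volume.restrict (Ioi (0 : ℝ))).prod (volume.restrict (Ioi (0 : ℝ)))) := by
    rw [integrable_prod_iff (Measurable.aestronglyMeasurable (by fun_prop))]
    constructor
    · filter_upwards [ae_restrict_mem measurableSet_Ioi] with u hu
      exact (hsubi u hu).const_mul _
    · refine ((integrableOn_betaConst h0 h1).mul_const (∫ r in Ioi (0 : ℝ), ‖f r‖)).congr ?_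
      filter_upwards [ae_restrict_mem measurableSet_Ioi] with u hu
      have hu0 : 0 < u := hu
      simp only [norm_mul]
      rw [integral_const_mul, hsub (fun r => ‖f r‖) u hu, Real.norm_of_nonneg (by positivity)]
      ring
  have key : ∀ τ ∈ Ioi (0 : ℝ), ∫ u in Ioi (0 : ℝ), u ^ (α - 1) * f ((1 + u) * τ) =
      τ ^ (-α) * ∫ a in Ioi (0 : ℝ), a ^ (α - 1) * f (a + τ) := by
    intro τ hτ
    have hτ0 : 0 < τ := hτ
    have := integral_comp_mul_left_Ioi (fun a => a ^ (α - 1) * f (a + τ)) 0 hτ0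
    rw [mul_zero, smul_eq_mul, inv_mul_eq_div, eq_div_iff hτ0.ne'] at this
    rw [← this, mul_comm _ τ, ← mul_assoc, ← integral_const_mul]
    refine setIntegral_congr_fun measurableSet_Ioi fun u hu => ?_
    have hu0 : 0 < u := hu
    rw [Real.mul_rpow hτ0.le hu0.le, show (1 + u) * τ = τ * u + τ by ring]
    have : τ ^ (-α) * τ * τ ^ (α - 1) = 1 := by
      rw [← Real.rpow_add_one hτ0.ne', ← Real.rpow_add hτ0]
      simp
    rw [show τ ^ (-α) * τ * (τ ^ (α - 1) * u ^ (α - 1) * f (τ * u + τ)) =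
      (τ ^ (-α) * τ * τ ^ (α - 1)) * (u ^ (α - 1) * f (τ * u + τ)) by ring, this, one_mul]
  constructor
  · refine Integrable.congr hF.integral_prod_right ?_
    filter_upwards [ae_restrict_mem measurableSet_Ioi] with τ hτ
    exact key τ hτ
  · rw [← setIntegral_congr_fun measurableSet_Ioi key,
      ← integral_integral_swap (f := fun u τ => u ^ (α - 1) * f ((1 + u) * τ)) hF]
    unfold betaConst
    rw [← integral_mul_const]
    refine setIntegral_congr_fun measurableSet_Ioi fun u hu => ?_
    rw [integral_const_mul, hsub f u hu]
    ring

end Weyl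

theorem integral_Ioi_comp_add_right (f : ℝ → ℝ) (t : ℝ) :
    ∫ r in Ioi (0 : ℝ), f (r + t) = ∫ r in Ioi t, f r := by
  have := (measurePreserving_add_right (volume : Measure ℝ) t).setIntegral_preimage_emb
    (measurableEmbedding_addRight t) f (Ioi t)
  simpa using this

theorem integrableOn_Ioi_comp_add_right {f : ℝ → ℝ} {t : ℝ} (hf : IntegrableOn f (Ioi t)) :
    IntegrableOn (fun r => f (r + t)) (Ioi 0) := by
  have := ((measurePreserving_add_right (volume : Measure ℝ) t).integrableOn_comp_preimage
    (measurableEmbedding_addRight t) (f := f) (s := Ioi t)).2 hf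
  simpa [Function.comp_def] using this

section HeatTime

variable {n : ℕ}

theorem measurable_heatLapKer : Measurable fun p : ℝ × Eucl n => heatLapKer p.1 p.2 := by
  have := measurable_heatKer (n := n)
  unfold heatLapKer
  fun_prop

theorem measurable_heatLap {φ : Eucl n → ℝ} (hφ : Measurable φ) (x : Eucl n) :
    Measurable fun r : ℝ => heatLap r φ x := by
  have h : Measurable fun p : ℝ × Eucl n => heatLapKer p.1 p.2 * φ (x + p.2) :=
    measurable_heatLapKer.mul (hφ.comp (measurable_snd.const_add x))
  exact h.stronglyMeasurable.integral_prod_right.measurable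

theorem abs_heatLap_le_integral {φ : Eucl n → ℝ} (hi : Integrable φ) {r : ℝ} (hr : 0 < r)
    (x : Eucl n) :
    |heatLap r φ x| ≤ (n + 1) * (4 * Real.pi * r) ^ (-(n : ℝ) / 2) * r⁻¹ * ∫ y, |φ y| := by
  unfold heatLap
  rw [← integral_add_left_eq_self (fun y => |φ y|) x, ← integral_const_mul]
  rw [← Real.norm_eq_abs]
  refine norm_integral_le_of_norm_le ((hi.comp_add_left x).abs.const_mul _)
    (Eventually.of_forall fun z => ?_)
  rw [norm_mul]
  exact mul_le_mul_of_nonneg_right (abs_heatLapKer_le hr z) (norm_nonneg _)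

theorem abs_heatDiv_le {τ : ℝ} (hτ : 0 < τ) {V : Eucl n → Eucl n} {B : ℝ} (hV : ∀ x, ‖V x‖ ≤ B)
    (x : Eucl n) : |heatDiv τ V x| ≤ B * ((n + 1) * τ ^ (-(1 / 2) : ℝ)) := by
  have hB : 0 ≤ B := (norm_nonneg _).trans (hV 0)
  refine le_trans ?_ (mul_le_mul_of_nonneg_left (integral_norm_div_mul_heatKer_le hτ) hB)
  unfold heatDiv
  rw [← integral_const_mul]
  have hI : Integrable fun z : Eucl n => B * (‖z‖ / (2 * τ) * heatKer τ z) := by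
    convert! (integrable_norm_mul_heatKer (n := n) hτ).const_mul (B / (2 * τ)) using 2
    ring
  rw [← Real.norm_eq_abs]
  refine norm_integral_le_of_norm_le hI (Eventually.of_forall fun z => ?_)
  have h := heatKer_pos hτ z
  rw [norm_mul, Real.norm_of_nonneg (by positivity : 0 ≤ heatKer τ z / (2 * τ))]
  calc _ ≤ heatKer τ z / (2 * τ) * (‖z‖ * B) := by
        gcongr
        exact (norm_inner_le_norm _ _).trans (by gcongr; exact hV _)
    _ = _ := by ring

/-- Writing `Δe^{rΔ} = div e^{(r/2)Δ} ∇e^{(r/2)Δ}` costs only `r^(-1/2)`, which is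
integrable at `0`. -/
theorem abs_heatLap_le_rpow {φ : Eucl n → ℝ} {M L : ℝ} (h : BddLip φ M L) {r : ℝ} (hr : 0 < r)
    (x : Eucl n) :
    |heatLap r φ x| ≤ n * L * ((n + 1) * (r / 2) ^ (-(1 / 2) : ℝ)) := by
  have h1 := heatDiv_heatGrad (half_pos hr) (half_pos hr) h x
  rw [add_halves] at h1
  rw [← h1]
  exact abs_heatDiv_le (half_pos hr)
    (fun y => (norm_heatGrad_le (half_pos hr) h y).trans (min_le_left _ _)) x

/-- Near `0` the bound `r^(-1/2)` applies, near infinity the bound `r^(-n/2-1)`. -/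
theorem integrableOn_heatLap (hn : 1 ≤ n) {φ : Eucl n → ℝ} {M L : ℝ} (h : BddLip φ M L)
    (hi : Integrable φ) (x : Eucl n) : IntegrableOn (fun r => heatLap r φ x) (Ioi 0) := by
  have hm := (measurable_heatLap h.cont.measurable x).aestronglyMeasurable (μ := volume)
  have hn' : (1 : ℝ) ≤ n := by exact_mod_cast hn
  rw [← Ioc_union_Ioi_eq_Ioi zero_le_one]
  refine IntegrableOn.union ?_ ?_
  · have hp : IntegrableOn (fun u : ℝ => u ^ (-(1 / 2) : ℝ)) (Ioc 0 1) :=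
      (intervalIntegrable_iff_integrableOn_Ioc_of_le zero_le_one).1
        (intervalIntegral.intervalIntegrable_rpow' (by norm_num))
    refine (hp.const_mul (n * L * ((n + 1) * (1 / 2 : ℝ) ^ (-(1 / 2) : ℝ)))).mono' hm.restrict
      ((ae_restrict_iff' measurableSet_Ioc).2 (Eventually.of_forall fun u hu => ?_))
    refine (abs_heatLap_le_rpow h hu.1 x).trans (le_of_eq ?_)
    rw [show u / 2 = 1 / 2 * u by ring, Real.mul_rpow (by norm_num) hu.1.le]
    ring
  · have hp := integrableOn_Ioi_rpow_of_lt (by linarith : -(n : ℝ) / 2 - 1 < -1) one_pos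
    refine (hp.const_mul ((n + 1) * (4 * Real.pi) ^ (-(n : ℝ) / 2) * ∫ y, |φ y|)).mono' hm.restrict
      ((ae_restrict_iff' measurableSet_Ioi).2 (Eventually.of_forall fun u hu => ?_))
    have hu0 : 0 < u := one_pos.trans hu
    refine (abs_heatLap_le_integral hi hu0 x).trans (le_of_eq ?_)
    rw [Real.mul_rpow (by positivity) hu0.le, Real.rpow_sub_one hu0.ne']
    ring

theorem hasDerivAt_heat {φ : Eucl n → ℝ} (hφ : Continuous φ) (hi : Integrable φ) {r : ℝ}
    (hr : 0 < r) (x : Eucl n) : HasDerivAt (fun t => heat t φ x) (heatLap r φ x) r := by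
  have hix : Integrable fun z => φ (x + z) := hi.comp_add_left x
  have hk : ∀ t, Continuous (heatKer (n := n) t) := continuous_heatKer
  have hint : ∀ t : ℝ, 0 < t → Integrable fun z => heatKer t z * φ (x + z) := fun t ht =>
    hix.bdd_mul (c := (4 * Real.pi * t) ^ (-(n : ℝ) / 2)) (hk t).aestronglyMeasurable
      (Eventually.of_forall fun z => by
        rw [Real.norm_of_nonneg (heatKer_pos ht z).le]; exact heatKer_le ht z)
  refine (hasDerivAt_integral_of_dominated_loc_of_deriv_le
    (F := fun t z => heatKer t z * φ (x + z)) (F' := fun t z => heatLapKer t z * φ (x + z))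
    (bound := fun z => (n + 1) * (4 * Real.pi * (r / 2)) ^ (-(n : ℝ) / 2) * (r / 2)⁻¹ * ‖φ (x + z)‖)
    (s := Ioi (r / 2)) (Ioi_mem_nhds (half_lt_self hr)) ?_ (hint r hr) ?_ ?_ ?_ ?_).2
  · filter_upwards [Ioi_mem_nhds hr] with t ht
    exact (hint t ht).aestronglyMeasurable
  · refine (Measurable.aestronglyMeasurable ?_)
    exact (measurable_heatLapKer.comp measurable_prodMk_left).mul
      (hφ.measurable.comp (measurable_const_add x))
  · refine Eventually.of_forall fun z t ht => ?_
    have ht' : r / 2 < t := ht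
    have ht0 : 0 < t := (half_pos hr).trans ht'
    rw [norm_mul]
    gcongr
    refine (abs_heatLapKer_le ht0 z).trans ?_
    gcongr ?_ * ?_ * ?_
    · exact Real.rpow_le_rpow_of_nonpos (by positivity) (by gcongr)
        (by rw [neg_div]; simp only [Left.neg_nonpos_iff]; positivity)
    · gcongr
  · exact hix.norm.const_mul _
  · refine Eventually.of_forall fun z t ht => ?_
    have ht0 : 0 < t := (half_pos hr).trans ht
    exact (hasDerivAt_heatKer ht0 z).mul_const _

theorem abs_heat_sub_le {φ : Eucl n → ℝ} {M L : ℝ} (h : BddLip φ M L) (hL : 0 ≤ L)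
    {t : ℝ} (ht : 0 < t) (x : Eucl n) :
    |heat t φ x - φ x| ≤ L * (2 * t * ((n + 1) * t ^ (-(1 / 2) : ℝ))) := by
  have hk := continuous_heatKer (n := n) t
  have hφ := h.cont
  have h1 : Integrable fun z => heatKer t z * φ (x + z) :=
    (integrable_heatKer ht).mul_bdd (c := M) (by fun_prop)
      (Eventually.of_forall fun z => h.bdd _)
  have h2 : heat t φ x - φ x = ∫ z, heatKer t z * (φ (x + z) - φ x) := by
    simp only [mul_sub]
    rw [integral_sub h1 ((integrable_heatKer ht).mul_const _), integral_mul_const,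
      integral_heatKer ht, one_mul]
    rfl
  have hI : Integrable fun z : Eucl n => L * (2 * t) * (‖z‖ / (2 * t) * heatKer t z) := by
    convert! (integrable_norm_mul_heatKer (n := n) ht).const_mul L using 2
    field_simp
  rw [h2]
  calc _ ≤ ∫ z : Eucl n, L * (2 * t) * (‖z‖ / (2 * t) * heatKer t z) := by
        rw [← Real.norm_eq_abs]
        refine norm_integral_le_of_norm_le hI (Eventually.of_forall fun z => ?_)
        have hp := heatKer_pos ht z
        rw [norm_mul, Real.norm_of_nonneg hp.le]
        have := h.lip (x + z) x
        rw [add_sub_cancel_left] at this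
        calc _ ≤ heatKer t z * (L * ‖z‖) := by gcongr; exact this
          _ = _ := by field_simp
    _ ≤ L * (2 * t) * ((n + 1) * t ^ (-(1 / 2) : ℝ)) := by
        rw [integral_const_mul]
        gcongr
        exact integral_norm_div_mul_heatKer_le ht
    _ = _ := by ring

/-- The heat equation integrated over `(0, t)`, as a difference of integrals over half-lines. -/
theorem heat_sub_eq_integral (hn : 1 ≤ n) {φ : Eucl n → ℝ} {M L : ℝ} (h : BddLip φ M L)
    (hL : 0 ≤ L) (hi : Integrable φ) {t : ℝ} (ht : 0 < t) (x : Eucl n) :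
    heat t φ x - φ x = (∫ r in Ioi (0 : ℝ), heatLap r φ x) -
      ∫ r in Ioi (0 : ℝ), heatLap (r + t) φ x := by
  have hI := integrableOn_heatLap hn h hi x
  have hlim : Tendsto (fun t => heat t φ x) (𝓝[>] 0) (𝓝 (φ x)) := by
    have hz : Tendsto (fun t : ℝ => L * (2 * ((n + 1) * t ^ (1 / 2 : ℝ)))) (𝓝[>] 0) (𝓝 0) := by
      have : ContinuousAt (fun t : ℝ => L * (2 * ((n + 1) * t ^ (1 / 2 : ℝ)))) 0 := by
        have := Real.continuousAt_rpow_const 0 (1 / 2 : ℝ) (Or.inr (by norm_num))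
        fun_prop
      have h3 := this.tendsto.mono_left (nhdsWithin_le_nhds (s := Ioi 0))
      simpa using h3
    rw [tendsto_iff_norm_sub_tendsto_zero]
    refine squeeze_zero' (Eventually.of_forall fun _ => norm_nonneg _) ?_ hz
    filter_upwards [self_mem_nhdsWithin] with t ht
    have ht0 : 0 < t := ht
    refine (abs_heat_sub_le h hL ht0 x).trans (le_of_eq ?_)
    have : t * t ^ (-(1 / 2) : ℝ) = t ^ (1 / 2 : ℝ) := by
      rw [← Real.rpow_one_add' ht0.le (by norm_num)]
      norm_num
    rw [← this]
    ring
  have hft : ∫ r in (0)..t, heatLap r φ x = heat t φ x - φ x := by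
    refine intervalIntegral.integral_eq_sub_of_hasDerivAt_of_tendsto ht
      (fun r hr => hasDerivAt_heat h.cont hi hr.1 x)
      ((intervalIntegrable_iff_integrableOn_Ioc_of_le ht.le).2 (hI.mono_set Ioc_subset_Ioi_self))
      hlim ?_
    exact (hasDerivAt_heat h.cont hi ht x).continuousAt.tendsto.mono_left nhdsWithin_le_nhds
  have hsh : ∫ r in Ioi (0 : ℝ), heatLap (r + t) φ x = ∫ r in Ioi t, heatLap r φ x := by
    exact integral_Ioi_comp_add_right (fun r => heatLap r φ x) t
  rw [← hft, hsh, intervalIntegral.integral_of_le ht.le, eq_sub_iff_add_eq,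
    ← setIntegral_union (Ioc_disjoint_Ioi le_rfl) measurableSet_Ioi
      (hI.mono_set Ioc_subset_Ioi_self) (hI.mono_set (Ioi_subset_Ioi ht.le)),
    Ioc_union_Ioi_eq_Ioi ht.le]

end HeatTime

/-! ### The estimate of `e^{tΔ}φ - φ` in `L¹` -/

section HeatEstimate

variable {n : ℕ}

theorem measurable_fracGrad (s : ℝ) {φ : Eucl n → ℝ} (hφ : ContDiff ℝ 1 φ) :
    Measurable (fracGrad s φ) := by
  unfold fracGrad
  by_cases h : s = 1
  · simp only [if_pos h]
    exact (continuous_gradient hφ).measurable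
  · simp only [if_neg h]
    have hm : Measurable fun q : Eucl n × Eucl n =>
        ((φ (q.1 + q.2) - φ q.1) / ‖q.2‖ ^ ((n : ℝ) + s + 1)) • q.2 := by
      have := hφ.continuous.measurable
      fun_prop
    exact (hm.stronglyMeasurable.integral_prod_right' (ν := volume)).measurable.const_smul
      (fracConst n s)

theorem measurable_heatDiv {V : Eucl n → Eucl n} (hV : Measurable V) :
    Measurable fun p : ℝ × Eucl n => heatDiv p.1 V p.2 := by
  have hm : Measurable fun q : (ℝ × Eucl n) × Eucl n =>
      heatKer q.1.1 q.2 / (2 * q.1.1) * inner ℝ q.2 (V (q.1.2 + q.2)) := by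
    have h2 : Measurable fun q : (ℝ × Eucl n) × Eucl n => heatKer q.1.1 q.2 :=
      measurable_heatKer.comp (by fun_prop : Measurable fun q : (ℝ × Eucl n) × Eucl n =>
        (q.1.1, q.2))
    fun_prop
  exact (hm.stronglyMeasurable.integral_prod_right' (ν := volume)).measurable

/-- The operator `V ↦ div(e^{τΔ} V)` is bounded on `L¹` with norm of order `τ^(-1/2)`. -/
theorem lintegral_heatDiv_le {τ : ℝ} (hτ : 0 < τ) {V : Eucl n → Eucl n} (hV : Measurable V) :
    ∫⁻ x, ‖heatDiv τ V x‖ₑ ≤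
      ENNReal.ofReal ((n + 1) * τ ^ (-(1 / 2) : ℝ)) * ∫⁻ x, ‖V x‖ₑ := by
  have hk := (continuous_heatKer (n := n) τ).measurable
  have hI : Integrable fun z : Eucl n => ‖z‖ / (2 * τ) * heatKer τ z := by
    convert! (integrable_norm_mul_heatKer (n := n) hτ).const_mul (1 / (2 * τ)) using 2
    ring
  have h0 : ∀ z : Eucl n, 0 ≤ ‖z‖ / (2 * τ) * heatKer τ z := fun z => by
    have := heatKer_pos hτ z
    positivity
  calc _ ≤ ∫⁻ x, ∫⁻ z : Eucl n, ENNReal.ofReal (‖z‖ / (2 * τ) * heatKer τ z) * ‖V (x + z)‖ₑ := by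
        refine lintegral_mono fun x => (enorm_integral_le_lintegral_enorm _).trans
          (lintegral_mono fun z => ?_)
        have := heatKer_pos hτ z
        rw [← ofReal_norm, ← ofReal_norm, ← ENNReal.ofReal_mul (h0 z)]
        refine ENNReal.ofReal_le_ofReal ?_
        rw [norm_mul, Real.norm_of_nonneg (by positivity : 0 ≤ heatKer τ z / (2 * τ))]
        calc _ ≤ heatKer τ z / (2 * τ) * (‖z‖ * ‖V (x + z)‖) := by
              gcongr
              exact norm_inner_le_norm _ _
          _ = _ := by ring
    _ = ∫⁻ z : Eucl n, ∫⁻ x, ENNReal.ofReal (‖z‖ / (2 * τ) * heatKer τ z) * ‖V (x + z)‖ₑ := by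
        refine lintegral_lintegral_swap (Measurable.aemeasurable ?_)
        simp only [Function.uncurry_def]
        fun_prop
    _ = ∫⁻ z : Eucl n, ENNReal.ofReal (‖z‖ / (2 * τ) * heatKer τ z) * ∫⁻ x, ‖V x‖ₑ := by
        refine lintegral_congr fun z => ?_
        rw [lintegral_const_mul _ (by fun_prop), lintegral_add_right_eq_self (fun x => ‖V x‖ₑ)]
    _ ≤ _ := by
        rw [lintegral_mul_const _ (by fun_prop), ← ofReal_integral_eq_lintegral_ofReal hI
          (Eventually.of_forall h0)]
        gcongr
        exact integral_norm_div_mul_heatKer_le hτ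

theorem rpow_neg_sub_rpow_neg_le {α t τ : ℝ} (hα0 : 0 ≤ α) (hα1 : α ≤ 1) (ht : 0 < t)
    (hτ : 0 < τ) : |(τ + t) ^ (-α) - τ ^ (-α)| ≤ τ ^ (-α) * min 1 (t / τ) := by
  have h1 : (τ + t) ^ (-α) ≤ τ ^ (-α) :=
    Real.rpow_le_rpow_of_nonpos hτ (by linarith) (by linarith)
  have h2 : 0 ≤ (τ + t) ^ (-α) := by positivity
  rw [abs_sub_comm, abs_of_nonneg (by linarith), mul_min_of_nonneg _ _ (by positivity)]
  refine le_min (by linarith) ?_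
  -- `(1 + t/τ)^(-α) ≥ (1 + t/τ)⁻¹ ≥ 1 - t/τ`
  have h3 : (1 + t / τ) ^ (-1 : ℝ) ≤ (1 + t / τ) ^ (-α) :=
    Real.rpow_le_rpow_of_exponent_le (by linarith [div_pos ht hτ]) (by linarith)
  have h4 : 1 - t / τ ≤ (1 + t / τ) ^ (-1 : ℝ) := by
    have := div_pos ht hτ
    rw [Real.rpow_neg_one, ← one_div, le_div_iff₀ (by linarith)]
    nlinarith
  have h5 : (τ + t) ^ (-α) = τ ^ (-α) * (1 + t / τ) ^ (-α) := by
    rw [← Real.mul_rpow hτ.le (by positivity)]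
    congr 1
    field_simp
  have h6 : 0 < τ ^ (-α) := by positivity
  rw [h5]
  nlinarith

/-- The two integrals are compared by shifting the first one by `t` on `(t, ∞)`; what remains
carries the weight `τ^(-α) min(1, t/τ)`, which gains decay at infinity. -/
theorem enorm_integral_sub_shift_le {α t : ℝ} (hα0 : 0 ≤ α) (hα1 : α ≤ 1) (ht : 0 < t)
    {g : ℝ → ℝ} (h0 : IntegrableOn (fun τ => τ ^ (-α) * g τ) (Ioi 0))
    (h1 : IntegrableOn (fun τ => τ ^ (-α) * g (τ + t)) (Ioi 0)) :
    ‖(∫ τ in Ioi (0 : ℝ), τ ^ (-α) * g τ) - ∫ τ in Ioi (0 : ℝ), τ ^ (-α) * g (τ + t)‖ₑ ≤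
      ∫⁻ τ in Ioi (0 : ℝ), ENNReal.ofReal (τ ^ (-α) * min 1 (t / τ)) *
        (‖g τ‖ₑ + ‖g (τ + t)‖ₑ) := by
  have hA : IntegrableOn ((Ioc 0 t).indicator fun τ => τ ^ (-α) * g τ) (Ioi 0) :=
    h0.indicator measurableSet_Ioc
  have hB := integrableOn_Ioi_comp_add_right (h0.mono_set (Ioi_subset_Ioi ht.le))
  have hsplit : ∫ τ in Ioi (0 : ℝ), τ ^ (-α) * g τ =
      (∫ τ in Ioi (0 : ℝ), (Ioc 0 t).indicator (fun τ => τ ^ (-α) * g τ) τ) +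
        ∫ τ in Ioi (0 : ℝ), (τ + t) ^ (-α) * g (τ + t) := by
    rw [integral_Ioi_comp_add_right (fun τ => τ ^ (-α) * g τ) t,
      setIntegral_indicator measurableSet_Ioc, inter_eq_self_of_subset_right Ioc_subset_Ioi_self,
      ← setIntegral_union (Ioc_disjoint_Ioi le_rfl) measurableSet_Ioi
        (h0.mono_set Ioc_subset_Ioi_self) (h0.mono_set (Ioi_subset_Ioi ht.le)),
      Ioc_union_Ioi_eq_Ioi ht.le]
  have hBC : IntegrableOn (fun τ => (τ + t) ^ (-α) * g (τ + t) - τ ^ (-α) * g (τ + t)) (Ioi 0) :=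
    hB.sub h1
  rw [hsplit, add_sub_assoc, ← integral_sub hB h1, ← integral_add hA hBC]
  refine (enorm_integral_le_lintegral_enorm _).trans
    (setLIntegral_mono' measurableSet_Ioi fun τ hτ => ?_)
  have hτ0 : 0 < τ := hτ
  rw [mul_add]
  refine (enorm_add_le _ _).trans (add_le_add ?_ ?_)
  · by_cases h : τ ∈ Ioc 0 t
    · rw [indicator_of_mem h, enorm_mul, min_eq_left ((one_le_div hτ0).2 h.2), mul_one,
        Real.enorm_of_nonneg (by positivity)]
    · rw [indicator_of_notMem h]
      simp
  · rw [← sub_mul, enorm_mul]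
    gcongr
    rw [← ofReal_norm]
    exact ENNReal.ofReal_le_ofReal (rpow_neg_sub_rpow_neg_le hα0 hα1 ht hτ0)

theorem lintegral_rpow_mul_min_le {s t : ℝ} (hs0 : 0 < s) (hs1 : s ≤ 1) (ht : 0 < t) :
    ∫⁻ τ in Ioi (0 : ℝ), ENNReal.ofReal (τ ^ (s / 2 - 1) * min 1 (t / τ)) ≤
      ENNReal.ofReal ((2 / s + 2) * t ^ (s / 2)) := by
  have hb : ∀ {S : Set ℝ} {h : ℝ → ℝ} {B : ℝ}, MeasurableSet S → IntegrableOn h S →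
      (∀ τ ∈ S, τ ^ (s / 2 - 1) * min 1 (t / τ) ≤ h τ) → (∀ τ ∈ S, 0 ≤ h τ) →
      ∫ τ in S, h τ ≤ B →
      ∫⁻ τ in S, ENNReal.ofReal (τ ^ (s / 2 - 1) * min 1 (t / τ)) ≤ ENNReal.ofReal B := by
    intro S h B hS hi hle hnn hB
    refine (setLIntegral_mono' hS fun τ hτ => ENNReal.ofReal_le_ofReal (hle τ hτ)).trans ?_
    rw [← ofReal_integral_eq_lintegral_ofReal hi ((ae_restrict_iff' hS).2
      (Eventually.of_forall hnn))]
    exact ENNReal.ofReal_le_ofReal hB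
  rw [← Ioc_union_Ioi_eq_Ioi ht.le, lintegral_union measurableSet_Ioi (Ioc_disjoint_Ioi le_rfl),
    add_mul, ENNReal.ofReal_add (by positivity) (by positivity)]
  refine add_le_add (hb (h := fun τ => τ ^ (s / 2 - 1)) measurableSet_Ioc
    ((intervalIntegrable_iff_integrableOn_Ioc_of_le ht.le).1
      (intervalIntegral.intervalIntegrable_rpow' (by linarith))) ?_ ?_ ?_)
    (hb (h := fun τ => t * τ ^ (s / 2 - 2)) measurableSet_Ioi
    ((integrableOn_Ioi_rpow_of_lt (by linarith) ht).const_mul t) ?_ ?_ ?_)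
  · intro τ hτ
    have : 0 < τ := hτ.1
    exact mul_le_of_le_one_right (by positivity) (min_le_left _ _)
  · intro τ hτ
    have : 0 < τ := hτ.1
    positivity
  · rw [← intervalIntegral.integral_of_le ht.le, integral_rpow (Or.inl (by linarith))]
    rw [sub_add_cancel, Real.zero_rpow (by positivity)]
    apply le_of_eq
    field_simp
    ring
  · intro τ hτ
    have hτ0 : 0 < τ := ht.trans hτ
    calc _ ≤ τ ^ (s / 2 - 1) * (t / τ) := by
          gcongr
          exact min_le_right _ _
      _ = _ := by
          rw [show s / 2 - 2 = (s / 2 - 1) - 1 by ring, Real.rpow_sub_one hτ0.ne' (s / 2 - 1)]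
          ring
  · intro τ hτ
    have hτ0 : 0 < τ := ht.trans hτ
    positivity
  · rw [integral_const_mul, integral_Ioi_rpow_of_lt (by linarith) ht,
      show s / 2 - 2 + 1 = s / 2 - 1 by ring, Real.rpow_sub_one ht.ne']
    have h1 : (0 : ℝ) < 1 - s / 2 := by linarith
    have : t * (-(t ^ (s / 2) / t) / (s / 2 - 1)) = t ^ (s / 2) / (1 - s / 2) := by
      rw [show s / 2 - 1 = -(1 - s / 2) by ring, neg_div_neg_eq]
      field_simp
    rw [this, div_le_iff₀ h1]
    have : 0 < t ^ (s / 2) := by positivity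
    nlinarith

/-- The heat semigroup recovers `φ` from `Dˢφ`: integrating `div(e^{(τ+t)Δ} Dˢφ)` against
`τ^((s-1)/2)` gives a multiple of `∫_t^∞ Δe^{rΔ}φ dr`, and the multiple stays away from `0`
as `s` varies. -/
theorem exists_heatDiv_fracGrad_integral (hn : 1 ≤ n) :
    ∃ κ : ℝ, 0 < κ ∧ ∀ s ∈ Ioc (0 : ℝ) 1, ∃ K : ℝ, κ ≤ K ∧
      ∀ φ : Eucl n → ℝ, ContDiff ℝ 1 φ → HasCompactSupport φ → ∀ x, ∀ t : ℝ, 0 ≤ t →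
        IntegrableOn (fun τ : ℝ => τ ^ (-((1 - s) / 2)) * heatDiv (τ + t) (fracGrad s φ) x)
          (Ioi 0) ∧
        ∫ τ in Ioi (0 : ℝ), τ ^ (-((1 - s) / 2)) * heatDiv (τ + t) (fracGrad s φ) x =
          K * ∫ r in Ioi (0 : ℝ), heatLap (r + t) φ x := by
  have hc : ContinuousOn Real.Gamma (Icc 1 2) := fun x hx =>
    (Real.differentiableAt_Gamma fun m => by
      have : (0 : ℝ) ≤ m := Nat.cast_nonneg m
      have := hx.1
      linarith).continuousAt.continuousWithinAt
  obtain ⟨y, hy, hmax⟩ := isCompact_Icc.exists_isMaxOn (nonempty_Icc.2 (by norm_num)) hc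
  have hy0 : 0 < Real.Gamma y := Real.Gamma_pos_of_pos (by linarith [hy.1])
  refine ⟨min 1 (1 / (2 * Real.Gamma y)), by positivity, fun s hs => ?_⟩
  have hint : ∀ (φ : Eucl n → ℝ), ContDiff ℝ 1 φ → HasCompactSupport φ → ∀ x, ∀ t : ℝ, 0 ≤ t →
      IntegrableOn (fun r => heatLap (r + t) φ x) (Ioi 0) := by
    intro φ hφ hφc x t ht
    obtain ⟨M, L, h, hL⟩ := exists_bddLip hφ hφc
    exact integrableOn_Ioi_comp_add_right ((integrableOn_heatLap hn h
      (hφ.continuous.integrable_of_hasCompactSupport hφc) x).mono_set (Ioi_subset_Ioi ht))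
  rcases hs.2.lt_or_eq with hs1 | rfl
  · set α := (1 - s) / 2 with hα
    have hα0 : 0 < α := by rw [hα]; linarith
    have hα1 : α < 1 := by rw [hα]; linarith [hs.1]
    have hΓ := Real.Gamma_pos_of_pos hα0
    refine ⟨betaConst α / Real.Gamma α, (min_le_right _ _).trans ?_, ?_⟩
    · rw [div_le_div_iff₀ (by positivity) hΓ, one_mul]
      have h1 : Real.Gamma (α + 1) ≤ Real.Gamma y := hmax ⟨by linarith, by linarith⟩
      rw [Real.Gamma_add_one hα0.ne'] at h1
      have h2 := le_betaConst hα0 hα1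
      calc Real.Gamma α = 1 / (2 * α) * (2 * (α * Real.Gamma α)) := by field_simp
        _ ≤ betaConst α * (2 * Real.Gamma y) :=
          mul_le_mul h2 (by gcongr) (by positivity) (h2.trans' (by positivity))
    · intro φ hφ hφc x t ht
      obtain ⟨M, L, h, hL⟩ := exists_bddLip hφ hφc
      have hW := integral_rpow_neg_mul_weyl hα0 hα1
        ((measurable_heatLap h.cont.measurable x).comp (measurable_id.add_const t))
        (hint φ hφ hφc x t ht)
      have he : ∀ τ ∈ Ioi (0 : ℝ), (Real.Gamma α)⁻¹ * (τ ^ (-α) * ∫ a in Ioi (0 : ℝ),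
          a ^ (α - 1) * heatLap (a + τ + t) φ x) =
          τ ^ (-α) * heatDiv (τ + t) (fracGrad s φ) x := by
        intro τ hτ
        have hτ0 : 0 < τ := hτ
        rw [heatDiv_fracGrad_of_lt hs.1 hs1 (by linarith : 0 < τ + t) h hL x, ← hα]
        simp only [add_assoc]
        ring
      constructor
      · exact IntegrableOn.congr_fun (hW.1.const_mul (Real.Gamma α)⁻¹) he measurableSet_Ioi
      · rw [← setIntegral_congr_fun measurableSet_Ioi he, integral_const_mul]
        have := hW.2
        simp only [Function.comp_def, id] at this
        rw [this]
        ring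
  · refine ⟨1, min_le_left _ _, fun φ hφ hφc x t ht => ?_⟩
    have he : ∀ τ ∈ Ioi (0 : ℝ), heatLap (τ + t) φ x =
        τ ^ (-(((1 : ℝ) - 1) / 2)) * heatDiv (τ + t) (fracGrad 1 φ) x := by
      intro τ hτ
      have hτ0 : 0 < τ := hτ
      rw [heatDiv_fracGrad_one (by linarith : 0 < τ + t) hφ hφc]
      simp
    constructor
    · exact (hint φ hφ hφc x t ht).congr_fun he measurableSet_Ioi
    · rw [← setIntegral_congr_fun measurableSet_Ioi he, one_mul]

set_option maxHeartbeats 1000000 in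
/-- `‖e^{tΔ}φ - φ‖₁ ≤ C t^(s/2) ‖Dˢφ‖₁`, with a constant that is uniform for `s` away from `0`. -/
theorem exists_lintegral_heat_sub_le (hn : 1 ≤ n) {s₀ : ℝ} (hs₀ : 0 < s₀) :
    ∃ C : ℝ, 0 ≤ C ∧ ∀ s ∈ Icc s₀ 1, ∀ φ : Eucl n → ℝ, ContDiff ℝ 1 φ → HasCompactSupport φ →
      ∀ t : ℝ, 0 < t →
        ∫⁻ x, ‖heat t φ x - φ x‖ₑ ≤
          ENNReal.ofReal (C * t ^ (s / 2)) * ∫⁻ x, ‖fracGrad s φ x‖ₑ := by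
  obtain ⟨κ, hκ, hK⟩ := exists_heatDiv_fracGrad_integral hn
  refine ⟨κ⁻¹ * (2 * (n + 1) * (2 / s₀ + 2)), by positivity, fun s hs φ hφ hφc t ht => ?_⟩
  have hs0 : 0 < s := hs₀.trans_le hs.1
  obtain ⟨K, hκK, hKφ⟩ := hK s ⟨hs0, hs.2⟩
  obtain ⟨M, L, h, hL⟩ := exists_bddLip hφ hφc
  have hi : Integrable φ := hφ.continuous.integrable_of_hasCompactSupport hφc
  set α := (1 - s) / 2 with hα
  have hα0 : 0 ≤ α := by rw [hα]; linarith [hs.2]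
  have hα1 : α ≤ 1 := by rw [hα]; linarith
  have hV := measurable_fracGrad s hφ
  have hG := measurable_heatDiv hV
  set N := ∫⁻ x, ‖fracGrad s φ x‖ₑ with hN
  have hpt : ∀ x, ‖heat t φ x - φ x‖ₑ ≤ ENNReal.ofReal κ⁻¹ *
      ∫⁻ τ in Ioi (0 : ℝ), ENNReal.ofReal (τ ^ (-α) * min 1 (t / τ)) *
        (‖heatDiv τ (fracGrad s φ) x‖ₑ + ‖heatDiv (τ + t) (fracGrad s φ) x‖ₑ) := by
    intro x
    have h0 := hKφ φ hφ hφc x 0 le_rfl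
    have h1 := hKφ φ hφ hφc x t ht.le
    simp only [add_zero] at h0
    have h2 := enorm_integral_sub_shift_le hα0 hα1 ht (g := fun τ => heatDiv τ (fracGrad s φ) x)
      h0.1 h1.1
    rw [h0.2, h1.2, ← mul_sub, ← heat_sub_eq_integral hn h hL hi ht x, enorm_mul] at h2
    calc _ = ENNReal.ofReal κ⁻¹ * (ENNReal.ofReal κ * ‖heat t φ x - φ x‖ₑ) := by
          rw [← mul_assoc, ← ENNReal.ofReal_mul (by positivity), inv_mul_cancel₀ hκ.ne']
          simp
      _ ≤ _ := by
          gcongr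
          refine le_trans ?_ h2
          gcongr
          rw [Real.enorm_of_nonneg (hκ.le.trans hκK)]
          exact ENNReal.ofReal_le_ofReal hκK
  have hbound : ∀ τ ∈ Ioi (0 : ℝ), ∫⁻ x, (‖heatDiv τ (fracGrad s φ) x‖ₑ +
      ‖heatDiv (τ + t) (fracGrad s φ) x‖ₑ) ≤
      ENNReal.ofReal (2 * (n + 1) * τ ^ (-(1 / 2) : ℝ)) * N := by
    intro τ hτ
    have hτ0 : 0 < τ := hτ
    have hGτ : Measurable fun x => heatDiv τ (fracGrad s φ) x := hG.comp measurable_prodMk_left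
    rw [lintegral_add_left hGτ.enorm]
    refine (add_le_add (lintegral_heatDiv_le hτ0 hV)
      (lintegral_heatDiv_le (by linarith : 0 < τ + t) hV)).trans ?_
    rw [← add_mul, ← ENNReal.ofReal_add (by positivity) (by positivity)]
    gcongr
    have : (τ + t) ^ (-(1 / 2) : ℝ) ≤ τ ^ (-(1 / 2) : ℝ) :=
      Real.rpow_le_rpow_of_nonpos hτ0 (by linarith) (by norm_num)
    nlinarith [this, (Nat.cast_nonneg n : (0 : ℝ) ≤ n)]
  have hw : Measurable fun τ : ℝ => ENNReal.ofReal (τ ^ (-α) * min 1 (t / τ)) := by fun_prop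
  have hG2 : Measurable fun p : ℝ × Eucl n => heatDiv (p.1 + t) (fracGrad s φ) p.2 :=
    hG.comp ((measurable_fst.add_const t).prodMk measurable_snd)
  have hswap : Measurable fun p : Eucl n × ℝ => ENNReal.ofReal (p.2 ^ (-α) * min 1 (t / p.2)) *
      (‖heatDiv p.2 (fracGrad s φ) p.1‖ₑ + ‖heatDiv (p.2 + t) (fracGrad s φ) p.1‖ₑ) :=
    (hw.comp measurable_snd).mul ((hG.comp measurable_swap).enorm.add
      (hG2.comp measurable_swap).enorm)
  calc ∫⁻ x, ‖heat t φ x - φ x‖ₑ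
      ≤ ∫⁻ x, ENNReal.ofReal κ⁻¹ *
        ∫⁻ τ in Ioi (0 : ℝ), ENNReal.ofReal (τ ^ (-α) * min 1 (t / τ)) *
        (‖heatDiv τ (fracGrad s φ) x‖ₑ + ‖heatDiv (τ + t) (fracGrad s φ) x‖ₑ) :=
        lintegral_mono hpt
    _ = ENNReal.ofReal κ⁻¹ * ∫⁻ τ in Ioi (0 : ℝ), ENNReal.ofReal (τ ^ (-α) * min 1 (t / τ)) *
        ∫⁻ x, (‖heatDiv τ (fracGrad s φ) x‖ₑ + ‖heatDiv (τ + t) (fracGrad s φ) x‖ₑ) := by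
        rw [lintegral_const_mul' _ _ ENNReal.ofReal_ne_top,
          lintegral_lintegral_swap hswap.aemeasurable]
        simp only [lintegral_const_mul' _ _ ENNReal.ofReal_ne_top]
    _ ≤ ENNReal.ofReal κ⁻¹ * ∫⁻ τ in Ioi (0 : ℝ),
        ENNReal.ofReal (τ ^ (s / 2 - 1) * min 1 (t / τ)) *
          (ENNReal.ofReal (2 * (n + 1)) * N) := by
        refine mul_le_mul' le_rfl (setLIntegral_mono' measurableSet_Ioi fun τ hτ => ?_)
        have hτ0 : 0 < τ := hτ
        refine (mul_le_mul' le_rfl (hbound τ hτ)).trans (le_of_eq ?_)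
        rw [← mul_assoc, ← mul_assoc, ← ENNReal.ofReal_mul (by positivity),
          ← ENNReal.ofReal_mul (by positivity), show s / 2 - 1 = -α + -(1 / 2) by rw [hα]; ring,
          Real.rpow_add hτ0]
        congr 2
        ring
    _ ≤ ENNReal.ofReal κ⁻¹ * (ENNReal.ofReal ((2 / s₀ + 2) * t ^ (s / 2)) *
          (ENNReal.ofReal (2 * (n + 1)) * N)) := by
        rw [lintegral_mul_const _ (by fun_prop)]
        gcongr
        refine (lintegral_rpow_mul_min_le hs0 hs.2 ht).trans (ENNReal.ofReal_le_ofReal ?_)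
        gcongr
        exact hs.1
    _ = _ := by
        rw [← mul_assoc, ← mul_assoc, ← ENNReal.ofReal_mul (by positivity),
          ← ENNReal.ofReal_mul (by positivity)]
        congr 2
        ring

end HeatEstimate

/-! ### Poincaré inequalities in `L¹` -/

section Poincare

variable {n : ℕ}

theorem abs_heat_le {t : ℝ} (ht : 0 < t) {φ : Eucl n → ℝ} (hi : Integrable φ) (x : Eucl n) :
    |heat t φ x| ≤ (4 * Real.pi * t) ^ (-(n : ℝ) / 2) * ∫ y, |φ y| := by
  unfold heat
  rw [← integral_add_left_eq_self (fun y => |φ y|) x, ← integral_const_mul, ← Real.norm_eq_abs]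
  refine norm_integral_le_of_norm_le ((hi.comp_add_left x).abs.const_mul _)
    (Eventually.of_forall fun z => ?_)
  rw [norm_mul, Real.norm_of_nonneg (heatKer_pos ht z).le]
  exact mul_le_mul_of_nonneg_right (heatKer_le ht z) (norm_nonneg _)

theorem le_two_mul_of_le_add_half {a b : ENNReal} (ha : a ≠ ⊤)
    (h : a ≤ b + a / ENNReal.ofReal 2) : a ≤ ENNReal.ofReal 2 * b := by
  have he : ENNReal.ofReal 2 = 2 := by simp
  rw [he] at h ⊢
  have h2 : a / 2 + a / 2 ≤ b + a / 2 := by rwa [ENNReal.add_halves]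
  have h3 : a / 2 ≤ b :=
    (ENNReal.add_le_add_iff_right (ENNReal.div_lt_top ha (by norm_num)).ne).1 h2
  rw [mul_comm]
  exact (ENNReal.div_le_iff (by norm_num) (by norm_num)).1 h3

/-- The fractional Poincaré inequality in `L¹`, from the decay of `e^{tΔ}φ` as `t → ∞`. -/
theorem exists_lintegral_le_lintegral_fracGrad (hn : 1 ≤ n) {s₀ R₀ : ℝ} (hs₀ : 0 < s₀) :
    ∃ C : ℝ, 0 ≤ C ∧ ∀ s ∈ Icc s₀ 1, ∀ φ : Eucl n → ℝ, ContDiff ℝ 1 φ → HasCompactSupport φ →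
      (∀ y, R₀ ≤ ‖y‖ → φ y = 0) → ∫⁻ x, ‖φ x‖ₑ ≤ ENNReal.ofReal C * ∫⁻ x, ‖fracGrad s φ x‖ₑ := by
  obtain ⟨C, hC, h⟩ := exists_lintegral_heat_sub_le hn hs₀
  set B := Metric.ball (0 : Eucl n) R₀ with hB
  -- `t` is chosen so large that `e^{tΔ}φ` has at most half of the mass of `φ` on the ball
  have hBfin : volume B ≠ ⊤ := measure_ball_lt_top.ne
  have hlim : Tendsto (fun t : ℝ => volume.real B * (4 * Real.pi * t) ^ (-((n : ℝ) / 2)))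
      atTop (𝓝 (volume.real B * 0)) := by
    refine ((tendsto_rpow_neg_atTop (by positivity)).comp
      (tendsto_id.const_mul_atTop (by positivity : 0 < 4 * Real.pi))).const_mul _
  rw [mul_zero] at hlim
  obtain ⟨t, ht, ht1⟩ := ((hlim.eventually (gt_mem_nhds (by norm_num : (0 : ℝ) < 1 / 2))).and
    (eventually_ge_atTop 1)).exists
  refine ⟨2 * (C * t), by positivity, fun s hs φ hφ hφc hsupp => ?_⟩
  have hi : Integrable φ := hφ.continuous.integrable_of_hasCompactSupport hφc
  have ht0 : 0 < t := by linarith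
  have hN : ∫⁻ x, ‖φ x‖ₑ = ENNReal.ofReal (∫ y, |φ y|) := by
    rw [ofReal_integral_eq_lintegral_ofReal hi.abs (Eventually.of_forall fun _ => abs_nonneg _)]
    exact lintegral_congr fun x => (ofReal_norm _).symm
  set c := (4 * Real.pi * t) ^ (-((n : ℝ) / 2)) * ∫ y, |φ y| with hc
  have hc0 : 0 ≤ c := mul_nonneg (by positivity) (integral_nonneg fun _ => abs_nonneg _)
  have hpt : ∀ x, ‖φ x‖ₑ ≤ ‖heat t φ x - φ x‖ₑ + ENNReal.ofReal c := fun x => by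
    have h2 := abs_heat_le ht0 hi x
    rw [neg_div] at h2
    calc ‖φ x‖ₑ = ‖heat t φ x - (heat t φ x - φ x)‖ₑ := by rw [sub_sub_cancel]
      _ ≤ ‖heat t φ x‖ₑ + ‖heat t φ x - φ x‖ₑ := enorm_sub_le
      _ ≤ _ := by
        rw [add_comm]
        gcongr
        rw [← ofReal_norm]
        exact ENNReal.ofReal_le_ofReal h2
  have h1 : ∫⁻ x, ‖φ x‖ₑ ≤ (∫⁻ x, ‖heat t φ x - φ x‖ₑ) + (∫⁻ x, ‖φ x‖ₑ) / ENNReal.ofReal 2 := by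
    calc ∫⁻ x, ‖φ x‖ₑ = ∫⁻ x in B, ‖φ x‖ₑ := by
          refine (setLIntegral_eq_of_support_subset fun x hx => ?_).symm
          by_contra hxB
          have : R₀ ≤ ‖x‖ := by simpa [hB] using hxB
          simp [hsupp x this] at hx
      _ ≤ ∫⁻ x in B, (‖heat t φ x - φ x‖ₑ + ENNReal.ofReal c) := lintegral_mono hpt
      _ ≤ (∫⁻ x, ‖heat t φ x - φ x‖ₑ) + ENNReal.ofReal c * volume B := by
          rw [lintegral_add_right _ measurable_const, setLIntegral_const]
          gcongr
          exact Measure.restrict_le_self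
      _ ≤ _ := by
          gcongr
          rw [hN, ← ENNReal.ofReal_div_of_pos two_pos, ← ENNReal.ofReal_toReal hBfin,
            ← ENNReal.ofReal_mul hc0]
          refine ENNReal.ofReal_le_ofReal ?_
          have h0 : 0 ≤ ∫ y, |φ y| := integral_nonneg fun _ => abs_nonneg _
          calc c * (volume B).toReal
              = (volume.real B * (4 * Real.pi * t) ^ (-((n : ℝ) / 2))) * ∫ y, |φ y| := by
                rw [hc, Measure.real]
                ring
            _ ≤ 1 / 2 * ∫ y, |φ y| := by gcongr
            _ = _ := by ring
  refine (le_two_mul_of_le_add_half (by rw [hN]; exact ENNReal.ofReal_ne_top) h1).trans ?_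
  refine (mul_le_mul' le_rfl (h s hs φ hφ hφc t ht0)).trans ?_
  rw [← mul_assoc,
    ← ENNReal.ofReal_mul (by norm_num)]
  gcongr
  calc t ^ (s / 2) ≤ t ^ (1 : ℝ) :=
        Real.rpow_le_rpow_of_exponent_le ht1 (by linarith [hs.2])
    _ = t := Real.rpow_one t

/-- The tail of `|x|^(-n-s₀)` tends to `0`; half of the excess `s₀` over integrability is given up
for an explicit rate. -/
theorem exists_lintegral_compl_ball_le (n : ℕ) {s₀ : ℝ} (hs₀ : 0 < s₀) :
    ∃ T : ℝ, 0 ≤ T ∧ ∀ R : ℝ, 1 ≤ R →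
      ∫⁻ x in (Metric.ball (0 : Eucl n) R)ᶜ, ENNReal.ofReal (‖x‖ ^ (-((n : ℝ) + s₀))) ≤
        ENNReal.ofReal (T * R ^ (-(s₀ / 2))) := by
  set r := (n : ℝ) + s₀ / 2 with hr
  have hI : Integrable (fun x : Eucl n => (1 + ‖x‖) ^ (-r)) :=
    integrable_one_add_norm (by simp [hr, hs₀])
  have h0 : ∀ x : Eucl n, 0 ≤ (1 + ‖x‖) ^ (-r) := fun x => by positivity
  refine ⟨2 ^ r * ∫ x : Eucl n, (1 + ‖x‖) ^ (-r),
    mul_nonneg (by positivity) (integral_nonneg h0), fun R hR => ?_⟩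
  have hR0 : 0 < R := by linarith
  calc _ ≤ ∫⁻ x in (Metric.ball (0 : Eucl n) R)ᶜ,
        ENNReal.ofReal (2 ^ r * R ^ (-(s₀ / 2)) * (1 + ‖x‖) ^ (-r)) := by
        refine setLIntegral_mono' Metric.isOpen_ball.measurableSet.compl fun x hx =>
          ENNReal.ofReal_le_ofReal ?_
        have hx1 : R ≤ ‖x‖ := by simpa using hx
        have hx0 : 0 < ‖x‖ := hR0.trans_le hx1
        rw [show -((n : ℝ) + s₀) = -r + -(s₀ / 2) by rw [hr]; ring, Real.rpow_add hx0]
        have h1 : ‖x‖ ^ (-(s₀ / 2)) ≤ R ^ (-(s₀ / 2)) :=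
          Real.rpow_le_rpow_of_nonpos hR0 hx1 (by linarith)
        have h2 : (2 * ‖x‖) ^ (-r) ≤ (1 + ‖x‖) ^ (-r) :=
          Real.rpow_le_rpow_of_nonpos (by positivity) (by linarith)
            (by rw [hr]; simp only [Left.neg_nonpos_iff]; positivity)
        rw [Real.mul_rpow two_pos.le hx0.le] at h2
        have h3 : ‖x‖ ^ (-r) ≤ 2 ^ r * (1 + ‖x‖) ^ (-r) := by
          calc _ = 2 ^ r * (2 ^ (-r) * ‖x‖ ^ (-r)) := by
                rw [← mul_assoc, ← Real.rpow_add two_pos]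
                simp
            _ ≤ _ := by gcongr
        calc _ ≤ (2 ^ r * (1 + ‖x‖) ^ (-r)) * R ^ (-(s₀ / 2)) := by gcongr
          _ = _ := by ring
    _ ≤ ∫⁻ x, ENNReal.ofReal (2 ^ r * R ^ (-(s₀ / 2)) * (1 + ‖x‖) ^ (-r)) :=
        setLIntegral_le_lintegral _ _
    _ = _ := by
        rw [← ofReal_integral_eq_lintegral_ofReal (hI.const_mul _)
          (Eventually.of_forall fun x => mul_nonneg (by positivity) (h0 x)), integral_const_mul]
        congr 1
        ring

/-- The fractional gradient of a test function supported in a fixed ball decays fast enough for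
its `L¹` norm to be controlled by the part in a larger ball. -/
theorem exists_poincare_ball (hn : 1 ≤ n) {s₀ R₀ : ℝ} (hs₀ : 0 < s₀) (hR₀ : 0 < R₀) :
    ∃ R C : ℝ, 0 ≤ C ∧ ∀ s ∈ Icc s₀ 1, ∀ φ : Eucl n → ℝ, ContDiff ℝ 1 φ → HasCompactSupport φ →
      (∀ y, R₀ ≤ ‖y‖ → φ y = 0) →
      ∫⁻ x, ‖φ x‖ₑ ≤ ENNReal.ofReal C * ∫⁻ x in Metric.ball 0 R, ‖fracGrad s φ x‖ₑ ∧
      ∀ t ∈ Ioc (0 : ℝ) 1, ∫⁻ x, ‖heat t φ x - φ x‖ₑ ≤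
        ENNReal.ofReal (C * t ^ (s₀ / 2)) * ∫⁻ x in Metric.ball 0 R, ‖fracGrad s φ x‖ₑ := by
  obtain ⟨C₁, hC₁, h₁⟩ := exists_lintegral_heat_sub_le hn hs₀
  obtain ⟨C₂, hC₂, h₂⟩ := exists_lintegral_le_lintegral_fracGrad (R₀ := R₀) hn hs₀
  obtain ⟨C₃, hC₃, h₃⟩ := exists_norm_fracGrad_le_of_large n hs₀
  obtain ⟨T, hT, hTR⟩ := exists_lintegral_compl_ball_le n hs₀
  -- `R` is chosen so large that the tail of `Dˢφ` is absorbed by half of `‖φ‖₁`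
  have hlim : Tendsto (fun R : ℝ => C₂ * C₃ * T * R ^ (-(s₀ / 2))) atTop
      (𝓝 (C₂ * C₃ * T * 0)) := (tendsto_rpow_neg_atTop (by positivity)).const_mul _
  rw [mul_zero] at hlim
  obtain ⟨R, ⟨hR, hR1⟩, hR2⟩ := (((hlim.eventually
    (gt_mem_nhds (by norm_num : (0 : ℝ) < 1 / 2))).and (eventually_ge_atTop 1)).and
    (eventually_ge_atTop (2 * R₀))).exists
  have hR0 : 0 < R := by linarith
  set K := C₃ * T * R ^ (-(s₀ / 2)) with hK
  have hK0 : 0 ≤ K := by positivity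
  refine ⟨R, 2 * C₂ + C₁ * (1 + K * (2 * C₂)), by positivity, fun s hs φ hφ hφc hsupp => ?_⟩
  have hi : Integrable φ := hφ.continuous.integrable_of_hasCompactSupport hφc
  have hN : ∫⁻ x, ‖φ x‖ₑ = ENNReal.ofReal (∫ y, |φ y|) := by
    rw [ofReal_integral_eq_lintegral_ofReal hi.abs (Eventually.of_forall fun _ => abs_nonneg _)]
    exact lintegral_congr fun x => (ofReal_norm _).symm
  have h0 : 0 ≤ ∫ y, |φ y| := integral_nonneg fun _ => abs_nonneg _
  set N := ∫⁻ x, ‖φ x‖ₑ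
  set A := ∫⁻ x in Metric.ball 0 R, ‖fracGrad s φ x‖ₑ with hA
  have htail : ∫⁻ x, ‖fracGrad s φ x‖ₑ ≤ A + ENNReal.ofReal K * N := by
    rw [← lintegral_add_compl _ (Metric.isOpen_ball (x := (0 : Eucl n)) (ε := R)).measurableSet]
    gcongr
    calc _ ≤ ∫⁻ x in (Metric.ball (0 : Eucl n) R)ᶜ, ENNReal.ofReal (C₃ * ∫ y, |φ y|) *
          ENNReal.ofReal (‖x‖ ^ (-((n : ℝ) + s₀))) := by
          refine setLIntegral_mono' Metric.isOpen_ball.measurableSet.compl fun x hx => ?_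
          have hx1 : R ≤ ‖x‖ := by simpa using hx
          rw [← ofReal_norm, ← ENNReal.ofReal_mul (by positivity)]
          exact ENNReal.ofReal_le_ofReal
            (h₃ s hs φ R₀ hR₀ hi hsupp x (hR2.trans hx1) (hR1.trans hx1))
      _ ≤ ENNReal.ofReal (C₃ * ∫ y, |φ y|) * ENNReal.ofReal (T * R ^ (-(s₀ / 2))) := by
          rw [lintegral_const_mul' _ _ ENNReal.ofReal_ne_top]
          gcongr
          exact hTR R hR1
      _ = _ := by
          rw [hN, ← ENNReal.ofReal_mul (by positivity), ← ENNReal.ofReal_mul hK0, hK]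
          congr 1
          ring
  have hP : N ≤ ENNReal.ofReal (2 * C₂) * A := by
    have h4 : N ≤ ENNReal.ofReal C₂ * A + N / ENNReal.ofReal 2 := by
      calc N ≤ ENNReal.ofReal C₂ * (A + ENNReal.ofReal K * N) :=
            (h₂ s hs φ hφ hφc hsupp).trans (by gcongr)
        _ ≤ _ := by
            rw [mul_add]
            gcongr
            rw [hN, ← ENNReal.ofReal_mul hK0, ← ENNReal.ofReal_mul hC₂,
              ← ENNReal.ofReal_div_of_pos two_pos]
            refine ENNReal.ofReal_le_ofReal ?_
            calc _ = (C₂ * C₃ * T * R ^ (-(s₀ / 2))) * ∫ y, |φ y| := by rw [hK]; ring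
              _ ≤ 1 / 2 * ∫ y, |φ y| := by gcongr
              _ = _ := by ring
    refine (le_two_mul_of_le_add_half (by rw [hN]; exact ENNReal.ofReal_ne_top) h4).trans ?_
    rw [← mul_assoc,
      ← ENNReal.ofReal_mul (by norm_num)]
  constructor
  · refine hP.trans ?_
    gcongr
    have : 0 ≤ C₁ * (1 + K * (2 * C₂)) := by positivity
    linarith
  · intro t ht
    calc _ ≤ ENNReal.ofReal (C₁ * t ^ (s / 2)) * (A + ENNReal.ofReal K *
          (ENNReal.ofReal (2 * C₂) * A)) :=
          (h₁ s hs φ hφ hφc t ht.1).trans (by gcongr; exact htail.trans (by gcongr))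
      _ = ENNReal.ofReal (C₁ * (1 + K * (2 * C₂)) * t ^ (s / 2)) * A := by
          have ht0 := ht.1
          rw [← mul_assoc, ← ENNReal.ofReal_mul hK0, ← one_add_mul, ← mul_assoc,
            ← ENNReal.ofReal_one, ← ENNReal.ofReal_add one_pos.le (by positivity),
            ← ENNReal.ofReal_mul (by positivity)]
          congr 2
          ring
      _ ≤ _ := by
          have ht0 := ht.1
          gcongr ENNReal.ofReal ?_ * A
          gcongr ?_ * ?_
          · linarith
          · exact Real.rpow_le_rpow_of_exponent_ge ht.1 ht.2 (by linarith [hs.1])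

end Poincare

/-! ### Completeness of the space of fields of finite energy -/

section FieldSpace

variable {n : ℕ} (D : Coefficients n)

/-- The energy `∫∫ a_S^{ij} Vᵢ Vⱼ dμ(s) dx` of a vector field `V(s,x)`. -/
noncomputable def energy (V : ℝ × Eucl n → Eucl n) : ENNReal :=
  ∫⁻ p, ENNReal.ofReal (D.bilS p (V p) (V p)) ∂D.prodMeas

variable {D}

theorem norm_sq_eq_integral (G : D.L2Field) :
    ‖G‖ ^ 2 = ∫ p, D.bilS p (G.1 p) (G.1 p) ∂D.prodMeas := by
  rw [← real_inner_self_eq_norm_sq]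
  rfl

theorem energy_coe (G : D.L2Field) : energy D G.1 = ENNReal.ofReal (‖G‖ ^ 2) := by
  rw [norm_sq_eq_integral, energy, ofReal_integral_eq_lintegral_ofReal G.2]
  filter_upwards [D.ae_mem] with p hp
  exact D.bilS_nonneg hp _

theorem energy_congr {V W : ℝ × Eucl n → Eucl n} (h : V =ᵐ[D.prodMeas] W) :
    energy D V = energy D W :=
  lintegral_congr_ae (h.mono fun p hp => by simp only [hp])

theorem aemeasurable_bilS {V W : ℝ × Eucl n → Eucl n} (hV : AEMeasurable V D.prodMeas)
    (hW : AEMeasurable W D.prodMeas) :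
    AEMeasurable (fun p => D.bilS p (V p) (W p)) D.prodMeas := by
  have hc : ∀ {F : ℝ × Eucl n → Eucl n} (_ : AEMeasurable F D.prodMeas) (i : Fin n),
      AEMeasurable (fun p => F p i) D.prodMeas := fun hF i =>
    (EuclideanSpace.proj (𝕜 := ℝ) i).continuous.measurable.comp_aemeasurable hF
  unfold Coefficients.bilS
  refine Finset.aemeasurable_fun_sum _ fun i _ => Finset.aemeasurable_fun_sum _ fun j _ => ?_
  exact ((((D.aemeasurable_A i j).add (D.aemeasurable_A j i)).div_const 2).mul (hc hV i)).mul
    (hc hW j)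

theorem continuous_bilS_self (p : ℝ × Eucl n) : Continuous fun ξ => D.bilS p ξ ξ := by
  unfold Coefficients.bilS
  fun_prop

variable (D)

/-- The lower ellipticity bound: `λ` is positive almost everywhere and `λ⁻¹` is integrable on
balls. -/
theorem exists_lower_bound : ∃ lam : Eucl n → ℝ, (∀ x, 0 ≤ lam x) ∧ AEMeasurable lam ∧
    (∀ᵐ x, 0 < lam x) ∧ (∀ R, ∫⁻ x in Metric.ball 0 R, (ENNReal.ofReal (lam x))⁻¹ < ⊤) ∧
    ∀ p : ℝ × Eucl n, p.1 ∈ Ioc (0 : ℝ) 1 → ∀ ξ, lam p.2 * ‖ξ‖ ^ 2 ≤ D.bilS p ξ ξ := by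
  obtain ⟨lam, Lam, h0, -, hell, R, C, δ, p, hR, hC, hδ, hp, -, -, hm, hint⟩ := D.elliptic
  have hle : ∀ y : ENNReal, y ≤ 1 + y ^ (1 + δ) := by
    intro y
    rcases le_total y 1 with h | h
    · exact h.trans le_self_add
    · calc y = y ^ (1 : ℝ) := (ENNReal.rpow_one y).symm
        _ ≤ y ^ (1 + δ) := ENNReal.rpow_le_rpow_of_exponent_le h (by linarith)
        _ ≤ _ := le_add_self
  have hball : ∀ R, ∫⁻ x in Metric.ball 0 R, (ENNReal.ofReal (lam x))⁻¹ < ⊤ := by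
    intro R
    calc _ ≤ ∫⁻ x in Metric.ball (0 : Eucl n) R, (1 + (ENNReal.ofReal (lam x))⁻¹ ^ (1 + δ)) :=
          lintegral_mono fun x => hle _
      _ = volume (Metric.ball (0 : Eucl n) R) +
          ∫⁻ x in Metric.ball (0 : Eucl n) R, (ENNReal.ofReal (lam x))⁻¹ ^ (1 + δ) := by
          rw [lintegral_add_left measurable_const, setLIntegral_one]
      _ < ⊤ := by
          refine ENNReal.add_lt_top.2 ⟨measure_ball_lt_top, ?_⟩
          exact (lintegral_mono_set Metric.ball_subset_closedBall).trans_lt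
            (hint _ (isCompact_closedBall 0 R))
  refine ⟨lam, h0, hm, ?_, hball, fun q hq ξ => ?_⟩
  · have : ∀ k : ℕ, ∀ᵐ x ∂volume.restrict (Metric.ball (0 : Eucl n) k), 0 < lam x := by
      intro k
      have hm' : AEMeasurable (fun x => (ENNReal.ofReal (lam x))⁻¹)
        (volume.restrict (Metric.ball (0 : Eucl n) k)) := hm.restrict.ennreal_ofReal.inv
      filter_upwards [ae_lt_top' hm' (hball k).ne] with x hx
      by_contra hne
      rw [ENNReal.ofReal_of_nonpos (not_lt.1 hne)] at hx
      simp at hx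
    rw [← Measure.restrict_univ (μ := (volume : Measure (Eucl n))),
      ← Metric.iUnion_ball_nat (0 : Eucl n)]
    exact (ae_restrict_iUnion_iff _ _).2 this
  · rw [D.bilS_self]
    exact (hell q.1 hq q.2 ξ).1

/-- Fields of finite energy are integrable on bounded sets, by the Cauchy--Schwarz inequality. -/
theorem exists_setLIntegral_le_energy (R : ℝ) : ∃ C : ℝ, 0 ≤ C ∧ ∀ V : ℝ × Eucl n → Eucl n,
    AEMeasurable V D.prodMeas →
      ∫⁻ p in univ ×ˢ Metric.ball 0 R, ‖V p‖ₑ ∂D.prodMeas ≤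
        ENNReal.ofReal C * energy D V ^ (1 / 2 : ℝ) := by
  obtain ⟨lam, h0, hm, hpos, hball, hlow⟩ := exists_lower_bound D
  set I := D.μ univ * ∫⁻ x in Metric.ball 0 R, (ENNReal.ofReal (lam x))⁻¹ with hI
  have hIfin : I ^ (1 / 2 : ℝ) ≠ ⊤ :=
    (ENNReal.rpow_lt_top_of_nonneg (by norm_num)
      (ENNReal.mul_lt_top (measure_lt_top _ _) (hball R)).ne).ne
  refine ⟨(I ^ (1 / 2 : ℝ)).toReal, ENNReal.toReal_nonneg, fun V hV => ?_⟩
  rw [ENNReal.ofReal_toReal hIfin]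
  set S : Set (ℝ × Eucl n) := univ ×ˢ Metric.ball 0 R with hS
  have hl2 : AEMeasurable (fun p : ℝ × Eucl n => ENNReal.ofReal (lam p.2)) D.prodMeas :=
    (hm.comp_quasiMeasurePreserving Measure.quasiMeasurePreserving_snd).ennreal_ofReal
  have hpos2 : ∀ᵐ p ∂D.prodMeas, 0 < lam p.2 :=
    Measure.quasiMeasurePreserving_snd.ae hpos
  let F : ℝ × Eucl n → ENNReal := fun p => (ENNReal.ofReal (lam p.2))⁻¹ ^ (1 / 2 : ℝ)
  let G : ℝ × Eucl n → ENNReal := fun p => ENNReal.ofReal (lam p.2) ^ (1 / 2 : ℝ) * ‖V p‖ₑ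
  have hFm : AEMeasurable F D.prodMeas := hl2.inv.pow_const _
  have hGm : AEMeasurable G D.prodMeas := (hl2.pow_const _).mul hV.enorm
  have hFG : ∀ᵐ p ∂D.prodMeas, ‖V p‖ₑ = F p * G p := by
    filter_upwards [hpos2] with p hp
    have h1 : ENNReal.ofReal (lam p.2) ≠ 0 := by simpa using hp
    simp only [F, G]
    rw [← mul_assoc, ← ENNReal.mul_rpow_of_nonneg _ _ (by norm_num),
      ENNReal.inv_mul_cancel h1 ENNReal.ofReal_ne_top, ENNReal.one_rpow, one_mul]
  have hF2 : ∫⁻ p in S, F p ^ (2 : ℝ) ∂D.prodMeas = I := by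
    have : ∀ p, F p ^ (2 : ℝ) = (ENNReal.ofReal (lam p.2))⁻¹ := fun p => by
      simp only [F]
      rw [← ENNReal.rpow_mul]
      norm_num
    simp only [this]
    rw [hS, ← Measure.prod_restrict, Measure.restrict_univ]
    rw [lintegral_prod _ (by
      have := hl2.inv.restrict (s := S)
      rwa [hS, ← Measure.prod_restrict, Measure.restrict_univ] at this)]
    simp only [lintegral_const]
    rw [hI, mul_comm]
  have hG2 : ∫⁻ p in S, G p ^ (2 : ℝ) ∂D.prodMeas ≤ energy D V := by
    refine (setLIntegral_le_lintegral _ _).trans (lintegral_mono_ae ?_)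
    filter_upwards [D.ae_mem] with p hp
    simp only [G]
    rw [ENNReal.mul_rpow_of_nonneg _ _ (by norm_num), ← ENNReal.rpow_mul]
    norm_num
    rw [← ofReal_norm, ← ENNReal.ofReal_pow (norm_nonneg _), ← ENNReal.ofReal_mul (h0 _)]
    exact ENNReal.ofReal_le_ofReal (hlow p hp _)
  calc ∫⁻ p in S, ‖V p‖ₑ ∂D.prodMeas = ∫⁻ p in S, (F * G) p ∂D.prodMeas :=
        lintegral_congr_ae (ae_restrict_of_ae hFG)
    _ ≤ (∫⁻ p in S, F p ^ (2 : ℝ) ∂D.prodMeas) ^ (1 / 2 : ℝ) *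
        (∫⁻ p in S, G p ^ (2 : ℝ) ∂D.prodMeas) ^ (1 / 2 : ℝ) :=
        ENNReal.lintegral_mul_le_Lp_mul_Lq _ Real.HolderConjugate.two_two hFm.restrict hGm.restrict
    _ ≤ _ := by rw [hF2]; gcongr

theorem exists_setLIntegral_le_norm (R : ℝ) : ∃ C : ℝ, 0 ≤ C ∧ ∀ G : D.L2Field,
    ∫⁻ p in univ ×ˢ Metric.ball 0 R, ‖G.1 p‖ₑ ∂D.prodMeas ≤ ENNReal.ofReal (C * ‖G‖) := by
  obtain ⟨C, hC, h⟩ := exists_setLIntegral_le_energy D R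
  refine ⟨C, hC, fun G => (h G.1 G.1.aemeasurable).trans (le_of_eq ?_)⟩
  rw [energy_coe, ENNReal.ofReal_rpow_of_nonneg (by positivity) (by norm_num),
    ENNReal.ofReal_mul hC, ← Real.sqrt_eq_rpow, Real.sqrt_sq (norm_nonneg _)]

/-- Multiplied by `√λ`, a rapidly convergent Cauchy sequence converges almost everywhere. Since
`λ > 0` almost everywhere, so does the sequence itself, and by Fatou's lemma the limit is attained
in the energy norm. -/
instance : CompleteSpace D.L2Field := by
  obtain ⟨lam, h0, hm, hpos, -, hlow⟩ := exists_lower_bound D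
  have hpos2 : ∀ᵐ p ∂D.prodMeas, 0 < lam p.2 :=
    Measure.quasiMeasurePreserving_snd.ae hpos
  have hm2 : AEMeasurable (fun p : ℝ × Eucl n => lam p.2) D.prodMeas :=
    hm.comp_quasiMeasurePreserving Measure.quasiMeasurePreserving_snd
  refine Metric.complete_of_convergent_controlled_sequences (fun k : ℕ => (1 / 2 : ℝ) ^ k)
    (fun k => by positivity) fun u hu => ?_
  have hsub : ∀ k m, ((u k - u m : D.L2Field).1 : ℝ × Eucl n → Eucl n) =ᵐ[D.prodMeas]
      fun p => (u k).1 p - (u m).1 p := fun k m => AEEqFun.coeFn_sub _ _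
  have hen : ∀ N k m, N ≤ k → N ≤ m →
      energy D (fun p => (u k).1 p - (u m).1 p) ≤ ENNReal.ofReal (((1 / 2 : ℝ) ^ N) ^ 2) := by
    intro N k m hk hmN
    rw [← energy_congr (hsub k m), energy_coe]
    refine ENNReal.ofReal_le_ofReal ?_
    have := hu N k m hk hmN
    rw [dist_eq_norm] at this
    gcongr
  have hlim : ∀ᵐ p ∂D.prodMeas, ∃ l, Tendsto (fun k => √(lam p.2) • (u k).1 p) atTop (𝓝 l) := by
    refine Lp.ae_tendsto_of_cauchy_eLpNorm (p := 2) (B := fun k => 2 * ENNReal.ofReal ((1 / 2) ^ k))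
      (fun k => (hm2.sqrt.smul (u k).1.aemeasurable).aestronglyMeasurable) (by norm_num) ?_ ?_
    · rw [ENNReal.tsum_mul_left]
      refine ENNReal.mul_ne_top (by norm_num) ?_
      have he : ∀ k : ℕ, ENNReal.ofReal ((1 / 2) ^ k) = 2⁻¹ ^ k := fun k => by
        rw [ENNReal.ofReal_pow (by norm_num), one_div, ENNReal.ofReal_inv_of_pos two_pos]
        simp
      simp only [he]
      rw [ENNReal.tsum_geometric]
      simp
    · intro N k m hk hmN
      have h1 : eLpNorm ((fun p => √(lam p.2) • (u k).1 p) - fun p => √(lam p.2) • (u m).1 p) 2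
          D.prodMeas ≤ ENNReal.ofReal ((1 / 2) ^ N) := by
        rw [eLpNorm_eq_lintegral_rpow_enorm_toReal (by norm_num) (by norm_num)]
        have h2 : ENNReal.ofReal ((1 / 2) ^ N) =
            ENNReal.ofReal (((1 / 2 : ℝ) ^ N) ^ 2) ^ (1 / (2 : ENNReal).toReal) := by
          rw [ENNReal.ofReal_rpow_of_nonneg (by positivity) (by norm_num)]
          rw [ENNReal.toReal_ofNat, ← Real.sqrt_eq_rpow, Real.sqrt_sq (by positivity)]
        rw [h2]
        gcongr
        refine le_trans (lintegral_mono_ae ?_) (hen N k m hk hmN)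
        filter_upwards [D.ae_mem] with p hp
        simp only [Pi.sub_apply, ENNReal.toReal_ofNat, ENNReal.rpow_ofNat]
        rw [← smul_sub, ← ofReal_norm, ← ENNReal.ofReal_pow (norm_nonneg _)]
        refine ENNReal.ofReal_le_ofReal ?_
        rw [norm_smul, mul_pow, Real.norm_of_nonneg (Real.sqrt_nonneg _), Real.sq_sqrt (h0 _)]
        exact hlow p hp _
      refine h1.trans_lt ?_
      have h3 : ENNReal.ofReal ((1 / 2) ^ N) ≠ 0 := by simp
      calc ENNReal.ofReal ((1 / 2) ^ N) < ENNReal.ofReal ((1 / 2) ^ N) +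
            ENNReal.ofReal ((1 / 2) ^ N) := ENNReal.lt_add_right ENNReal.ofReal_ne_top h3
        _ = _ := (two_mul _).symm
  have hlim2 : ∀ᵐ p ∂D.prodMeas, ∃ l, Tendsto (fun k => (u k).1 p) atTop (𝓝 l) := by
    filter_upwards [hlim, hpos2] with p ⟨l, hl⟩ hp
    refine ⟨(√(lam p.2))⁻¹ • l, ?_⟩
    have hs : √(lam p.2) ≠ 0 := (Real.sqrt_pos.2 hp).ne'
    refine (hl.const_smul (√(lam p.2))⁻¹).congr fun k => ?_
    rw [smul_smul, inv_mul_cancel₀ hs, one_smul]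
  obtain ⟨G, hGm, hG⟩ := exists_stronglyMeasurable_limit_of_tendsto_ae
    (fun k => (u k).1.aestronglyMeasurable) hlim2
  have hfat : ∀ k, energy D (fun p => (u k).1 p - G p) ≤
      ENNReal.ofReal (((1 / 2 : ℝ) ^ k) ^ 2) := by
    intro k
    have hconv : ∀ᵐ p ∂D.prodMeas, Tendsto (fun m => ENNReal.ofReal
        (D.bilS p ((u k).1 p - (u m).1 p) ((u k).1 p - (u m).1 p))) atTop
        (𝓝 (ENNReal.ofReal (D.bilS p ((u k).1 p - G p) ((u k).1 p - G p)))) := by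
      filter_upwards [hG] with p hp
      exact (ENNReal.continuous_ofReal.comp (continuous_bilS_self p)).tendsto _ |>.comp
        (tendsto_const_nhds.sub hp)
    calc energy D (fun p => (u k).1 p - G p)
        = ∫⁻ p, liminf (fun m => ENNReal.ofReal
          (D.bilS p ((u k).1 p - (u m).1 p) ((u k).1 p - (u m).1 p))) atTop ∂D.prodMeas :=
          lintegral_congr_ae (hconv.mono fun p hp => hp.liminf_eq.symm)
      _ ≤ liminf (fun m => energy D (fun p => (u k).1 p - (u m).1 p)) atTop :=
          lintegral_liminf_le' fun m => by
            have hd := (u k).1.aemeasurable.sub (u m).1.aemeasurable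
            exact (aemeasurable_bilS hd hd).ennreal_ofReal
      _ ≤ _ := by
          refine liminf_le_of_frequently_le' (Eventually.frequently ?_)
          filter_upwards [eventually_ge_atTop k] with m hmk
          exact hen k k m le_rfl hmk
  have hmem : AEEqFun.mk G hGm.aestronglyMeasurable ∈ D.L2Field := by
    have hd : AEStronglyMeasurable (fun p => (u 0).1 p - G p) D.prodMeas :=
      (u 0).1.aestronglyMeasurable.sub hGm.aestronglyMeasurable
    have hd2 : AEEqFun.mk _ hd ∈ D.L2Field := by
      have hmk := AEEqFun.coeFn_mk _ hd
      refine ⟨D.aestronglyMeasurable_bilS _ _, ?_⟩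
      rw [hasFiniteIntegral_iff_ofReal]
      · exact (energy_congr hmk).trans_lt ((hfat 0).trans_lt ENNReal.ofReal_lt_top)
      · filter_upwards [D.ae_mem] with p hp
        exact D.bilS_nonneg hp _
    have he : AEEqFun.mk G hGm.aestronglyMeasurable = (u 0).1 - AEEqFun.mk _ hd := by
      apply AEEqFun.ext
      filter_upwards [AEEqFun.coeFn_mk G hGm.aestronglyMeasurable, AEEqFun.coeFn_mk _ hd,
        AEEqFun.coeFn_sub (u 0).1 (AEEqFun.mk _ hd)] with p h1 h2 h3
      rw [h1, h3, Pi.sub_apply, h2, sub_sub_cancel]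
    rw [he]
    exact D.L2Field.sub_mem (u 0).2 hd2
  refine ⟨⟨_, hmem⟩, ?_⟩
  rw [tendsto_iff_norm_sub_tendsto_zero]
  refine squeeze_zero (fun _ => norm_nonneg _) (fun k => ?_)
    (tendsto_pow_atTop_nhds_zero_of_lt_one (by norm_num : (0 : ℝ) ≤ 1 / 2) (by norm_num))
  have h1 := hfat k
  rw [← energy_congr (V := ((u k - ⟨_, hmem⟩ : D.L2Field).1 : ℝ × Eucl n → Eucl n)),
    energy_coe, ENNReal.ofReal_le_ofReal_iff (by positivity)] at h1
  · exact (sq_le_sq₀ (norm_nonneg _) (by positivity)).1 h1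
  · filter_upwards [AEEqFun.coeFn_sub (u k).1 (AEEqFun.mk G hGm.aestronglyMeasurable),
      AEEqFun.coeFn_mk G hGm.aestronglyMeasurable] with p hp hp2
    rw [Submodule.coe_sub, hp, Pi.sub_apply, hp2]

end FieldSpace

/-! ### Test functions in `H⁰(𝒜, Ω)` -/

section TestFields

variable {n : ℕ} (D : Coefficients n)

/-- Test functions have finite energy: `|Dˢφ|²` decays like `|x|^(-2(n+s₀))`, which beats the growth
`|x|^p`, `p < n`, of `Λ`. -/
theorem energy_fracGrad_lt_top {φ : Eucl n → ℝ} (hφ : ContDiff ℝ 1 φ)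
    (hφc : HasCompactSupport φ) : energy D (fun p => fracGrad p.1 φ p.2) < ⊤ := by
  obtain ⟨lam, Lam, -, hLam0, hell, R, C, δ, p, hR, hC, hδ, hp, hLamI, hLamb, -, -⟩ := D.elliptic
  obtain ⟨s₀, hs₀, hμ⟩ := D.support_μ
  obtain ⟨M, L, hb, hL⟩ := exists_bddLip hφ hφc
  obtain ⟨C₁, hC₁, h₁⟩ := exists_norm_fracGrad_le n hs₀
  obtain ⟨C₂, hC₂, h₂⟩ := exists_norm_fracGrad_le_of_large n hs₀
  have hM := hb.M_nonneg
  have hi : Integrable φ := hφ.continuous.integrable_of_hasCompactSupport hφc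
  obtain ⟨R₁, hR₁, hsupp⟩ : ∃ R₁ : ℝ, 0 < R₁ ∧ ∀ y, R₁ ≤ ‖y‖ → φ y = 0 := by
    obtain ⟨R₁, h⟩ := hφc.isCompact.isBounded.subset_ball 0
    refine ⟨max R₁ 1, by positivity, fun y hy => image_eq_zero_of_notMem_tsupport fun hmem => ?_⟩
    have := h hmem
    simp only [Metric.mem_ball, dist_zero_right] at this
    linarith [le_max_left R₁ 1]
  set B := C₁ * (M + L) with hB
  set N := C₂ * ∫ y, |φ y| with hN
  have hN0 : 0 ≤ N := mul_nonneg hC₂ (integral_nonneg fun _ => abs_nonneg _)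
  have hB0 : 0 ≤ B := by positivity
  set r := (n : ℝ) + s₀ with hr
  have hr0 : 0 < r := by positivity
  set R₂ := max (2 * R₁) 1 with hR₂
  -- a bound for `Dˢφ` that is uniform in `s` and integrable against `|x|^n`
  set K := B * (1 + R₂) ^ r + N * 2 ^ r with hK
  have hK0 : 0 ≤ K := by positivity
  have hV : ∀ s ∈ Icc s₀ 1, ∀ x, ‖fracGrad s φ x‖ ≤ K * (1 + ‖x‖) ^ (-r) := by
    intro s hs x
    have hx0 : 0 < 1 + ‖x‖ := by positivity
    rw [Real.rpow_neg hx0.le, ← div_eq_mul_inv, le_div_iff₀ (by positivity)]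
    by_cases hx : R₂ ≤ ‖x‖
    · have hx1 : 1 ≤ ‖x‖ := (le_max_right _ _).trans hx
      have h3 := h₂ s hs φ R₁ hR₁ hi hsupp x ((le_max_left _ _).trans hx) hx1
      calc _ ≤ (N * ‖x‖ ^ (-r)) * (2 * ‖x‖) ^ r := by
            gcongr
            linarith
        _ = N * 2 ^ r := by
            rw [Real.mul_rpow two_pos.le (by positivity), Real.rpow_neg (by positivity)]
            have : ‖x‖ ^ r ≠ 0 := by positivity
            field_simp
        _ ≤ K := le_add_of_nonneg_left (by positivity)
    · calc _ ≤ B * (1 + R₂) ^ r := by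
            gcongr
            · exact h₁ s hs φ M L hb hL x
            · exact (not_le.1 hx).le
        _ ≤ K := le_add_of_nonneg_right (by positivity)
  set g : Eucl n → ℝ := fun x => (Metric.ball (0 : Eucl n) R).indicator (fun x => Lam x * K ^ 2) x +
    C * (1 + R ^ p) * K ^ 2 * (1 + ‖x‖) ^ (-((n : ℝ) + 2 * s₀)) with hg
  have hgI : Integrable g := by
    refine Integrable.add ?_ ((integrable_one_add_norm (by simp [hs₀])).const_mul _)
    rw [integrable_indicator_iff Metric.isOpen_ball.measurableSet]
    exact hLamI.mul_const _
  have hgle : ∀ q : ℝ × Eucl n, q.1 ∈ Icc s₀ 1 →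
      D.bilS q (fracGrad q.1 φ q.2) (fracGrad q.1 φ q.2) ≤ g q.2 := by
    intro q hq
    have h1 := (hell q.1 ⟨hs₀.trans_le hq.1, hq.2⟩ q.2 (fracGrad q.1 φ q.2)).2
    rw [← D.bilS_self] at h1
    have h2 := hV q.1 hq q.2
    have hx0 : 0 < 1 + ‖q.2‖ := by positivity
    refine h1.trans ?_
    have hpos : 0 ≤ C * (1 + R ^ p) * K ^ 2 * (1 + ‖q.2‖) ^ (-((n : ℝ) + 2 * s₀)) := by positivity
    by_cases hx : q.2 ∈ Metric.ball (0 : Eucl n) R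
    · simp only [hg, indicator_of_mem hx]
      have : ‖fracGrad q.1 φ q.2‖ ≤ K := h2.trans (mul_le_of_le_one_right hK0
        (Real.rpow_le_one_of_one_le_of_nonpos (by linarith [norm_nonneg q.2]) (by linarith)))
      have h4 : Lam q.2 * ‖fracGrad q.1 φ q.2‖ ^ 2 ≤ Lam q.2 * K ^ 2 := by
        have := hLam0 q.2
        gcongr
      linarith
    · simp only [hg, indicator_of_notMem hx, zero_add]
      have hRx : R ≤ ‖q.2‖ := by simpa using hx
      have hx1 : 0 < ‖q.2‖ := hR.trans_le hRx
      have h5 : ‖q.2‖ ^ p ≤ (1 + R ^ p) * (1 + ‖q.2‖) ^ (n : ℝ) := by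
        have h6 : 1 ≤ (1 + ‖q.2‖) ^ (n : ℝ) :=
          Real.one_le_rpow (by linarith) (by positivity)
        have hRp : 0 < R ^ p := by positivity
        rcases le_total 0 p with hp0 | hp0
        · calc ‖q.2‖ ^ p ≤ (1 + ‖q.2‖) ^ p := by gcongr; linarith
            _ ≤ (1 + ‖q.2‖) ^ (n : ℝ) :=
              Real.rpow_le_rpow_of_exponent_le (by linarith) hp.le
            _ ≤ _ := le_mul_of_one_le_left (by positivity) (by linarith)
        · calc ‖q.2‖ ^ p ≤ R ^ p := Real.rpow_le_rpow_of_nonpos hR hRx hp0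
            _ ≤ (1 + R ^ p) * 1 := by linarith
            _ ≤ _ := by gcongr
      calc Lam q.2 * ‖fracGrad q.1 φ q.2‖ ^ 2
          ≤ (C * ((1 + R ^ p) * (1 + ‖q.2‖) ^ (n : ℝ))) * (K * (1 + ‖q.2‖) ^ (-r)) ^ 2 := by
            gcongr
            exact (hLamb _ hx).trans (by gcongr)
        _ = C * (1 + R ^ p) * K ^ 2 * ((1 + ‖q.2‖) ^ (n : ℝ) * ((1 + ‖q.2‖) ^ (-r)) ^ 2) := by ring
        _ = _ := by
            rw [← Real.rpow_mul_natCast hx0.le, ← Real.rpow_add hx0]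
            congr 2
            rw [hr]
            push_cast
            ring
  have hmem : ∀ᵐ q ∂D.prodMeas, q.1 ∈ Icc s₀ 1 :=
    Measure.quasiMeasurePreserving_fst.ae (ae_iff.2 hμ)
  have hgP : Integrable (fun q : ℝ × Eucl n => g q.2) D.prodMeas := hgI.comp_snd D.μ
  refine lt_of_le_of_lt (lintegral_mono_ae ?_) hgP.lintegral_lt_top
  filter_upwards [hmem] with q hq
  exact ENNReal.ofReal_le_ofReal (hgle q hq)

variable (Ω : TopologicalSpace.Opens (Eucl n))

theorem TestFunction.contDiff_one {Ω : TopologicalSpace.Opens (Eucl n)} (φ : 𝓓(Ω, ℝ)) :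
    ContDiff ℝ 1 φ := φ.contDiff.of_le (by exact_mod_cast le_top)

theorem aestronglyMeasurable_fracGrad_prodMeas {φ : Eucl n → ℝ} (hφ : ContDiff ℝ 1 φ) :
    AEStronglyMeasurable (fun p => fracGrad p.1 φ p.2) D.prodMeas :=
  aestronglyMeasurable_fracGrad _ D.ae_mem hφ

theorem mk_fracGrad_mem {φ : Eucl n → ℝ} (hφ : ContDiff ℝ 1 φ) (hφc : HasCompactSupport φ) :
    AEEqFun.mk _ (aestronglyMeasurable_fracGrad_prodMeas D hφ) ∈ D.L2Field := by
  refine ⟨D.aestronglyMeasurable_bilS _ _, ?_⟩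
  rw [hasFiniteIntegral_iff_ofReal]
  · exact (energy_congr (AEEqFun.coeFn_mk _ _)).trans_lt (energy_fracGrad_lt_top D hφ hφc)
  · filter_upwards [D.ae_mem] with p hp
    exact D.bilS_nonneg hp _

/-- The embedding of test functions into the fields of finite energy, `φ ↦ ((s,x) ↦ Dˢφ(x))`. -/
noncomputable def testField : 𝓓(Ω, ℝ) →ₗ[ℝ] D.L2Field where
  toFun φ := ⟨_, mk_fracGrad_mem D (TestFunction.contDiff_one φ) φ.hasCompactSupport⟩
  map_add' φ ψ := by
    apply Subtype.ext
    apply AEEqFun.ext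
    filter_upwards [AEEqFun.coeFn_mk _ (aestronglyMeasurable_fracGrad_prodMeas D
        (TestFunction.contDiff_one φ)), AEEqFun.coeFn_mk _ (aestronglyMeasurable_fracGrad_prodMeas D
        (TestFunction.contDiff_one ψ)), AEEqFun.coeFn_mk _ (aestronglyMeasurable_fracGrad_prodMeas D
        (TestFunction.contDiff_one (φ + ψ))), AEEqFun.coeFn_add
        (AEEqFun.mk _ (aestronglyMeasurable_fracGrad_prodMeas D (TestFunction.contDiff_one φ)))
        (AEEqFun.mk _ (aestronglyMeasurable_fracGrad_prodMeas D (TestFunction.contDiff_one ψ))),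
        D.ae_mem] with p h1 h2 h3 h4 hp
    rw [Submodule.coe_add, h3, h4, Pi.add_apply, h1, h2]
    exact fracGrad_add hp (TestFunction.contDiff_one φ) φ.hasCompactSupport
      (TestFunction.contDiff_one ψ) ψ.hasCompactSupport p.2
  map_smul' c φ := by
    apply Subtype.ext
    apply AEEqFun.ext
    filter_upwards [AEEqFun.coeFn_mk _ (aestronglyMeasurable_fracGrad_prodMeas D
        (TestFunction.contDiff_one φ)), AEEqFun.coeFn_mk _ (aestronglyMeasurable_fracGrad_prodMeas D
        (TestFunction.contDiff_one (c • φ))), AEEqFun.coeFn_smul c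
        (AEEqFun.mk _ (aestronglyMeasurable_fracGrad_prodMeas D (TestFunction.contDiff_one φ))),
        D.ae_mem] with p h1 h2 h3 hp
    rw [RingHom.id_apply, Submodule.coe_smul, h2, h3, Pi.smul_apply, h1]
    exact fracGrad_smul c (TestFunction.contDiff_one φ) p.2

variable {D Ω}

theorem testField_ae (φ : 𝓓(Ω, ℝ)) : ((testField D Ω φ).1 : ℝ × Eucl n → Eucl n) =ᵐ[D.prodMeas]
    fun p => fracGrad p.1 φ p.2 := AEEqFun.coeFn_mk _ _

theorem h0Submodule_eq :
    D.h0Submodule Ω = (LinearMap.range (testField D Ω)).topologicalClosure := by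
  unfold Coefficients.h0Submodule
  congr 1
  rw [← Submodule.span_eq (LinearMap.range (testField D Ω))]
  congr 1
  ext G
  constructor
  · rintro ⟨φ, h⟩
    exact ⟨φ, Subtype.ext (AEEqFun.ext ((testField_ae φ).trans h.symm))⟩
  · rintro ⟨φ, rfl⟩
    exact ⟨φ, testField_ae φ⟩

instance : CompleteSpace (D.H0 Ω) :=
  (Submodule.isClosed_topologicalClosure _ :
    IsClosed (D.h0Submodule Ω : Set D.L2Field)).completeSpace_coe

theorem testField_mem (φ : 𝓓(Ω, ℝ)) : testField D Ω φ ∈ D.h0Submodule Ω := by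
  rw [h0Submodule_eq]
  exact Submodule.le_topologicalClosure _ ⟨φ, rfl⟩

variable (D Ω)

/-- The embedding of `𝓓(Ω)` into `H⁰(𝒜, Ω)`. -/
noncomputable def toH0 : 𝓓(Ω, ℝ) →ₗ[ℝ] D.H0 Ω :=
  (testField D Ω).codRestrict (D.h0Submodule Ω) testField_mem

variable {D Ω}

theorem toH0_grad_ae (φ : 𝓓(Ω, ℝ)) : (toH0 D Ω φ).grad =ᵐ[D.prodMeas]
    fun p => fracGrad p.1 φ p.2 := testField_ae φ

theorem denseRange_toH0 : DenseRange (toH0 D Ω) := by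
  intro U
  have hU : (U.1 : D.L2Field) ∈ closure (LinearMap.range (testField D Ω) : Set D.L2Field) :=
    (h0Submodule_eq (D := D) (Ω := Ω)).le U.2
  rw [Metric.mem_closure_iff] at hU ⊢
  intro ε hε
  obtain ⟨_, ⟨φ, rfl⟩, hφ⟩ := hU ε hε
  exact ⟨_, ⟨φ, rfl⟩, hφ⟩

theorem norm_sq_toH0 (φ : 𝓓(Ω, ℝ)) :
    ENNReal.ofReal (‖toH0 D Ω φ‖ ^ 2) = energy D fun p => fracGrad p.1 φ p.2 := by
  rw [← energy_congr (testField_ae φ), energy_coe]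
  rfl

theorem exists_setLIntegral_grad_le (R : ℝ) : ∃ C : ℝ, 0 ≤ C ∧ ∀ U : D.H0 Ω,
    ∫⁻ p in univ ×ˢ Metric.ball 0 R, ‖U.grad p‖ₑ ∂D.prodMeas ≤ ENNReal.ofReal (C * ‖U‖) := by
  obtain ⟨C, hC, h⟩ := exists_setLIntegral_le_norm D R
  exact ⟨C, hC, fun U => h U.1⟩

theorem TestFunction.eq_zero_of_notMem (φ : 𝓓(Ω, ℝ)) {x : Eucl n} (hx : x ∉ (Ω : Set (Eucl n))) :
    φ x = 0 :=
  image_eq_zero_of_notMem_tsupport fun h => hx (φ.tsupport_subset h)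

/-- The Poincaré inequality on `H⁰(𝒜, Ω)`, and the equicontinuity that makes the embedding
into `L¹` compact. -/
theorem exists_poincare_toH0 (hn : 1 ≤ n) (hΩ : Bornology.IsBounded (Ω : Set (Eucl n))) :
    ∃ C ρ : ℝ, 0 ≤ C ∧ 0 < ρ ∧ ∀ φ : 𝓓(Ω, ℝ), ∫⁻ x, ‖φ x‖ₑ ≤ ENNReal.ofReal (C * ‖toH0 D Ω φ‖) ∧
      ∀ t ∈ Ioc (0 : ℝ) 1, ∫⁻ x, ‖heat t φ x - φ x‖ₑ ≤
        ENNReal.ofReal (C * t ^ ρ * ‖toH0 D Ω φ‖) := by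
  obtain ⟨s₀, hs₀, hμ⟩ := D.support_μ
  obtain ⟨R₀, hR₀, hsub⟩ := hΩ.subset_ball_lt 0 0
  obtain ⟨R, C, hC, h⟩ := exists_poincare_ball hn hs₀ hR₀
  obtain ⟨C', hC', h'⟩ := exists_setLIntegral_grad_le (D := D) (Ω := Ω) R
  set m := D.μ.real univ with hm
  have hm0 : 0 < m := by
    rw [hm, Measure.real, ENNReal.toReal_pos_iff]
    exact ⟨by simpa using D.μ_ne_zero, measure_lt_top _ _⟩
  have hmE : D.μ univ = ENNReal.ofReal m := (ofReal_measureReal (measure_ne_top _ _)).symm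
  have hmem : ∀ᵐ s ∂D.μ, s ∈ Icc s₀ 1 := ae_iff.2 hμ
  -- integrate a bound that holds for each order `s` against `dμ(s)`
  have key : ∀ (φ : 𝓓(Ω, ℝ)) (I : ENNReal) (K : ℝ), 0 ≤ K →
      (∀ s ∈ Icc s₀ 1,
        I ≤ ENNReal.ofReal K * ∫⁻ x in Metric.ball (0 : Eucl n) R, ‖fracGrad s φ x‖ₑ) →
      I ≤ ENNReal.ofReal (m⁻¹ * K * C' * ‖toH0 D Ω φ‖) := by
    intro φ I K hK hI
    have h1 : ENNReal.ofReal m * I ≤ ENNReal.ofReal K * ENNReal.ofReal (C' * ‖toH0 D Ω φ‖) := by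
      calc ENNReal.ofReal m * I = ∫⁻ _, I ∂D.μ := by rw [lintegral_const, hmE, mul_comm]
        _ ≤ ∫⁻ s, ENNReal.ofReal K *
            (∫⁻ x in Metric.ball (0 : Eucl n) R, ‖fracGrad s φ x‖ₑ) ∂D.μ :=
          lintegral_mono_ae (hmem.mono hI)
        _ = ENNReal.ofReal K *
            ∫⁻ p in univ ×ˢ Metric.ball (0 : Eucl n) R, ‖fracGrad p.1 φ p.2‖ₑ ∂D.prodMeas := by
          rw [lintegral_const_mul' _ _ ENNReal.ofReal_ne_top]
          have hae := (aestronglyMeasurable_fracGrad_prodMeas D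
            (TestFunction.contDiff_one φ)).enorm.restrict (s := univ ×ˢ Metric.ball (0 : Eucl n) R)
          rw [← Measure.prod_restrict, Measure.restrict_univ] at hae ⊢
          rw [lintegral_prod _ hae]
        _ ≤ _ := by
          gcongr
          refine le_trans (le_of_eq ?_) (h' (toH0 D Ω φ))
          exact lintegral_congr_ae (ae_restrict_of_ae ((toH0_grad_ae φ).mono fun p hp => by
            simp only [hp]))
    calc I = ENNReal.ofReal m⁻¹ * (ENNReal.ofReal m * I) := by
          rw [← mul_assoc, ← ENNReal.ofReal_mul (by positivity), inv_mul_cancel₀ hm0.ne']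
          simp
      _ ≤ ENNReal.ofReal m⁻¹ * (ENNReal.ofReal K * ENNReal.ofReal (C' * ‖toH0 D Ω φ‖)) := by
          gcongr
      _ = _ := by
          rw [← ENNReal.ofReal_mul hK, ← ENNReal.ofReal_mul (by positivity)]
          congr 1
          ring
  refine ⟨m⁻¹ * C * C', s₀ / 2, by positivity, by positivity, fun φ => ?_⟩
  have hsupp : ∀ y, R₀ ≤ ‖y‖ → φ y = 0 := fun y hy =>
    TestFunction.eq_zero_of_notMem φ fun hmem => by
      have := hsub hmem
      simp only [Metric.mem_ball, dist_zero_right] at this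
      linarith
  have h2 := fun s hs => h s hs φ (TestFunction.contDiff_one φ) φ.hasCompactSupport hsupp
  refine ⟨key φ _ C hC fun s hs => (h2 s hs).1, fun t ht => ?_⟩
  have ht0 := ht.1
  refine (key φ _ _ (by positivity) fun s hs => (h2 s hs).2 t ht).trans (le_of_eq ?_)
  congr 1
  ring

end TestFields

/-! ### The embedding into `L¹`: injectivity and compactness -/

section Embedding

variable {n : ℕ} (D : Coefficients n) (Ω : TopologicalSpace.Opens (Eucl n))

theorem TestFunction.integrable {Ω : TopologicalSpace.Opens (Eucl n)} (φ : 𝓓(Ω, ℝ)) :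
    Integrable φ :=
  (TestFunction.contDiff_one φ).continuous.integrable_of_hasCompactSupport φ.hasCompactSupport

/-- The embedding of `𝓓(Ω)` into `L¹(ℝⁿ)`. -/
noncomputable def testToL1 : 𝓓(Ω, ℝ) →ₗ[ℝ] Lp ℝ 1 (volume : Measure (Eucl n)) where
  toFun φ := (TestFunction.integrable φ).toL1 φ
  map_add' φ ψ :=
    Integrable.toL1_add φ ψ (TestFunction.integrable φ) (TestFunction.integrable ψ)
  map_smul' c φ := Integrable.toL1_smul' φ (TestFunction.integrable φ) c

/-- The map `H⁰(𝒜, Ω) → L¹(ℝⁿ)` that extends the identity on `𝓓(Ω)` by continuity. -/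
noncomputable def toFunctionL1 : D.H0 Ω →L[ℝ] Lp ℝ 1 (volume : Measure (Eucl n)) :=
  (testToL1 Ω).extendOfNorm (toH0 D Ω)

variable {D Ω}

theorem testToL1_ae (φ : 𝓓(Ω, ℝ)) : testToL1 Ω φ =ᵐ[volume] φ :=
  (TestFunction.integrable φ).coeFn_toL1

theorem ofReal_norm_testToL1 (φ : 𝓓(Ω, ℝ)) :
    ENNReal.ofReal ‖testToL1 Ω φ‖ = ∫⁻ x, ‖φ x‖ₑ := by
  rw [ofReal_norm]
  exact Integrable.enorm_toL1 (TestFunction.integrable φ)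

theorem norm_testToL1 (φ : 𝓓(Ω, ℝ)) : ‖testToL1 Ω φ‖ = ∫ x, ‖φ x‖ := by
  rw [integral_norm_eq_lintegral_enorm (TestFunction.integrable φ).aestronglyMeasurable,
    ← ofReal_norm_testToL1, ENNReal.toReal_ofReal (norm_nonneg _)]

theorem exists_norm_testToL1_le (hn : 1 ≤ n) (hΩ : Bornology.IsBounded (Ω : Set (Eucl n))) :
    ∃ C, ∀ φ, ‖testToL1 Ω φ‖ ≤ C * ‖toH0 D Ω φ‖ := by
  obtain ⟨C, ρ, hC, -, h⟩ := exists_poincare_toH0 (D := D) hn hΩ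
  refine ⟨C, fun φ => ?_⟩
  have := (h φ).1
  rwa [← ofReal_norm_testToL1, ENNReal.ofReal_le_ofReal_iff (by positivity)] at this

theorem toFunctionL1_toH0 (hn : 1 ≤ n) (hΩ : Bornology.IsBounded (Ω : Set (Eucl n)))
    (φ : 𝓓(Ω, ℝ)) : toFunctionL1 D Ω (toH0 D Ω φ) = testToL1 Ω φ :=
  LinearMap.extendOfNorm_eq denseRange_toH0 (exists_norm_testToL1_le hn hΩ) φ

/-- Every element of `H⁰(𝒜, Ω)` is a limit of test functions in norm and almost everywhere. -/
theorem exists_seq_tendsto (hn : 1 ≤ n) (hΩ : Bornology.IsBounded (Ω : Set (Eucl n)))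
    (U : D.H0 Ω) : ∃ φ : ℕ → 𝓓(Ω, ℝ), Tendsto (fun k => toH0 D Ω (φ k)) atTop (𝓝 U) ∧
      ∀ᵐ x, Tendsto (fun k => φ k x) atTop (𝓝 (toFunctionL1 D Ω U x)) := by
  obtain ⟨v, hv, hlim⟩ := mem_closure_iff_seq_limit.1 (denseRange_toH0 (D := D) (Ω := Ω) U)
  choose φ hφ using hv
  have h1 : Tendsto (fun k => toH0 D Ω (φ k)) atTop (𝓝 U) := by simpa only [hφ] using hlim
  have h2 := ((toFunctionL1 D Ω).continuous.tendsto U).comp h1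
  obtain ⟨ns, hns, hae⟩ := (tendstoInMeasure_of_tendsto_Lp h2).exists_seq_tendsto_ae
  refine ⟨fun k => φ (ns k), h1.comp hns.tendsto_atTop, ?_⟩
  have h3 : ∀ᵐ x, ∀ k, toFunctionL1 D Ω (toH0 D Ω (φ k)) x = φ k x := by
    rw [ae_all_iff]
    intro k
    rw [toFunctionL1_toH0 hn hΩ]
    exact testToL1_ae (φ k)
  filter_upwards [hae, h3] with x hx hx3
  simpa only [Function.comp_apply, hx3] using hx

/-- The elements of `H⁰(𝒜, Ω)` vanish off `Ω`. -/
theorem toFunctionL1_eq_zero (hn : 1 ≤ n) (hΩ : Bornology.IsBounded (Ω : Set (Eucl n)))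
    (U : D.H0 Ω) : ∀ᵐ x, x ∉ (Ω : Set (Eucl n)) → toFunctionL1 D Ω U x = 0 := by
  obtain ⟨φ, -, h⟩ := exists_seq_tendsto hn hΩ U
  filter_upwards [h] with x hx hxΩ
  refine tendsto_nhds_unique hx ?_
  simp only [TestFunction.eq_zero_of_notMem _ hxΩ]
  exact tendsto_const_nhds

/-- Moving `Dˢ` onto the test field `g` bounds the pairing of `g` with `Dˢφ` by `‖φ‖₁` alone. -/
theorem exists_norm_integral_smul_fracGrad_le {g : ℝ × Eucl n → ℝ} (hg : ContDiff ℝ 1 g)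
    (hgc : HasCompactSupport g) : ∃ C : ℝ, ∀ φ : 𝓓(Ω, ℝ),
      ‖∫ p, g p • fracGrad p.1 φ p.2 ∂D.prodMeas‖ ≤ C * ‖testToL1 Ω φ‖ := by
  obtain ⟨s₀, hs₀, hμ⟩ := D.support_μ
  have hmem : ∀ᵐ s ∂D.μ, s ∈ Icc s₀ 1 := ae_iff.2 hμ
  obtain ⟨B, hB, h⟩ := exists_norm_fracGrad_le n hs₀
  obtain ⟨L, hL⟩ := ContDiff.lipschitzWith_of_hasCompactSupport hgc hg one_ne_zero
  obtain ⟨M, hM⟩ := hg.continuous.bounded_above_of_compact_support hgc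
  have hgs : ∀ s : ℝ, ContDiff ℝ 1 fun x : Eucl n => g (s, x) := fun s => by fun_prop
  have hgsc : ∀ s : ℝ, HasCompactSupport fun x : Eucl n => g (s, x) := fun s => by
    refine HasCompactSupport.intro (hgc.isCompact.image continuous_snd) fun x hx => ?_
    exact image_eq_zero_of_notMem_tsupport fun hmem => hx ⟨_, hmem, rfl⟩
  have hgb : ∀ s : ℝ, BddLip (fun x : Eucl n => g (s, x)) M L := fun s =>
    ⟨(hgs s).continuous, fun x => hM _, fun x y => by
      have := hL.dist_le_mul (s, x) (s, y)
      rwa [Prod.dist_eq, dist_self, max_eq_right dist_nonneg, Real.dist_eq, dist_eq_norm] at this⟩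
  refine ⟨D.μ.real univ * (B * (M + L)), fun φ => ?_⟩
  have hφ1 := TestFunction.contDiff_one φ
  obtain ⟨M', L', hb', hL'⟩ := exists_bddLip hφ1 φ.hasCompactSupport
  have hgi : Integrable g D.prodMeas := hg.continuous.integrable_of_hasCompactSupport hgc
  have hint : Integrable (fun p => g p • fracGrad p.1 φ p.2) D.prodMeas := by
    refine hgi.smul_bdd (B * (M' + L')) (aestronglyMeasurable_fracGrad_prodMeas D hφ1) ?_
    filter_upwards [Measure.quasiMeasurePreserving_fst.ae hmem] with p hp
    exact h p.1 hp φ M' L' hb' hL' p.2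
  rw [integral_prod _ hint, norm_testToL1]
  have hs : ∀ᵐ s ∂D.μ, ‖∫ x, g (s, x) • fracGrad s φ x‖ ≤ B * (M + L) * ∫ x, ‖φ x‖ := by
    filter_upwards [hmem] with s hs
    rw [integral_smul_fracGrad ⟨hs₀.trans_le hs.1, hs.2⟩ hφ1 φ.hasCompactSupport (hgs s) (hgsc s),
      norm_neg, ← integral_const_mul]
    refine norm_integral_le_of_norm_le ((TestFunction.integrable φ).norm.const_mul _)
      (Eventually.of_forall fun x => ?_)
    rw [norm_smul, mul_comm]
    gcongr
    exact h s hs _ M L (hgb s) L.2 x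
  refine (norm_integral_le_of_norm_le_const hs).trans (le_of_eq ?_)
  ring

theorem integrable_smul_grad {g : ℝ × Eucl n → ℝ} (hg : Continuous g)
    (hgc : HasCompactSupport g) (U : D.H0 Ω) : Integrable (fun p => g p • U.grad p) D.prodMeas := by
  obtain ⟨M, hM⟩ := hg.bounded_above_of_compact_support hgc
  obtain ⟨R, hR⟩ := (hgc.isCompact.image continuous_snd).isBounded.subset_ball 0
  obtain ⟨C, -, hC⟩ := exists_setLIntegral_grad_le (D := D) (Ω := Ω) R
  have hUm : AEStronglyMeasurable U.grad D.prodMeas := U.1.1.aestronglyMeasurable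
  have hUi : IntegrableOn U.grad (univ ×ˢ Metric.ball 0 R) D.prodMeas :=
    ⟨hUm.restrict, (hC U).trans_lt ENNReal.ofReal_lt_top⟩
  have h1 : IntegrableOn (fun p => g p • U.grad p) (univ ×ˢ Metric.ball 0 R) D.prodMeas :=
    hUi.bdd_smul M hg.aestronglyMeasurable (Eventually.of_forall hM)
  refine (integrableOn_iff_integrable_of_support_subset ?_).1 h1
  intro p hp
  refine ⟨mem_univ _, hR ⟨p, subset_tsupport _ fun h0 => hp ?_, rfl⟩⟩
  simp [h0]

theorem exists_norm_integral_smul_grad_le {g : ℝ × Eucl n → ℝ} (hg : Continuous g)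
    (hgc : HasCompactSupport g) : ∃ C : ℝ, 0 ≤ C ∧ ∀ U : D.H0 Ω,
      ‖∫ p, g p • U.grad p ∂D.prodMeas‖ ≤ C * ‖U‖ := by
  obtain ⟨M, hM⟩ := hg.bounded_above_of_compact_support hgc
  have hM0 : 0 ≤ M := (norm_nonneg _).trans (hM 0)
  obtain ⟨R, hR⟩ := (hgc.isCompact.image continuous_snd).isBounded.subset_ball 0
  obtain ⟨C, hC0, hC⟩ := exists_setLIntegral_grad_le (D := D) (Ω := Ω) R
  refine ⟨M * C, by positivity, fun U => ?_⟩
  rw [← ENNReal.ofReal_le_ofReal_iff (by positivity), ofReal_norm]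
  calc _ ≤ ∫⁻ p, ‖g p • U.grad p‖ₑ ∂D.prodMeas := enorm_integral_le_lintegral_enorm _
    _ = ∫⁻ p in univ ×ˢ Metric.ball 0 R, ‖g p • U.grad p‖ₑ ∂D.prodMeas := by
        refine (setLIntegral_eq_of_support_subset fun p hp => ?_).symm
        refine ⟨mem_univ _, hR ⟨p, subset_tsupport _ fun h0 => hp ?_, rfl⟩⟩
        simp [h0]
    _ ≤ ∫⁻ p in univ ×ˢ Metric.ball 0 R, ENNReal.ofReal M * ‖U.grad p‖ₑ ∂D.prodMeas := by
        refine lintegral_mono fun p => ?_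
        rw [enorm_smul]
        gcongr
        rw [← ofReal_norm]
        exact ENNReal.ofReal_le_ofReal (hM p)
    _ ≤ _ := by
        rw [lintegral_const_mul' _ _ ENNReal.ofReal_ne_top, mul_assoc, ENNReal.ofReal_mul hM0]
        gcongr
        exact hC U

theorem grad_sub_ae (U V : D.H0 Ω) :
    (U - V).grad =ᵐ[D.prodMeas] fun p => U.grad p - V.grad p :=
  AEEqFun.coeFn_sub U.1.1 V.1.1

/-- Integration by parts against a test function shows that `Dˢu` is determined by `u`. -/
theorem norm_integral_smul_grad_le_toFunctionL1 (hn : 1 ≤ n)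
    (hΩ : Bornology.IsBounded (Ω : Set (Eucl n))) {g : ℝ × Eucl n → ℝ} (hg : ContDiff ℝ 1 g)
    (hgc : HasCompactSupport g) : ∃ C : ℝ, ∀ U : D.H0 Ω,
      ‖∫ p, g p • U.grad p ∂D.prodMeas‖ ≤ C * ‖toFunctionL1 D Ω U‖ := by
  obtain ⟨C, hC⟩ := exists_norm_integral_smul_fracGrad_le (D := D) (Ω := Ω) hg hgc
  obtain ⟨C', hC'0, hC'⟩ := exists_norm_integral_smul_grad_le (D := D) (Ω := Ω) hg.continuous hgc
  have hcont : Continuous fun U : D.H0 Ω => ∫ p, g p • U.grad p ∂D.prodMeas := by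
    refine LipschitzWith.continuous (K := ⟨C', hC'0⟩) (LipschitzWith.of_dist_le_mul fun U V => ?_)
    rw [dist_eq_norm, dist_eq_norm, ← integral_sub (integrable_smul_grad hg.continuous hgc U)
      (integrable_smul_grad hg.continuous hgc V)]
    refine le_trans (le_of_eq ?_) (hC' (U - V))
    congr 1
    refine integral_congr_ae ?_
    filter_upwards [grad_sub_ae U V] with p hp
    rw [hp, smul_sub]
  refine ⟨C, fun U => ?_⟩
  refine (denseRange_toH0 (D := D) (Ω := Ω)).induction_on
    (p := fun U => ‖∫ p, g p • U.grad p ∂D.prodMeas‖ ≤ C * ‖toFunctionL1 D Ω U‖) U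
    (isClosed_le hcont.norm (by fun_prop)) fun φ => ?_
  rw [toFunctionL1_toH0 hn hΩ]
  refine le_trans (le_of_eq ?_) (hC φ)
  congr 1
  refine integral_congr_ae ?_
  filter_upwards [toH0_grad_ae φ] with p hp
  rw [hp]

/-- If `u = 0` then the field `Dˢu` is annihilated by every test field in `(s, x)`, hence vanishes
almost everywhere; the norm of `H⁰(𝒜, Ω)` sees only this field. -/
theorem toFunctionL1_injective (hn : 1 ≤ n) (hΩ : Bornology.IsBounded (Ω : Set (Eucl n))) :
    Function.Injective (toFunctionL1 D Ω) := by
  rw [injective_iff_map_eq_zero]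
  intro U hU
  have hloc : LocallyIntegrable U.grad D.prodMeas := by
    rw [locallyIntegrable_iff]
    intro K hK
    obtain ⟨R, hR⟩ := (hK.image continuous_snd).isBounded.subset_ball 0
    obtain ⟨C, -, hC⟩ := exists_setLIntegral_grad_le (D := D) (Ω := Ω) R
    have hUm : AEStronglyMeasurable U.grad D.prodMeas := U.1.1.aestronglyMeasurable
    have hUi : IntegrableOn U.grad (univ ×ˢ Metric.ball 0 R) D.prodMeas :=
      ⟨hUm.restrict, (hC U).trans_lt ENNReal.ofReal_lt_top⟩
    exact hUi.mono_set fun p hp => ⟨mem_univ _, hR ⟨p, hp, rfl⟩⟩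
  have h0 := ae_eq_zero_of_integral_contDiff_smul_eq_zero hloc fun g hg hgc => by
    obtain ⟨C, hC⟩ := norm_integral_smul_grad_le_toFunctionL1 (D := D) hn hΩ
      (hg.of_le (by exact_mod_cast le_top)) hgc
    have := hC U
    rw [hU, norm_zero, mul_zero] at this
    exact norm_le_zero_iff.1 this
  apply Subtype.ext
  apply Subtype.ext
  apply AEEqFun.ext
  filter_upwards [h0, AEEqFun.coeFn_zero (μ := D.prodMeas) (α := ℝ × Eucl n) (β := Eucl n)]
    with p hp hz
  exact hp.trans hz.symm

/-- Evaluation of `e^{tΔ}u` at the point `x`, as a functional of `u ∈ L¹`. -/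
noncomputable def heatEval {t : ℝ} (ht : 0 < t) (x : Eucl n) :
    Lp ℝ 1 (volume : Measure (Eucl n)) →L[ℝ] ℝ :=
  have hk : ∀ u : Lp ℝ 1 (volume : Measure (Eucl n)),
      Integrable (fun y => heatKer t (y - x) * u y) := fun u =>
    (L1.integrable_coeFn u).bdd_mul (c := (4 * Real.pi * t) ^ (-(n : ℝ) / 2))
      ((continuous_heatKer t).comp (continuous_sub_right x)).aestronglyMeasurable
      (Eventually.of_forall fun y => by
        rw [Real.norm_of_nonneg (heatKer_pos ht _).le]; exact heatKer_le ht _)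
  LinearMap.mkContinuous
    { toFun := fun u => ∫ y, heatKer t (y - x) * u y
      map_add' := fun u v => by
        rw [← integral_add (hk u) (hk v)]
        refine integral_congr_ae ?_
        filter_upwards [Lp.coeFn_add u v] with y hy
        rw [hy, Pi.add_apply, mul_add]
      map_smul' := fun c u => by
        rw [RingHom.id_apply, smul_eq_mul, ← integral_const_mul]
        refine integral_congr_ae ?_
        filter_upwards [Lp.coeFn_smul c u] with y hy
        rw [hy, Pi.smul_apply, smul_eq_mul]
        ring } ((4 * Real.pi * t) ^ (-(n : ℝ) / 2)) fun u => by
    rw [L1.norm_eq_integral_norm, ← integral_const_mul]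
    refine norm_integral_le_of_norm_le ((L1.integrable_coeFn u).norm.const_mul _)
      (Eventually.of_forall fun y => ?_)
    rw [norm_mul, Real.norm_of_nonneg (heatKer_pos ht _).le]
    exact mul_le_mul_of_nonneg_right (heatKer_le ht _) (norm_nonneg _)

theorem heatEval_testToL1 {t : ℝ} (ht : 0 < t) (x : Eucl n) (φ : 𝓓(Ω, ℝ)) :
    heatEval ht x (testToL1 Ω φ) = heat t φ x := by
  have h1 : heatEval ht x (testToL1 Ω φ) = ∫ y, heatKer t (y - x) * testToL1 Ω φ y := rfl
  rw [h1, heat]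
  have h2 : ∫ z, heatKer t z * φ (x + z) = ∫ y, heatKer t (y - x) * φ y := by
    rw [← integral_add_left_eq_self (fun y => heatKer t (y - x) * φ y) x]
    simp only [add_sub_cancel_left]
  rw [h2]
  refine integral_congr_ae ?_
  filter_upwards [testToL1_ae φ] with y hy
  rw [hy]

/-- `e^{tΔ}` maps `L¹` into Lipschitz functions. -/
theorem abs_heat_sub_heat_le {t : ℝ} (ht : 0 < t) : ∃ A : ℝ, 0 ≤ A ∧ ∀ φ : Eucl n → ℝ,
    Integrable φ → ∀ x y, |heat t φ x - heat t φ y| ≤ A * ‖x - y‖ * ∫ z, ‖φ z‖ := by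
  obtain ⟨A, hA, h⟩ := abs_heatKer_sub_le (n := n) ht
  refine ⟨A, hA, fun φ hi x y => ?_⟩
  have he : ∀ x, heat t φ x = ∫ w, heatKer t (w - x) * φ w := fun x => by
    rw [← integral_add_left_eq_self (fun w => heatKer t (w - x) * φ w) x]
    simp only [add_sub_cancel_left]
    rfl
  have hk : ∀ x, Integrable fun w => heatKer t (w - x) * φ w := fun x =>
    hi.bdd_mul (c := (4 * Real.pi * t) ^ (-(n : ℝ) / 2))
      ((continuous_heatKer t).comp (continuous_sub_right x)).aestronglyMeasurable
      (Eventually.of_forall fun y => by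
        rw [Real.norm_of_nonneg (heatKer_pos ht _).le]; exact heatKer_le ht _)
  rw [he, he, ← integral_sub (hk x) (hk y), ← integral_const_mul, ← Real.norm_eq_abs]
  refine norm_integral_le_of_norm_le (hi.norm.const_mul _) (Eventually.of_forall fun w => ?_)
  rw [← sub_mul, norm_mul]
  gcongr
  refine (h _ _).trans (le_of_eq ?_)
  rw [sub_sub_sub_cancel_left, norm_sub_rev]

/-- Compactness of the embedding into `L¹`: up to a small multiple of the norm of `H⁰(𝒜, Ω)`, the
`L¹` norm is controlled by finitely many functionals, the values of `e^{tΔ}u` on a finite net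
of `Ω`. -/
theorem exists_norm_toFunctionL1_le (hn : 1 ≤ n) (hΩ : Bornology.IsBounded (Ω : Set (Eucl n)))
    {ε : ℝ} (hε : 0 < ε) : ∃ (T : Finset (Eucl n)) (θ : Eucl n → D.H0 Ω →L[ℝ] ℝ) (K : ℝ),
      ∀ U, ‖toFunctionL1 D Ω U‖ ≤ ε * ‖U‖ + K * ∑ x ∈ T, |θ x U| := by
  obtain ⟨C, ρ, hC, hρ, h⟩ := exists_poincare_toH0 (D := D) hn hΩ
  obtain ⟨t, ht, htε⟩ : ∃ t ∈ Ioc (0 : ℝ) 1, C * t ^ ρ ≤ ε / 2 := by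
    have hlim : Tendsto (fun t : ℝ => C * t ^ ρ) (𝓝[>] 0) (𝓝 0) := by
      have : ContinuousAt (fun t : ℝ => C * t ^ ρ) 0 :=
        (Real.continuousAt_rpow_const 0 ρ (Or.inr hρ.le)).const_mul C
      have h3 := this.tendsto.mono_left (nhdsWithin_le_nhds (s := Ioi 0))
      simpa [Real.zero_rpow hρ.ne'] using h3
    obtain ⟨t, h1, h2⟩ := ((hlim.eventually (ge_mem_nhds (half_pos hε))).and
      (Ioc_mem_nhdsGT one_pos)).exists
    exact ⟨t, h2, h1⟩
  obtain ⟨A, hA, hlip⟩ := abs_heat_sub_heat_le (n := n) ht.1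
  set v := volume.real (Ω : Set (Eucl n)) with hv
  have hv0 : 0 ≤ v := measureReal_nonneg
  have hvE : volume (Ω : Set (Eucl n)) = ENNReal.ofReal v :=
    (ofReal_measureReal hΩ.measure_lt_top.ne).symm
  -- on a net of mesh `δ`, the oscillation of `e^{tΔ}φ` contributes at most `‖φ‖₁ / 2`
  set δ := (2 * (v * A + 1))⁻¹ with hδ
  have hδ0 : 0 < δ := by positivity
  have hvδ : v * (A * δ) ≤ 1 / 2 := by
    have h1 : 0 < v * A + 1 := by positivity
    rw [hδ, mul_inv]
    calc v * (A * (2⁻¹ * (v * A + 1)⁻¹)) = (v * A) / (v * A + 1) * 2⁻¹ := by ring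
      _ ≤ 1 * 2⁻¹ := by
          gcongr
          rw [div_le_one h1]
          linarith
      _ = 1 / 2 := by norm_num
  obtain ⟨T, hTfin, hT⟩ := Metric.totallyBounded_iff.1
    (hΩ.isCompact_closure.totallyBounded.subset subset_closure) δ hδ0
  refine ⟨hTfin.toFinset, fun x => (heatEval ht.1 x).comp (toFunctionL1 D Ω), 2 * v, fun U => ?_⟩
  refine (denseRange_toH0 (D := D) (Ω := Ω)).induction_on
    (p := fun U => ‖toFunctionL1 D Ω U‖ ≤ ε * ‖U‖ + 2 * v * ∑ x ∈ hTfin.toFinset,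
      |((heatEval ht.1 x).comp (toFunctionL1 D Ω)) U|) U
    (isClosed_le (by fun_prop) (by fun_prop)) fun φ => ?_
  simp only [ContinuousLinearMap.comp_apply, toFunctionL1_toH0 hn hΩ, heatEval_testToL1]
  set N := ‖testToL1 Ω φ‖ with hN
  set Θ := ∑ x ∈ hTfin.toFinset, |heat t φ x| with hΘ
  have hΘ0 : 0 ≤ Θ := Finset.sum_nonneg fun _ _ => abs_nonneg _
  have hpt : ∀ x ∈ (Ω : Set (Eucl n)), ‖φ x‖ₑ ≤
      ‖heat t φ x - φ x‖ₑ + ENNReal.ofReal (A * δ * N + Θ) := by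
    intro x hx
    obtain ⟨y, hy, hxy⟩ := mem_iUnion₂.1 (hT hx)
    have h1 := hlip φ (TestFunction.integrable φ) x y
    rw [← norm_testToL1] at h1
    have h2 : |heat t φ y| ≤ Θ :=
      Finset.single_le_sum (f := fun x => |heat t φ x|) (fun _ _ => abs_nonneg _)
        (hTfin.mem_toFinset.2 hy)
    have h3 : |heat t φ x| ≤ A * δ * N + Θ := by
      have h4 : A * ‖x - y‖ * N ≤ A * δ * N := by
        gcongr
        rw [← dist_eq_norm]
        exact (Metric.mem_ball.1 hxy).le
      have h5 := abs_sub_abs_le_abs_sub (heat t φ x) (heat t φ y)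
      linarith
    calc ‖φ x‖ₑ = ‖heat t φ x - (heat t φ x - φ x)‖ₑ := by rw [sub_sub_cancel]
      _ ≤ ‖heat t φ x‖ₑ + ‖heat t φ x - φ x‖ₑ := enorm_sub_le
      _ ≤ _ := by
        rw [add_comm]
        gcongr
        rw [← ofReal_norm]
        exact ENNReal.ofReal_le_ofReal h3
  have hmain : ENNReal.ofReal N ≤
      ENNReal.ofReal (C * t ^ ρ * ‖toH0 D Ω φ‖ + (A * δ * N + Θ) * v) := by
    have ht0 := ht.1
    calc ENNReal.ofReal N = ∫⁻ x in Ω, ‖φ x‖ₑ := by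
          rw [hN, ofReal_norm_testToL1]
          refine (setLIntegral_eq_of_support_subset fun x hx => ?_).symm
          by_contra hxΩ
          simp [TestFunction.eq_zero_of_notMem φ hxΩ] at hx
      _ ≤ ∫⁻ x in Ω, (‖heat t φ x - φ x‖ₑ + ENNReal.ofReal (A * δ * N + Θ)) :=
          setLIntegral_mono' Ω.isOpen.measurableSet hpt
      _ ≤ (∫⁻ x, ‖heat t φ x - φ x‖ₑ) + ENNReal.ofReal (A * δ * N + Θ) * ENNReal.ofReal v := by
          rw [lintegral_add_right _ measurable_const, setLIntegral_const, hvE]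
          gcongr
          exact Measure.restrict_le_self
      _ ≤ _ := by
          rw [ENNReal.ofReal_add (p := C * t ^ ρ * ‖toH0 D Ω φ‖) (by positivity) (by positivity),
            ENNReal.ofReal_mul (q := v) (by positivity)]
          gcongr
          exact (h φ).2 t ht
  rw [ENNReal.ofReal_le_ofReal_iff (by have := ht.1; positivity)] at hmain
  have h6 : C * t ^ ρ * ‖toH0 D Ω φ‖ ≤ ε / 2 * ‖toH0 D Ω φ‖ := by gcongr
  have h7 : v * (A * δ) * N ≤ 1 / 2 * N := by gcongr
  nlinarith

/-- The functionals of `exists_norm_toFunctionL1_le` vanish on the orthogonal complement of their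
Riesz representatives. -/
theorem exists_finiteDimensional_norm_toFunctionL1_le (hn : 1 ≤ n)
    (hΩ : Bornology.IsBounded (Ω : Set (Eucl n))) {ε : ℝ} (hε : 0 < ε) :
    ∃ V : Submodule ℝ (D.H0 Ω), FiniteDimensional ℝ V ∧
      ∀ U ∈ Vᗮ, ‖toFunctionL1 D Ω U‖ ≤ ε * ‖U‖ := by
  obtain ⟨T, θ, K, h⟩ := exists_norm_toFunctionL1_le (D := D) hn hΩ hε
  let w : Eucl n → D.H0 Ω := fun x => (InnerProductSpace.toDual ℝ (D.H0 Ω)).symm (θ x)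
  refine ⟨Submodule.span ℝ (w '' T), FiniteDimensional.span_of_finite ℝ (T.finite_toSet.image w),
    fun U hU => ?_⟩
  have h0 : ∑ x ∈ T, |θ x U| = 0 := by
    refine Finset.sum_eq_zero fun x hx => ?_
    have h1 := (Submodule.mem_orthogonal _ _).1 hU (w x) (Submodule.subset_span ⟨x, hx, rfl⟩)
    rw [InnerProductSpace.toDual_symm_apply] at h1
    rw [h1, abs_zero]
  have := h U
  rwa [h0, mul_zero, add_zero] at this

end Embedding

/-! ### Pointwise bounds for the integrands -/

section Forms

/-- A bilinear form with a quadratic bound is bounded, by homogeneity. -/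
theorem exists_clm_of_bilinear {H : Type*} [NormedAddCommGroup H] [NormedSpace ℝ H]
    {B : H → H → ℝ} (hal : ∀ u u' v, B (u + u') v = B u v + B u' v)
    (hsl : ∀ (c : ℝ) u v, B (c • u) v = c * B u v)
    (har : ∀ u v v', B u (v + v') = B u v + B u v')
    (hsr : ∀ (c : ℝ) u v, B u (c • v) = c * B u v)
    {C : ℝ} (hC : ∀ u v, |B u v| ≤ C * (‖u‖ ^ 2 + ‖v‖ ^ 2)) :
    ∃ L : H →L[ℝ] StrongDual ℝ H, ∀ u v, L u v = B u v := by
  refine ⟨LinearMap.mkContinuous₂ (LinearMap.mk₂ ℝ B hal hsl har hsr) (2 * C) fun u v => ?_,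
    fun u v => rfl⟩
  rw [LinearMap.mk₂_apply, Real.norm_eq_abs]
  have h0l : ∀ v, B 0 v = 0 := fun v => by simpa using hsl 0 0 v
  have h0r : ∀ u, B u 0 = 0 := fun u => by simpa using hsr 0 u 0
  rcases eq_or_ne u 0 with rfl | hu
  · simp [h0l]
  rcases eq_or_ne v 0 with rfl | hv
  · simp [h0r]
  have hu0 : 0 < ‖u‖ := norm_pos_iff.2 hu
  have hv0 : 0 < ‖v‖ := norm_pos_iff.2 hv
  have h1 := hC (‖u‖⁻¹ • u) (‖v‖⁻¹ • v)
  rw [hsl, hsr, norm_smul, norm_smul, norm_inv, norm_inv, norm_norm, norm_norm,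
    inv_mul_cancel₀ hu0.ne', inv_mul_cancel₀ hv0.ne', ← mul_assoc, abs_mul,
    abs_of_pos (by positivity : 0 < ‖u‖⁻¹ * ‖v‖⁻¹)] at h1
  calc |B u v| = ‖u‖ * ‖v‖ * (‖u‖⁻¹ * ‖v‖⁻¹ * |B u v|) := by field_simp
    _ ≤ ‖u‖ * ‖v‖ * (C * (1 ^ 2 + 1 ^ 2)) := by gcongr
    _ = _ := by ring

theorem abs_le_of_sq_le_mul {x a b : ℝ} (ha : 0 ≤ a) (hb : 0 ≤ b) (h : x ^ 2 ≤ a * b) :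
    |x| ≤ (a + b) / 2 := by
  refine abs_le_of_sq_le_sq (h.trans ?_) (by positivity)
  nlinarith [sq_nonneg (a - b)]

variable {n : ℕ} (D : Coefficients n)

theorem det_ne_zero {s : ℝ} (hs : s ∈ Ioc (0 : ℝ) 1) (x : Eucl n) : (D.A s x).det ≠ 0 := by
  intro h
  obtain ⟨v, hv, hAv⟩ := Matrix.exists_mulVec_eq_zero_iff.2 h
  have hv' : (WithLp.toLp 2 v : Eucl n) ≠ 0 := fun h0 => hv (by
    have := congrArg (WithLp.ofLp) h0
    simpa using this)
  refine (D.posDef_A s hs x _ hv').ne' ?_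
  have : ∀ i, ∑ j, D.A s x i j * v i * v j = v i * (D.A s x).mulVec v i := fun i => by
    rw [Matrix.mulVec, dotProduct, Finset.mul_sum]
    exact Finset.sum_congr rfl fun j _ => by ring
  simp only [this, hAv]
  simp

theorem zero_le_Bbd (x : Eucl n) (i j : Fin n) : 0 ≤ D.Bbd x i j :=
  (abs_nonneg _).trans (D.le_Bbd 1 ⟨one_pos, le_rfl⟩ x i j)

theorem zero_le_abd (x : Eucl n) (i : Fin n) : 0 ≤ D.abd x i :=
  (abs_nonneg _).trans (D.le_abd 1 ⟨one_pos, le_rfl⟩ x i)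

theorem zero_le_bbd (x : Eucl n) (i : Fin n) : 0 ≤ D.bbd x i :=
  (abs_nonneg _).trans (D.le_bbd 1 ⟨one_pos, le_rfl⟩ x i)

theorem f_eq (x : Eucl n) : D.f x = ∑ i, ∑ j, D.Bbd x i j * (D.abd x i * D.abd x j) +
    ∑ i, ∑ j, D.Bbd x i j * (D.bbd x i * D.bbd x j) + |D.a₀ x| := by
  unfold Coefficients.f
  simp only [mul_add, Finset.sum_add_distrib]

theorem sum_abd_nonneg (x : Eucl n) : 0 ≤ ∑ i, ∑ j, D.Bbd x i j * (D.abd x i * D.abd x j) :=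
  Finset.sum_nonneg fun i _ => Finset.sum_nonneg fun j _ =>
    mul_nonneg (zero_le_Bbd D x i j) (mul_nonneg (zero_le_abd D x i) (zero_le_abd D x j))

theorem sum_bbd_nonneg (x : Eucl n) : 0 ≤ ∑ i, ∑ j, D.Bbd x i j * (D.bbd x i * D.bbd x j) :=
  Finset.sum_nonneg fun i _ => Finset.sum_nonneg fun j _ =>
    mul_nonneg (zero_le_Bbd D x i j) (mul_nonneg (zero_le_bbd D x i) (zero_le_bbd D x j))

theorem abs_a₀_le_f (x : Eucl n) : |D.a₀ x| ≤ D.f x := by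
  rw [f_eq]
  linarith [sum_abd_nonneg D x, sum_bbd_nonneg D x]

theorem f_nonneg (x : Eucl n) : 0 ≤ D.f x := (abs_nonneg _).trans (abs_a₀_le_f D x)

/-- The sector condition, applied to `H` and `𝒜⁻¹c`. -/
theorem sq_sum_mul_le {KA : ℝ} (hKA : 0 < KA) (hsec : ∀ s ∈ Ioc (0 : ℝ) 1, ∀ x ξ ψ : Eucl n,
      |∑ i, ∑ j, D.A s x i j * ξ i * ψ j| ^ 2 ≤
        KA * (∑ i, ∑ j, D.A s x i j * ξ i * ξ j) * (∑ i, ∑ j, D.A s x i j * ψ i * ψ j))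
    {p : ℝ × Eucl n} (hp : p.1 ∈ Ioc (0 : ℝ) 1) {c d : Fin n → ℝ} (hcd : ∀ i, |c i| ≤ d i)
    (H : Eucl n) : (∑ i, c i * H i) ^ 2 ≤
      KA * (∑ i, ∑ j, D.Bbd p.2 i j * (d i * d j)) * D.bilS p H H := by
  set A := D.A p.1 p.2 with hA
  have hdet : IsUnit A.det := (det_ne_zero D hp p.2).isUnit
  set η : Fin n → ℝ := A⁻¹.mulVec c with hη
  have hAη : A.mulVec η = c := by
    rw [hη, Matrix.mulVec_mulVec, Matrix.mul_nonsing_inv _ hdet, Matrix.one_mulVec]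
  have h1 : ∀ ξ : Fin n → ℝ, ∑ i, ∑ j, A i j * ξ i * η j = ∑ i, c i * ξ i := fun ξ => by
    refine Finset.sum_congr rfl fun i _ => ?_
    conv_rhs => rw [← hAη]
    rw [Matrix.mulVec, dotProduct, Finset.sum_mul]
    exact Finset.sum_congr rfl fun j _ => by ring
  have h2 := hsec p.1 hp p.2 H (WithLp.toLp 2 η)
  simp only [← hA] at h2
  rw [h1, h1, sq_abs] at h2
  have h3 : ∑ i, c i * η i ≤ ∑ i, ∑ j, D.Bbd p.2 i j * (d i * d j) := by
    refine Finset.sum_le_sum fun i _ => ?_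
    rw [hη, Matrix.mulVec, dotProduct, Finset.mul_sum]
    refine Finset.sum_le_sum fun j _ => ?_
    have hd : ∀ i, 0 ≤ d i := fun i => (abs_nonneg _).trans (hcd i)
    calc c i * (A⁻¹ i j * c j) ≤ |c i * (A⁻¹ i j * c j)| := le_abs_self _
      _ = |A⁻¹ i j| * (|c i| * |c j|) := by
          rw [abs_mul, abs_mul]
          ring
      _ ≤ _ := by
          have h4 := D.le_Bbd p.1 hp p.2 i j
          have h5 := hd i
          have h6 := zero_le_Bbd D p.2 i j
          gcongr
          · exact hcd i
          · exact hcd j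
  have h7 : ∑ i, ∑ j, A i j * H i * H j = D.bilS p H H := (D.bilS_self p H).symm
  rw [h7, mul_right_comm] at h2
  refine h2.trans ?_
  have := D.bilS_nonneg hp H
  gcongr

variable {D} in
/-- The three consequences of the sector condition: each of the terms `a^{ij} Dˢⱼu Dˢᵢv`,
`aⁱ u Dˢᵢv` and `bⁱ v Dˢᵢu` is a geometric mean of densities of the energy and of `f u²`. -/
theorem exists_sector : ∃ KA : ℝ, 0 < KA ∧ ∀ p : ℝ × Eucl n, p.1 ∈ Ioc (0 : ℝ) 1 →
    (∀ G H : Eucl n, (∑ i, ∑ j, D.A p.1 p.2 i j * G j * H i) ^ 2 ≤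
      KA * D.bilS p G G * D.bilS p H H) ∧
    (∀ (t : ℝ) (H : Eucl n), (∑ i, D.a p.1 p.2 i * t * H i) ^ 2 ≤
      KA * (D.f p.2 * t ^ 2) * D.bilS p H H) ∧
    (∀ (t : ℝ) (H : Eucl n), (∑ i, D.b p.1 p.2 i * t * H i) ^ 2 ≤
      KA * (D.f p.2 * t ^ 2) * D.bilS p H H) := by
  obtain ⟨KA, hKA, hsec⟩ := D.sector
  have hpull : ∀ (c : Fin n → ℝ) (t : ℝ) (H : Eucl n),
      (∑ i, c i * t * H i) ^ 2 = t ^ 2 * (∑ i, c i * H i) ^ 2 := fun c t H => by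
    rw [← mul_pow, Finset.mul_sum]
    congr 1
    exact Finset.sum_congr rfl fun i _ => by ring
  refine ⟨KA, hKA, fun p hp => ⟨fun G H => ?_, fun t H => ?_, fun t H => ?_⟩⟩
  · have h := hsec p.1 hp p.2 H G
    rw [sq_abs, ← D.bilS_self, ← D.bilS_self] at h
    calc _ = (∑ i, ∑ j, D.A p.1 p.2 i j * H i * G j) ^ 2 := by
          congr 1
          exact Finset.sum_congr rfl fun i _ => Finset.sum_congr rfl fun j _ => by ring
      _ ≤ _ := h
      _ = _ := by ring
  · rw [hpull]
    have h := sq_sum_mul_le D hKA hsec hp (D.le_abd p.1 hp p.2) H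
    have h1 : ∑ i, ∑ j, D.Bbd p.2 i j * (D.abd p.2 i * D.abd p.2 j) ≤ D.f p.2 := by
      rw [f_eq]
      linarith [sum_bbd_nonneg D p.2, abs_nonneg (D.a₀ p.2)]
    have h2 := D.bilS_nonneg hp H
    calc _ ≤ t ^ 2 * (KA * D.f p.2 * D.bilS p H H) := by
          gcongr
          exact h.trans (by gcongr)
      _ = _ := by ring
  · rw [hpull]
    have h := sq_sum_mul_le D hKA hsec hp (D.le_bbd p.1 hp p.2) H
    have h1 : ∑ i, ∑ j, D.Bbd p.2 i j * (D.bbd p.2 i * D.bbd p.2 j) ≤ D.f p.2 := by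
      rw [f_eq]
      linarith [sum_abd_nonneg D p.2, abs_nonneg (D.a₀ p.2)]
    have h2 := D.bilS_nonneg hp H
    calc _ ≤ t ^ 2 * (KA * D.f p.2 * D.bilS p H H) := by
          gcongr
          exact h.trans (by gcongr)
      _ = _ := by ring

variable {D}

theorem exists_abs_integrand_le : ∃ C : ℝ, 0 ≤ C ∧ ∀ (u v : Eucl n → ℝ) (G H : ℝ × Eucl n → Eucl n)
    (p : ℝ × Eucl n), p.1 ∈ Ioc (0 : ℝ) 1 → |D.integrand u v G H p| ≤
      C * (D.bilS p (G p) (G p) + D.bilS p (H p) (H p) + D.f p.2 * u p.2 ^ 2 +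
        D.f p.2 * v p.2 ^ 2) := by
  obtain ⟨KA, hKA, h⟩ := exists_sector (D := D)
  refine ⟨KA + 1, by positivity, fun u v G H p hp => ?_⟩
  obtain ⟨h1, h2, h3⟩ := h p hp
  have hg := D.bilS_nonneg hp (G p)
  have hh := D.bilS_nonneg hp (H p)
  have hf := f_nonneg D p.2
  have hu : 0 ≤ D.f p.2 * u p.2 ^ 2 := by positivity
  have hv : 0 ≤ D.f p.2 * v p.2 ^ 2 := by positivity
  have e1 := abs_le_of_sq_le_mul (by positivity) hh (h1 (G p) (H p))
  have e2 := abs_le_of_sq_le_mul (by positivity) hh (h2 (u p.2) (H p))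
  have e3 := abs_le_of_sq_le_mul (by positivity) hg (h3 (v p.2) (G p))
  unfold Coefficients.integrand
  refine (abs_add_three _ _ _).trans ?_
  nlinarith [mul_nonneg hKA.le hg, mul_nonneg hKA.le hh, mul_nonneg hKA.le hu,
    mul_nonneg hKA.le hv]

/-- The pointwise form of coercivity: the terms of lower order cost at most half of the principal
part and a multiple of `f u²`. -/
theorem exists_le_integrand_self : ∃ C : ℝ, 0 ≤ C ∧ ∀ (u : Eucl n → ℝ) (G : ℝ × Eucl n → Eucl n)
    (p : ℝ × Eucl n), p.1 ∈ Ioc (0 : ℝ) 1 →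
      1 / 2 * D.bilS p (G p) (G p) - C * (D.f p.2 * u p.2 ^ 2) ≤ D.integrand u u G G p := by
  obtain ⟨KA, hKA, h⟩ := exists_sector (D := D)
  refine ⟨2 * KA, by positivity, fun u G p hp => ?_⟩
  obtain ⟨-, h2, h3⟩ := h p hp
  have hg := D.bilS_nonneg hp (G p)
  have hf := f_nonneg D p.2
  have hu : 0 ≤ D.f p.2 * u p.2 ^ 2 := by positivity
  -- the weights `2` and `1/2` leave half of the principal part
  have e2 := abs_le_of_sq_le_mul (x := ∑ i, D.a p.1 p.2 i * u p.2 * G p i)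
    (a := 2 * (KA * (D.f p.2 * u p.2 ^ 2))) (b := 1 / 2 * D.bilS p (G p) (G p))
    (by positivity) (by positivity) ((h2 _ _).trans (le_of_eq (by ring)))
  have e3 := abs_le_of_sq_le_mul (x := ∑ i, D.b p.1 p.2 i * u p.2 * G p i)
    (a := 2 * (KA * (D.f p.2 * u p.2 ^ 2))) (b := 1 / 2 * D.bilS p (G p) (G p))
    (by positivity) (by positivity) ((h3 _ _).trans (le_of_eq (by ring)))
  have e1 : ∑ i, ∑ j, D.A p.1 p.2 i j * G p j * G p i = D.bilS p (G p) (G p) := by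
    rw [D.bilS_self]
    exact Finset.sum_congr rfl fun i _ => Finset.sum_congr rfl fun j _ => by ring
  unfold Coefficients.integrand
  rw [e1]
  have := (abs_le.1 e2).1
  have := (abs_le.1 e3).1
  linarith

theorem integrand_add_left {u u' w v : Eucl n → ℝ} {G G' W H : ℝ × Eucl n → Eucl n}
    {p : ℝ × Eucl n} (hw : w p.2 = u p.2 + u' p.2) (hW : W p = G p + G' p) :
    D.integrand w v W H p = D.integrand u v G H p + D.integrand u' v G' H p := by
  unfold Coefficients.integrand
  simp only [hw, hW, PiLp.add_apply, mul_add, add_mul, Finset.sum_add_distrib]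
  ring

theorem integrand_smul_left {u w v : Eucl n → ℝ} {G W H : ℝ × Eucl n → Eucl n}
    {p : ℝ × Eucl n} {c : ℝ} (hw : w p.2 = c * u p.2) (hW : W p = c • G p) :
    D.integrand w v W H p = c * D.integrand u v G H p := by
  unfold Coefficients.integrand
  simp only [hw, hW, PiLp.smul_apply, smul_eq_mul, mul_add, Finset.mul_sum]
  congr 1
  · congr 1
    · exact Finset.sum_congr rfl fun i _ => Finset.sum_congr rfl fun j _ => by ring
    · exact Finset.sum_congr rfl fun i _ => by ring
  · exact Finset.sum_congr rfl fun i _ => by ring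

theorem integrand_add_right {u w v v' : Eucl n → ℝ} {G W H H' : ℝ × Eucl n → Eucl n}
    {p : ℝ × Eucl n} (hw : w p.2 = v p.2 + v' p.2) (hW : W p = H p + H' p) :
    D.integrand u w G W p = D.integrand u v G H p + D.integrand u v' G H' p := by
  unfold Coefficients.integrand
  simp only [hw, hW, PiLp.add_apply, mul_add, add_mul, Finset.sum_add_distrib]
  ring

theorem integrand_smul_right {u w v : Eucl n → ℝ} {G W H : ℝ × Eucl n → Eucl n}
    {p : ℝ × Eucl n} {c : ℝ} (hw : w p.2 = c * v p.2) (hW : W p = c • H p) :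
    D.integrand u w G W p = c * D.integrand u v G H p := by
  unfold Coefficients.integrand
  simp only [hw, hW, PiLp.smul_apply, smul_eq_mul, mul_add, Finset.mul_sum]
  congr 1
  · congr 1
    · exact Finset.sum_congr rfl fun i _ => Finset.sum_congr rfl fun j _ => by ring
    · exact Finset.sum_congr rfl fun i _ => by ring
  · exact Finset.sum_congr rfl fun i _ => by ring

/-- The integrand of `𝓛*` is that of `𝓛` with the arguments exchanged. -/
theorem integrandStar_eq (u v : Eucl n → ℝ) (G H : ℝ × Eucl n → Eucl n) :
    D.integrandStar u v G H = D.integrand v u H G := by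
  funext p
  unfold Coefficients.integrand Coefficients.integrandStar
  rw [Finset.sum_comm]
  have : ∀ i j, D.A p.1 p.2 i j * G p i * H p j = D.A p.1 p.2 i j * H p j * G p i :=
    fun i j => by ring
  simp only [this]
  ring

theorem aestronglyMeasurable_integrand {u v : Eucl n → ℝ} {G H : ℝ × Eucl n → Eucl n}
    (hu : AEMeasurable u) (hv : AEMeasurable v) (hG : AEMeasurable G D.prodMeas)
    (hH : AEMeasurable H D.prodMeas) :
    AEStronglyMeasurable (D.integrand u v G H) D.prodMeas := by
  have hc : ∀ {F : ℝ × Eucl n → Eucl n} (_ : AEMeasurable F D.prodMeas) (i : Fin n),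
      AEMeasurable (fun p => F p i) D.prodMeas := fun hF i =>
    (EuclideanSpace.proj (𝕜 := ℝ) i).continuous.measurable.comp_aemeasurable hF
  have hs : ∀ {w : Eucl n → ℝ} (_ : AEMeasurable w),
      AEMeasurable (fun p : ℝ × Eucl n => w p.2) D.prodMeas := fun hw =>
    hw.comp_quasiMeasurePreserving Measure.quasiMeasurePreserving_snd
  apply AEMeasurable.aestronglyMeasurable
  refine (AEMeasurable.add ?_ ?_).add ?_
  · exact Finset.aemeasurable_fun_sum _ fun i _ => Finset.aemeasurable_fun_sum _ fun j _ =>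
      ((D.aemeasurable_A i j).mul (hc hG j)).mul (hc hH i)
  · exact Finset.aemeasurable_fun_sum _ fun i _ =>
      ((D.aemeasurable_a i).mul (hs hu)).mul (hc hH i)
  · exact Finset.aemeasurable_fun_sum _ fun i _ =>
      ((D.aemeasurable_b i).mul (hs hv)).mul (hc hG i)

end Forms

/-! ### The bounded forms on `H⁰(𝒜, Ω)` -/

section Operators

variable {n : ℕ} {D : Coefficients n} {Ω : TopologicalSpace.Opens (Eucl n)}

/-- Compact boundedness of `f` passes from test functions to `H⁰(𝒜, Ω)` by Fatou's lemma. -/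
theorem exists_setLIntegral_f_mul_sq_le (hn : 1 ≤ n)
    (hΩ : Bornology.IsBounded (Ω : Set (Eucl n))) (hf : D.CompactlyBounded Ω D.f) {ε : ℝ}
    (hε : 0 < ε) : ∃ K : ℝ, 0 ≤ K ∧ ∀ U : D.H0 Ω,
      ∫⁻ x in Ω, ENNReal.ofReal (D.f x * toFunctionL1 D Ω U x ^ 2) ≤
        ENNReal.ofReal (ε * ‖U‖ ^ 2 + K * ‖toFunctionL1 D Ω U‖ ^ 2) := by
  obtain ⟨-, hfm, hfK⟩ := hf
  obtain ⟨K, hK, h⟩ := hfK ε hε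
  refine ⟨K, hK, fun U => ?_⟩
  obtain ⟨φ, hφ, hae⟩ := exists_seq_tendsto hn hΩ U
  have hlim : Tendsto (fun k => ENNReal.ofReal (ε * ‖toH0 D Ω (φ k)‖ ^ 2 +
      K * ‖toFunctionL1 D Ω (toH0 D Ω (φ k))‖ ^ 2)) atTop
      (𝓝 (ENNReal.ofReal (ε * ‖U‖ ^ 2 + K * ‖toFunctionL1 D Ω U‖ ^ 2))) := by
    have hc : Continuous fun U : D.H0 Ω =>
        ENNReal.ofReal (ε * ‖U‖ ^ 2 + K * ‖toFunctionL1 D Ω U‖ ^ 2) :=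
      ENNReal.continuous_ofReal.comp (by fun_prop)
    exact (hc.tendsto U).comp hφ
  have hk : ∀ k, ∫⁻ x in Ω, ENNReal.ofReal (D.f x * φ k x ^ 2) ≤
      ENNReal.ofReal (ε * ‖toH0 D Ω (φ k)‖ ^ 2 +
        K * ‖toFunctionL1 D Ω (toH0 D Ω (φ k))‖ ^ 2) := by
    intro k
    refine (h (φ k)).trans ?_
    rw [ENNReal.ofReal_add (by positivity) (by positivity), ENNReal.ofReal_mul hε.le,
      ENNReal.ofReal_mul hK, norm_sq_toH0, toFunctionL1_toH0 hn hΩ,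
      ENNReal.ofReal_pow (norm_nonneg _), ofReal_norm_testToL1]
    gcongr
    · exact le_rfl
    · exact Measure.restrict_le_self
  calc _ = ∫⁻ x in Ω, liminf (fun k => ENNReal.ofReal (D.f x * φ k x ^ 2)) atTop := by
        refine lintegral_congr_ae (ae_restrict_of_ae ?_)
        filter_upwards [hae] with x hx
        exact ((ENNReal.continuous_ofReal.tendsto _).comp ((hx.pow 2).const_mul _)).liminf_eq.symm
    _ ≤ liminf (fun k => ∫⁻ x in Ω, ENNReal.ofReal (D.f x * φ k x ^ 2)) atTop :=
        lintegral_liminf_le' fun k => (hfm.mul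
          (((φ k).contDiff.continuous.measurable.pow_const 2).aemeasurable)).ennreal_ofReal
    _ ≤ liminf (fun k => ENNReal.ofReal (ε * ‖toH0 D Ω (φ k)‖ ^ 2 +
        K * ‖toFunctionL1 D Ω (toH0 D Ω (φ k))‖ ^ 2)) atTop :=
        liminf_le_liminf (Eventually.of_forall hk)
    _ = _ := hlim.liminf_eq

theorem integrableOn_f_mul_sq (hn : 1 ≤ n) (hΩ : Bornology.IsBounded (Ω : Set (Eucl n)))
    (hf : D.CompactlyBounded Ω D.f) (U : D.H0 Ω) :
    IntegrableOn (fun x => D.f x * toFunctionL1 D Ω U x ^ 2) Ω := by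
  obtain ⟨K, -, h⟩ := exists_setLIntegral_f_mul_sq_le hn hΩ hf one_pos
  refine ⟨(hf.2.1.mul
    ((Lp.aestronglyMeasurable (toFunctionL1 D Ω U)).aemeasurable.restrict.pow_const
    2)).aestronglyMeasurable, ?_⟩
  rw [hasFiniteIntegral_iff_ofReal
    (Eventually.of_forall fun x => mul_nonneg (f_nonneg D x) (sq_nonneg _))]
  exact (h U).trans_lt ENNReal.ofReal_lt_top

theorem exists_setIntegral_f_mul_sq_le (hn : 1 ≤ n)
    (hΩ : Bornology.IsBounded (Ω : Set (Eucl n))) (hf : D.CompactlyBounded Ω D.f) {ε : ℝ}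
    (hε : 0 < ε) : ∃ K : ℝ, 0 ≤ K ∧ ∀ U : D.H0 Ω,
      ∫ x in Ω, D.f x * toFunctionL1 D Ω U x ^ 2 ≤
        ε * ‖U‖ ^ 2 + K * ‖toFunctionL1 D Ω U‖ ^ 2 := by
  obtain ⟨K, hK, h⟩ := exists_setLIntegral_f_mul_sq_le hn hΩ hf hε
  refine ⟨K, hK, fun U => ?_⟩
  rw [← ENNReal.ofReal_le_ofReal_iff (by positivity), ofReal_integral_eq_lintegral_ofReal
    (integrableOn_f_mul_sq hn hΩ hf U)
    (Eventually.of_forall fun x => mul_nonneg (f_nonneg D x) (sq_nonneg _))]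
  exact h U

theorem exists_setIntegral_f_mul_sq_le_norm (hn : 1 ≤ n)
    (hΩ : Bornology.IsBounded (Ω : Set (Eucl n))) (hf : D.CompactlyBounded Ω D.f) :
    ∃ C : ℝ, 0 ≤ C ∧ ∀ U : D.H0 Ω,
      ∫ x in Ω, D.f x * toFunctionL1 D Ω U x ^ 2 ≤ C * ‖U‖ ^ 2 := by
  obtain ⟨K, hK, h⟩ := exists_setIntegral_f_mul_sq_le hn hΩ hf one_pos
  refine ⟨1 + K * ‖toFunctionL1 D Ω‖ ^ 2, by positivity, fun U => (h U).trans ?_⟩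
  calc _ ≤ 1 * ‖U‖ ^ 2 + K * (‖toFunctionL1 D Ω‖ * ‖U‖) ^ 2 := by
        gcongr
        exact (toFunctionL1 D Ω).le_opNorm U
    _ = _ := by ring

theorem abs_mul_mul_le {w f : ℝ} (h : |w| ≤ f) (s t : ℝ) : |w * s * t| ≤ f * s ^ 2 + f * t ^ 2 := by
  rw [abs_mul, abs_mul, ← sq_abs s, ← sq_abs t]
  have hf : 0 ≤ f := (abs_nonneg w).trans h
  calc |w| * |s| * |t| ≤ f * |s| * |t| := by gcongr
    _ = f * (|s| * |t|) := by ring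
    _ ≤ f * (|s| ^ 2 + |t| ^ 2) := by
        gcongr
        nlinarith [sq_nonneg (|s| - |t|), sq_nonneg |s|, sq_nonneg |t|]
    _ = _ := by ring

theorem integrableOn_weight_mul (hn : 1 ≤ n) (hΩ : Bornology.IsBounded (Ω : Set (Eucl n)))
    (hf : D.CompactlyBounded Ω D.f) {w : Eucl n → ℝ} (hwm : AEMeasurable w (volume.restrict Ω))
    (hw : ∀ x, |w x| ≤ D.f x) (U V : D.H0 Ω) :
    IntegrableOn (fun x => w x * toFunctionL1 D Ω U x * toFunctionL1 D Ω V x) Ω := by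
  have hm : ∀ U : D.H0 Ω, AEMeasurable (toFunctionL1 D Ω U) (volume.restrict Ω) := fun U =>
    (Lp.aestronglyMeasurable (toFunctionL1 D Ω U)).aemeasurable.restrict
  refine ((integrableOn_f_mul_sq hn hΩ hf U).add (integrableOn_f_mul_sq hn hΩ hf V)).mono'
    ((hwm.mul (hm U)).mul (hm V)).aestronglyMeasurable (Eventually.of_forall fun x => ?_)
  exact abs_mul_mul_le (hw x) _ _

theorem abs_setIntegral_weight_mul_le (hn : 1 ≤ n) (hΩ : Bornology.IsBounded (Ω : Set (Eucl n)))
    (hf : D.CompactlyBounded Ω D.f) {w : Eucl n → ℝ} (hw : ∀ x, |w x| ≤ D.f x) (U V : D.H0 Ω) :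
    |∫ x in Ω, w x * toFunctionL1 D Ω U x * toFunctionL1 D Ω V x| ≤
      (∫ x in Ω, D.f x * toFunctionL1 D Ω U x ^ 2) +
        ∫ x in Ω, D.f x * toFunctionL1 D Ω V x ^ 2 := by
  have hU := integrableOn_f_mul_sq hn hΩ hf U
  have hV := integrableOn_f_mul_sq hn hΩ hf V
  rw [← integral_add hU hV, ← Real.norm_eq_abs]
  refine norm_integral_le_of_norm_le (hU.add hV) (Eventually.of_forall fun x => ?_)
  exact abs_mul_mul_le (hw x) _ _

theorem toFunctionL1_add_ae (U V : D.H0 Ω) : ∀ᵐ x, toFunctionL1 D Ω (U + V) x =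
    toFunctionL1 D Ω U x + toFunctionL1 D Ω V x := by
  rw [map_add]
  exact Lp.coeFn_add _ _

theorem toFunctionL1_smul_ae (c : ℝ) (U : D.H0 Ω) : ∀ᵐ x, toFunctionL1 D Ω (c • U) x =
    c * toFunctionL1 D Ω U x := by
  rw [map_smul]
  exact Lp.coeFn_smul _ _

theorem grad_add_ae (U V : D.H0 Ω) :
    ∀ᵐ p ∂D.prodMeas, (U + V).grad p = U.grad p + V.grad p :=
  AEEqFun.coeFn_add U.1.1 V.1.1

theorem grad_smul_ae (c : ℝ) (U : D.H0 Ω) :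
    ∀ᵐ p ∂D.prodMeas, (c • U).grad p = c • U.grad p :=
  AEEqFun.coeFn_smul c U.1.1

/-- The operator `(u, v) ↦ ∫_Ω w u v` for a weight `w` dominated by `f`. -/
theorem exists_weight_form (hn : 1 ≤ n) (hΩ : Bornology.IsBounded (Ω : Set (Eucl n)))
    (hf : D.CompactlyBounded Ω D.f) {w : Eucl n → ℝ} (hwm : AEMeasurable w (volume.restrict Ω))
    (hw : ∀ x, |w x| ≤ D.f x) : ∃ J : D.H0 Ω →L[ℝ] StrongDual ℝ (D.H0 Ω), ∀ U V,
      J U V = ∫ x in Ω, w x * toFunctionL1 D Ω U x * toFunctionL1 D Ω V x := by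
  obtain ⟨C, hC, hCU⟩ := exists_setIntegral_f_mul_sq_le_norm hn hΩ hf
  have hi := integrableOn_weight_mul hn hΩ hf hwm hw
  refine exists_clm_of_bilinear (C := C) ?_ ?_ ?_ ?_ ?_
  · intro U U' V
    rw [← integral_add (hi U V) (hi U' V)]
    refine integral_congr_ae (ae_restrict_of_ae ?_)
    filter_upwards [toFunctionL1_add_ae U U'] with x hx
    rw [hx]
    ring
  · intro c U V
    rw [← integral_const_mul]
    refine integral_congr_ae (ae_restrict_of_ae ?_)
    filter_upwards [toFunctionL1_smul_ae c U] with x hx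
    rw [hx]
    ring
  · intro U V V'
    rw [← integral_add (hi U V) (hi U V')]
    refine integral_congr_ae (ae_restrict_of_ae ?_)
    filter_upwards [toFunctionL1_add_ae V V'] with x hx
    rw [hx]
    ring
  · intro c U V
    rw [← integral_const_mul]
    refine integral_congr_ae (ae_restrict_of_ae ?_)
    filter_upwards [toFunctionL1_smul_ae c V] with x hx
    rw [hx]
    ring
  · intro U V
    refine (abs_setIntegral_weight_mul_le hn hΩ hf hw U V).trans ?_
    linarith [hCU U, hCU V]

theorem integrable_bilS_grad (U : D.H0 Ω) :
    Integrable (fun p => D.bilS p (U.grad p) (U.grad p)) D.prodMeas := U.1.2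

theorem integral_bilS_grad (U : D.H0 Ω) :
    ∫ p, D.bilS p (U.grad p) (U.grad p) ∂D.prodMeas = ‖U‖ ^ 2 :=
  (norm_sq_eq_integral U.1).symm

/-- Since `u` vanishes off `Ω`, the integrals of `f u²` over `Ω` and over `ℝⁿ` agree. -/
theorem integral_prodMeas_f_mul_sq (hn : 1 ≤ n) (hΩ : Bornology.IsBounded (Ω : Set (Eucl n)))
    (hf : D.CompactlyBounded Ω D.f) (U : D.H0 Ω) :
    Integrable (fun p : ℝ × Eucl n => D.f p.2 * toFunctionL1 D Ω U p.2 ^ 2) D.prodMeas ∧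
      ∫ p, D.f p.2 * toFunctionL1 D Ω U p.2 ^ 2 ∂D.prodMeas =
        D.μ.real univ * ∫ x in Ω, D.f x * toFunctionL1 D Ω U x ^ 2 := by
  have h0 : ∀ᵐ x, x ∉ (Ω : Set (Eucl n)) → D.f x * toFunctionL1 D Ω U x ^ 2 = 0 := by
    filter_upwards [toFunctionL1_eq_zero hn hΩ U] with x hx hxΩ
    rw [hx hxΩ]
    ring
  have hI : Integrable fun x => D.f x * toFunctionL1 D Ω U x ^ 2 := by
    refine ((integrableOn_f_mul_sq hn hΩ hf U).integrable_indicator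
      Ω.isOpen.measurableSet).congr ?_
    filter_upwards [h0] with x hx
    by_cases hxΩ : x ∈ (Ω : Set (Eucl n))
    · rw [indicator_of_mem hxΩ]
    · rw [indicator_of_notMem hxΩ, hx hxΩ]
  refine ⟨hI.comp_snd D.μ, ?_⟩
  rw [integral_fun_snd (fun x => D.f x * toFunctionL1 D Ω U x ^ 2), smul_eq_mul,
    setIntegral_eq_integral_of_ae_compl_eq_zero h0]

theorem integrable_integrand (hn : 1 ≤ n) (hΩ : Bornology.IsBounded (Ω : Set (Eucl n)))
    (hf : D.CompactlyBounded Ω D.f) (U V : D.H0 Ω) :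
    Integrable (D.integrand (toFunctionL1 D Ω U) (toFunctionL1 D Ω V) U.grad V.grad)
      D.prodMeas := by
  obtain ⟨C, -, h⟩ := exists_abs_integrand_le (D := D)
  have hm : ∀ U : D.H0 Ω, AEMeasurable (toFunctionL1 D Ω U) := fun U =>
    (Lp.aestronglyMeasurable (toFunctionL1 D Ω U)).aemeasurable
  have hg : ∀ U : D.H0 Ω, AEMeasurable U.grad D.prodMeas := fun U => U.1.1.aemeasurable
  refine (((((integrable_bilS_grad U).add (integrable_bilS_grad V)).add
    (integral_prodMeas_f_mul_sq hn hΩ hf U).1).add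
    (integral_prodMeas_f_mul_sq hn hΩ hf V).1).const_mul C).mono'
    (aestronglyMeasurable_integrand (hm U) (hm V) (hg U) (hg V)) ?_
  filter_upwards [D.ae_mem] with p hp
  exact h _ _ _ _ p hp

theorem exists_abs_integral_integrand_le (hn : 1 ≤ n)
    (hΩ : Bornology.IsBounded (Ω : Set (Eucl n))) (hf : D.CompactlyBounded Ω D.f) :
    ∃ C : ℝ, ∀ U V : D.H0 Ω,
      |∫ p, D.integrand (toFunctionL1 D Ω U) (toFunctionL1 D Ω V) U.grad V.grad p ∂D.prodMeas| ≤
        C * (‖U‖ ^ 2 + ‖V‖ ^ 2) := by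
  obtain ⟨C, hC, h⟩ := exists_abs_integrand_le (D := D)
  obtain ⟨C', hC', hCU⟩ := exists_setIntegral_f_mul_sq_le_norm hn hΩ hf
  set m := D.μ.real univ with hm
  have hm0 : 0 ≤ m := measureReal_nonneg
  refine ⟨C * (1 + m * C'), fun U V => ?_⟩
  have hU := integrable_bilS_grad U
  have hV := integrable_bilS_grad V
  obtain ⟨hU1, hU2⟩ := integral_prodMeas_f_mul_sq hn hΩ hf U
  obtain ⟨hV1, hV2⟩ := integral_prodMeas_f_mul_sq hn hΩ hf V
  have hI : Integrable (fun p : ℝ × Eucl n => C * (D.bilS p (U.grad p) (U.grad p) +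
      D.bilS p (V.grad p) (V.grad p) + D.f p.2 * toFunctionL1 D Ω U p.2 ^ 2 +
      D.f p.2 * toFunctionL1 D Ω V p.2 ^ 2)) D.prodMeas :=
    (((hU.add hV).add hU1).add hV1).const_mul C
  calc _ ≤ ∫ p, C * (D.bilS p (U.grad p) (U.grad p) +
      D.bilS p (V.grad p) (V.grad p) + D.f p.2 * toFunctionL1 D Ω U p.2 ^ 2 +
      D.f p.2 * toFunctionL1 D Ω V p.2 ^ 2) ∂D.prodMeas := by
        rw [← Real.norm_eq_abs]
        refine norm_integral_le_of_norm_le hI ?_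
        filter_upwards [D.ae_mem] with p hp
        exact h _ _ _ _ p hp
    _ = C * (‖U‖ ^ 2 + ‖V‖ ^ 2 + m * (∫ x in Ω, D.f x * toFunctionL1 D Ω U x ^ 2) +
        m * ∫ x in Ω, D.f x * toFunctionL1 D Ω V x ^ 2) := by
        have hadd : ∀ {a b c d : ℝ × Eucl n → ℝ}, Integrable a D.prodMeas →
            Integrable b D.prodMeas → Integrable c D.prodMeas → Integrable d D.prodMeas →
            ∫ p, (a p + b p + c p + d p) ∂D.prodMeas = (∫ p, a p ∂D.prodMeas) +
              (∫ p, b p ∂D.prodMeas) + (∫ p, c p ∂D.prodMeas) + ∫ p, d p ∂D.prodMeas := by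
          intro a b c d ha hb hc hd
          rw [integral_add (f := fun p => a p + b p + c p) ((ha.add hb).add hc) hd,
            integral_add (f := fun p => a p + b p) (ha.add hb) hc, integral_add ha hb]
        rw [integral_const_mul, hadd hU hV hU1 hV1, hU2, hV2, integral_bilS_grad,
          integral_bilS_grad]
    _ ≤ C * (‖U‖ ^ 2 + ‖V‖ ^ 2 + m * (C' * ‖U‖ ^ 2) + m * (C' * ‖V‖ ^ 2)) := by
        gcongr
        · exact hCU U
        · exact hCU V
    _ = _ := by ring

/-- The part of `𝓛` that carries fractional gradients, as a bounded operator into the dual. -/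
theorem exists_integrand_form (hn : 1 ≤ n) (hΩ : Bornology.IsBounded (Ω : Set (Eucl n)))
    (hf : D.CompactlyBounded Ω D.f) : ∃ J : D.H0 Ω →L[ℝ] StrongDual ℝ (D.H0 Ω), ∀ U V,
      J U V = ∫ p, D.integrand (toFunctionL1 D Ω U) (toFunctionL1 D Ω V) U.grad V.grad p
        ∂D.prodMeas := by
  obtain ⟨C, hC⟩ := exists_abs_integral_integrand_le hn hΩ hf
  have hi := integrable_integrand hn hΩ hf
  have hsnd : ∀ {P : Eucl n → Prop}, (∀ᵐ x, P x) → ∀ᵐ p ∂D.prodMeas, P p.2 := fun h =>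
    Measure.quasiMeasurePreserving_snd.ae h
  refine exists_clm_of_bilinear ?_ ?_ ?_ ?_ hC
  · intro U U' V
    rw [← integral_add (hi U V) (hi U' V)]
    refine integral_congr_ae ?_
    filter_upwards [hsnd (toFunctionL1_add_ae U U'), grad_add_ae U U'] with p h1 h2
    exact integrand_add_left h1 h2
  · intro c U V
    rw [← integral_const_mul]
    refine integral_congr_ae ?_
    filter_upwards [hsnd (toFunctionL1_smul_ae c U), grad_smul_ae c U] with p h1 h2
    exact integrand_smul_left h1 h2
  · intro U V V'
    rw [← integral_add (hi U V) (hi U V')]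
    refine integral_congr_ae ?_
    filter_upwards [hsnd (toFunctionL1_add_ae V V'), grad_add_ae V V'] with p h1 h2
    exact integrand_add_right h1 h2
  · intro c U V
    rw [← integral_const_mul]
    refine integral_congr_ae ?_
    filter_upwards [hsnd (toFunctionL1_smul_ae c V), grad_smul_ae c V] with p h1 h2
    exact integrand_smul_right h1 h2

/-- Gårding's inequality. -/
theorem exists_le_integral_integrand_self (hn : 1 ≤ n)
    (hΩ : Bornology.IsBounded (Ω : Set (Eucl n))) (hf : D.CompactlyBounded Ω D.f) :
    ∃ C : ℝ, ∀ U : D.H0 Ω, 1 / 2 * ‖U‖ ^ 2 -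
      C * (∫ x in Ω, D.f x * toFunctionL1 D Ω U x ^ 2) ≤
        ∫ p, D.integrand (toFunctionL1 D Ω U) (toFunctionL1 D Ω U) U.grad U.grad p
          ∂D.prodMeas := by
  obtain ⟨C, hC, h⟩ := exists_le_integrand_self (D := D)
  refine ⟨C * D.μ.real univ, fun U => ?_⟩
  obtain ⟨hU1, hU2⟩ := integral_prodMeas_f_mul_sq hn hΩ hf U
  have hU := integrable_bilS_grad U
  calc _ = ∫ p, (1 / 2 * D.bilS p (U.grad p) (U.grad p) -
        C * (D.f p.2 * toFunctionL1 D Ω U p.2 ^ 2)) ∂D.prodMeas := by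
        rw [integral_sub (hU.const_mul _) (hU1.const_mul _), integral_const_mul,
          integral_const_mul, hU2, integral_bilS_grad]
        ring
    _ ≤ _ := by
        refine integral_mono_ae ((hU.const_mul _).sub (hU1.const_mul _))
          (integrable_integrand hn hΩ hf U U) ?_
        filter_upwards [D.ae_mem] with p hp
        exact h _ _ p hp

end Operators

end NonlocalFredholm

open NonlocalFredholm

theorem theorem1p2 {n : ℕ} (hn : 1 ≤ n) (D : NonlocalFredholm.Coefficients n)
    (Ω : TopologicalSpace.Opens (NonlocalFredholm.Eucl n))
    (hΩ : Bornology.IsBounded (Ω : Set (NonlocalFredholm.Eucl n)))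
    (ha₀ : AEMeasurable D.a₀ (volume.restrict Ω))
    (hf : D.CompactlyBounded Ω D.f) :
    -- `ι` reads the elements of `H⁰(𝒜, Ω)` as functions on `ℝⁿ`; `L`, `Lstar` and `I` are the
    -- operators `𝓛`, `𝓛*` and `𝓘(f)` from `H⁰(𝒜, Ω)` to its dual
    ∃ (ι : D.H0 Ω →L[ℝ] Lp ℝ 1 (volume : Measure (NonlocalFredholm.Eucl n)))
      (L Lstar I : D.H0 Ω →L[ℝ] StrongDual ℝ (D.H0 Ω)),
      Function.Injective ι ∧
      (∀ φ : 𝓓(Ω, ℝ), ∃ U : D.H0 Ω,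
        (U.grad =ᵐ[D.prodMeas] fun p => NonlocalFredholm.fracGrad p.1 φ p.2) ∧
        ι U =ᵐ[volume] φ) ∧
      (∀ U V : D.H0 Ω,
        Integrable (D.integrand (ι U) (ι V) U.grad V.grad) D.prodMeas ∧
        IntegrableOn (fun x => D.a₀ x * ι U x * ι V x) Ω ∧
        L U V = (∫ p, D.integrand (ι U) (ι V) U.grad V.grad p ∂D.prodMeas) +
          (∫ x in Ω, D.a₀ x * ι U x * ι V x)) ∧
      (∀ U V : D.H0 Ω,
        Integrable (D.integrandStar (ι U) (ι V) U.grad V.grad) D.prodMeas ∧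
        Lstar U V = (∫ p, D.integrandStar (ι U) (ι V) U.grad V.grad p ∂D.prodMeas) +
          (∫ x in Ω, D.a₀ x * ι U x * ι V x)) ∧
      (∀ U V : D.H0 Ω,
        IntegrableOn (fun x => D.f x * ι U x * ι V x) Ω ∧
        I U V = ∫ x in Ω, D.f x * ι U x * ι V x) ∧
      ∃ (σ₀ : ℝ) (S : Set ℝ), S.Countable ∧ (∀ σ : ℝ, ¬ AccPt σ (𝓟 S)) ∧ S ⊆ Iio σ₀ ∧
        (∀ σ ∉ S, Function.Bijective (L + σ • I)) ∧
        (∀ σ ∈ S,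
          (L + σ • I).toLinearMap.ker ≠ ⊥ ∧ (Lstar + σ • I).toLinearMap.ker ≠ ⊥ ∧
          FiniteDimensional ℝ (L + σ • I).toLinearMap.ker ∧
          FiniteDimensional ℝ (Lstar + σ • I).toLinearMap.ker ∧
          Module.finrank ℝ (L + σ • I).toLinearMap.ker =
            Module.finrank ℝ (Lstar + σ • I).toLinearMap.ker) ∧
        (∀ (σ : ℝ) (T : StrongDual ℝ (D.H0 Ω)),
          (∃ U : D.H0 Ω, (L + σ • I) U = T) ↔
            ∀ W : D.H0 Ω, (Lstar + σ • I) W = 0 → T W = 0) := by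
  obtain ⟨J, hJ⟩ := exists_integrand_form hn hΩ hf
  obtain ⟨J₀, hJ₀⟩ := exists_weight_form hn hΩ hf ha₀ (abs_a₀_le_f D)
  obtain ⟨I, hI⟩ := exists_weight_form hn hΩ hf hf.2.1 fun x => (abs_of_nonneg (f_nonneg D x)).le
  have hIself : ∀ U, I U U = ∫ x in Ω, D.f x * toFunctionL1 D Ω U x ^ 2 := fun U => by
    simp only [hI, mul_assoc, pow_two]
  obtain ⟨C, hC⟩ := exists_le_integral_integrand_self hn hΩ hf
  -- coercivity: the terms of lower order are absorbed by a multiple of `𝓘(f)`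
  have hcoer : ∀ U, 1 / 2 * ‖U‖ ^ 2 ≤ (J + J₀) U U + (C + 2) * I U U := fun U => by
    have h1 := hC U
    have h2 := abs_setIntegral_weight_mul_le hn hΩ hf (abs_a₀_le_f D) U U
    rw [← hJ] at h1
    rw [← hJ₀] at h2
    rw [← hIself] at h1 h2
    have h3 := (abs_le.1 h2).1
    rw [add_apply, add_apply]
    linarith
  -- compactness of `𝓘(f)`
  have hcomp : ∀ ε > 0, ∃ V : Submodule ℝ (D.H0 Ω), FiniteDimensional ℝ V ∧
      ∀ U ∈ Vᗮ, I U U ≤ ε * ‖U‖ ^ 2 := by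
    intro ε hε
    obtain ⟨K, hK, hKU⟩ := exists_setIntegral_f_mul_sq_le hn hΩ hf (half_pos hε)
    obtain ⟨V, hV, hVU⟩ := exists_finiteDimensional_norm_toFunctionL1_le (D := D) hn hΩ
      (ε := √(ε / (2 * (K + 1)))) (by positivity)
    refine ⟨V, hV, fun U hU => ?_⟩
    have h1 : ‖toFunctionL1 D Ω U‖ ^ 2 ≤ ε / (2 * (K + 1)) * ‖U‖ ^ 2 := by
      calc _ ≤ (√(ε / (2 * (K + 1))) * ‖U‖) ^ 2 := by
            gcongr
            exact hVU U hU
        _ = _ := by rw [mul_pow, Real.sq_sqrt (by positivity)]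
    have h2 : K * (ε / (2 * (K + 1))) ≤ ε / 2 := by
      rw [mul_div_assoc', div_le_div_iff₀ (by positivity) two_pos]
      nlinarith
    calc I U U ≤ ε / 2 * ‖U‖ ^ 2 + K * ‖toFunctionL1 D Ω U‖ ^ 2 := by
          rw [hIself]
          exact hKU U
      _ ≤ ε / 2 * ‖U‖ ^ 2 + K * (ε / (2 * (K + 1)) * ‖U‖ ^ 2) := by gcongr
      _ = ε / 2 * ‖U‖ ^ 2 + K * (ε / (2 * (K + 1))) * ‖U‖ ^ 2 := by ring
      _ ≤ ε / 2 * ‖U‖ ^ 2 + ε / 2 * ‖U‖ ^ 2 := by gcongr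
      _ = ε * ‖U‖ ^ 2 := by ring
  have hIpos : ∀ U, 0 ≤ I U U := fun U => by
    rw [hIself]
    exact integral_nonneg fun x => mul_nonneg (f_nonneg D x) (sq_nonneg _)
  have hIsymm : ∀ U V, I U V = I V U := fun U V => by
    rw [hI, hI]
    refine integral_congr_ae (Eventually.of_forall fun x => ?_)
    exact mul_right_comm _ _ _
  obtain ⟨S, hS⟩ := fredholm_alternative_forms (J + J₀) (J + J₀).flip I (fun _ _ => rfl) hIsymm
    hIpos (by norm_num : (0 : ℝ) < 1 / 2) hcoer hcomp
  refine ⟨toFunctionL1 D Ω, J + J₀, (J + J₀).flip, I, toFunctionL1_injective hn hΩ,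
    fun φ => ⟨toH0 D Ω φ, toH0_grad_ae φ, ?_⟩,
    fun U V => ⟨integrable_integrand hn hΩ hf U V,
      integrableOn_weight_mul hn hΩ hf ha₀ (abs_a₀_le_f D) U V, ?_⟩,
    fun U V => ⟨?_, ?_⟩,
    fun U V => ⟨integrableOn_weight_mul hn hΩ hf hf.2.1
      (fun x => (abs_of_nonneg (f_nonneg D x)).le) U V, hI U V⟩, C + 2, S, hS⟩
  · rw [toFunctionL1_toH0 hn hΩ]
    exact testToL1_ae φ
  · rw [add_apply, add_apply, hJ, hJ₀]
  · rw [integrandStar_eq]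
    exact integrable_integrand hn hΩ hf V U
  · rw [integrandStar_eq, ContinuousLinearMap.flip_apply, add_apply, add_apply, hJ, hJ₀]
    congr 1
    refine integral_congr_ae (Eventually.of_forall fun x => ?_)
    exact mul_right_comm _ _ _
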